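/- Let $\mathbb D=\{z\in\mathbb C:|z|<1\}$ and $\alpha\in(1,2]$. Let $Co(\alpha)$ be the class of functions $f:\mathbb D\to\mathbb C$ such that (i) $f$ is analytic in $\mathbb D$ with $f(0)=0$, $f'(0)=1$, and $f(1)=\infty$, i.e. $|f(\zeta)|\to\infty$ as $\zeta\to1$ in $\mathbb D$; (ii) $f$ maps $\mathbb D$ conformally (injectively) onto a set whose complement $\mathbb C\setminus f(\mathbb D)$ is convex; (iii) the opening angle of $f(\mathbb D)$ at $\infty$, i.e. the Lebesgue measure of the set of $\theta\in(-\pi,\pi]$ such that $re^{i\theta}\in f(\mathbb D)$ for all sufficiently large $r>0$, is at most $\pi\alpha$. Write $T_f=f''/f'$. Theorem. Let $\alpha\in(1,2]$, let $a\in\mathbb C$ with $|a|\le1$, and let $z\in\mathbb D$. Then the set of variability $$\left\{(1-|z|^2)\,T_f(z)\;:\;f\in Co(\alpha),\ f''(0)=\alpha+1+(\alpha-1)a\right\}$$ is exactly the closed disk (a single point if the radius is $0$) with center $$2\overline z+(\alpha+1)\frac{1-\overline z}{1-z}+(\alpha-1)\frac{\overline z\,(1+|a|^2+\overline a\,\overline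 z)+a}{1+|z|^2+2\,\mathrm{Re}(az)}$$ and radius $$(\alpha-1)\frac{(1-|a|^2)\,|z|}{1+|z|^2+2\,\mathrm{Re}(az)}.$$ -/

import Mathlib

open Filter Topology MeasureTheory
open scoped ComplexConjugate

noncomputable section

/-- The open unit disk. -/
def unitDisk : Set ℂ := Metric.ball 0 1

/-- The pre-Schwarzian derivative `f'' / f'`. -/
def preSchwarzian (f : ℂ → ℂ) (z : ℂ) : ℂ := deriv (deriv f) z / deriv f z

/-- The opening angle at infinity of a plane domain `Ω`: the angular measure of the set of
directions `exp (i θ)`, `-π < θ ≤ π`, whose ray `{r exp (i θ)}` lies in `Ω` for all large `r`.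
If the complement of `Ω` is a nonempty closed convex set, this is `2π` minus the angle of the
cone of directions in which that convex set recedes to infinity; for a sector it is the angle of
the sector. -/
def openingAngleAtInfty (Ω : Set ℂ) : ℝ :=
  (volume {θ : ℝ | θ ∈ Set.Ioc (-Real.pi) Real.pi ∧
    ∀ᶠ r : ℝ in atTop, (r : ℂ) * Complex.exp (θ * Complex.I) ∈ Ω}).toReal

/-- The class `Co(α)` of concave univalent functions of the unit disk. Functions are total on `ℂ`,
but only their values on the disk matter. -/
structure IsConcaveUnivalent (α : ℝ) (f : ℂ → ℂ) : Prop where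
  analytic : DifferentiableOn ℂ f unitDisk
  map_zero : f 0 = 0
  deriv_zero : deriv f 0 = 1
  /-- `f(1) = ∞` -/
  pole : Tendsto f (𝓝[unitDisk] 1) (Bornology.cobounded ℂ)
  univalent : Set.InjOn f unitDisk
  convex_compl : Convex ℝ (f '' unitDisk)ᶜ
  opening_angle : openingAngleAtInfty (f '' unitDisk) ≤ Real.pi * α

/-- The center of the disk of variability. -/
def variabilityCenter (α : ℝ) (a z : ℂ) : ℂ :=
  2 * conj z + (α + 1) * (1 - conj z) / (1 - z) +
    (α - 1) * (conj z * (1 + (‖a‖ : ℂ) ^ 2 + conj a * conj z) + a) /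
      (1 + (‖z‖ : ℂ) ^ 2 + 2 * ((a * z).re : ℂ))

/-- The radius of the disk of variability. -/
def variabilityRadius (α : ℝ) (a z : ℂ) : ℝ :=
  (α - 1) * ((1 - ‖a‖ ^ 2) * ‖z‖) / (1 + ‖z‖ ^ 2 + 2 * (a * z).re)

end

open Filter Topology MeasureTheory
open scoped ComplexConjugate

noncomputable section

/-! ### Injective holomorphic functions -/

/-! The Cayley transform moves the problem to the right half plane: the boundary point `1` goes to
infinity and `f` becomes a conformal map `F` with `F → ∞` at `∞`.

Inclusion in the disk. For `k` in the convex complement, dilations centred at `k` map the image into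
itself. Conjugated by `F`, they are self-maps of the half plane; Schwarz-Pick, differentiated at
time `0`, with one point sent to infinity, gives `Re (F - k)/F' ≥ 0` (`re_div_deriv_nonneg`). A
sharp distance estimate at the boundary and the minimum principle turn this into
`re_twoPoint_nonneg`, whose limit along vertical lines is `Re F''/F' ≥ 0`. Directions of rays that
do not stay in the image are recession directions of the complement. They fill measure at least `2π
- πα`, and none makes an acute angle with any value of `F'`. So `arg F'` oscillates by at most `π(α
- 1)`, and `|F''/F'| Re ζ ≤ α - 1`. Schwarz-Pick for `q = F''/F'` between `ζ` and `N → ∞` sharpens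
this to `Re ζ |q|² ≤ (α - 1) Re q`. In the disk this reads `T_f = (α + 1)/(1 - z) + (α - 1) φ/(1 +
zφ)` with `|φ| ≤ 1` (`exists_schur`). The value `f''(0)` means `φ(0) = a`, so Schwarz-Pick confines
`φ(z)` to a disk, which a Möbius map carries into the stated one.

Equality. For a probability measure with masses `t_j` at unimodular `e_j`, a product of powers `∏ (ζ
+ i c_j)^{μ_j}` serves as `F'`, up to a constant. Its argument increases along vertical lines, so
the image is a union of tangent half planes (`mem_image_iff`) and its complement is convex.
Two-point measures, coming from `φ = (a + cz)/(1 + \bar a cz)` with `|c| = 1`, reach the whole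
boundary circle. Since `T_f` and `f''(0)` are affine in the measure, mixing the measures of two
antipodal boundary points reaches every point of the disk. -/

theorem image_mem_nhds_of_injOn {F : ℂ → ℂ} {U V : Set ℂ} {z : ℂ} (hU : IsOpen U)
    (hF : DifferentiableOn ℂ F U) (hinj : Set.InjOn F U) (hz : z ∈ U) (hV : V ∈ 𝓝 z) :
    F '' V ∈ 𝓝 (F z) := by
  have han : AnalyticAt ℂ F z := hF.analyticAt (hU.mem_nhds hz)
  rcases han.eventually_constant_or_nhds_le_map_nhds with h | h
  · exfalso
    have h1 : ∀ᶠ w in 𝓝[≠] z, F w = F z ∧ w ∈ U :=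
      (h.and (hU.mem_nhds hz)).filter_mono nhdsWithin_le_nhds
    obtain ⟨w, ⟨hw, hwU⟩, hwz⟩ := (h1.and self_mem_nhdsWithin).exists
    exact hwz (hinj hwU hz hw)
  · exact h (image_mem_map hV)

theorem isOpen_image_of_injOn {F : ℂ → ℂ} {U : Set ℂ} (hU : IsOpen U)
    (hF : DifferentiableOn ℂ F U) (hinj : Set.InjOn F U) : IsOpen (F '' U) := by
  rw [isOpen_iff_mem_nhds]
  rintro _ ⟨z, hz, rfl⟩
  exact image_mem_nhds_of_injOn hU hF hinj hz (hU.mem_nhds hz)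

theorem continuousAt_leftInverse {F G : ℂ → ℂ} {U : Set ℂ} {z : ℂ} (hU : IsOpen U)
    (hF : DifferentiableOn ℂ F U) (hG : ∀ z ∈ U, G (F z) = z) (hz : z ∈ U) :
    ContinuousAt G (F z) := by
  have hinj : Set.InjOn F U := fun a ha b hb h => by rw [← hG a ha, h, hG b hb]
  intro V hV
  rw [hG z hz] at hV
  have := image_mem_nhds_of_injOn hU hF hinj hz (inter_mem hV (hU.mem_nhds hz))
  refine mem_map.2 (mem_of_superset this ?_)
  rintro _ ⟨w, ⟨hwV, hwU⟩, rfl⟩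
  simpa [hG w hwU] using hwV

theorem eventually_right_inverse {F G : ℂ → ℂ} {U : Set ℂ} {z : ℂ} (hU : IsOpen U)
    (hF : DifferentiableOn ℂ F U) (hG : ∀ z ∈ U, G (F z) = z) (hz : z ∈ U) :
    ∀ᶠ w in 𝓝 (F z), G w ∈ U ∧ F (G w) = w := by
  have hinj : Set.InjOn F U := fun a ha b hb h => by rw [← hG a ha, h, hG b hb]
  refine mem_of_superset (image_mem_nhds_of_injOn hU hF hinj hz (hU.mem_nhds hz)) ?_
  rintro _ ⟨w, hw, rfl⟩
  simp [hG w hw, hw]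

/-- Zeros of `F'` are isolated, so `G` is differentiable near `F z` except perhaps at `F z`. Being
continuous there, it is differentiable there too, and the chain rule gives `G' F' = 1`. -/
theorem deriv_ne_zero_of_leftInverse {F G : ℂ → ℂ} {U : Set ℂ} {z : ℂ} (hU : IsOpen U)
    (hF : DifferentiableOn ℂ F U) (hG : ∀ z ∈ U, G (F z) = z) (hz : z ∈ U) :
    deriv F z ≠ 0 := by
  have hinj : Set.InjOn F U := fun a ha b hb h => by rw [← hG a ha, h, hG b hb]
  have hdiff : ∀ w ∈ U, DifferentiableAt ℂ F w := fun w hw => hF.differentiableAt (hU.mem_nhds hw)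
  have han : AnalyticAt ℂ (deriv F) z := (hF.analyticAt (hU.mem_nhds hz)).deriv
  have hcont := continuousAt_leftInverse hU hF hG hz
  have hne : ∀ᶠ w in 𝓝[≠] z, deriv F w ≠ 0 := by
    rcases han.eventually_eq_zero_or_eventually_ne_zero with h | h
    · exfalso
      obtain ⟨r, hr, hball⟩ := Metric.mem_nhds_iff.1 (inter_mem h (hU.mem_nhds hz))
      have hconst : ∀ w ∈ Metric.ball z r, F w = F z := fun w hw =>
        Metric.isOpen_ball.is_const_of_deriv_eq_zero (convex_ball z r).isPreconnected
          (hF.mono fun x hx => (hball hx).2) (fun x hx => (hball hx).1) hw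
          (Metric.mem_ball_self hr)
      have : ∀ᶠ w in 𝓝[≠] z, w ∈ Metric.ball z r :=
        nhdsWithin_le_nhds (Metric.ball_mem_nhds z hr)
      obtain ⟨w, hw, hwz⟩ := (this.and self_mem_nhdsWithin).exists
      exact hwz (hinj (hball hw).2 hz (hconst w hw))
    · exact h
  have hdG : ∀ᶠ w in 𝓝[≠] (F z), DifferentiableAt ℂ G w := by
    have hmap : Tendsto G (𝓝[≠] (F z)) (𝓝[≠] z) := by
      refine tendsto_nhdsWithin_iff.2 ⟨?_, ?_⟩
      · have := hcont.tendsto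
        rw [hG z hz] at this
        exact this.mono_left nhdsWithin_le_nhds
      · filter_upwards [nhdsWithin_le_nhds (eventually_right_inverse hU hF hG hz),
          self_mem_nhdsWithin] with w hw hwz h
        apply hwz
        rw [Set.mem_singleton_iff] at h ⊢
        rw [← hw.2, h]
    filter_upwards [hmap.eventually hne,
      nhdsWithin_le_nhds (eventually_right_inverse hU hF hG hz)] with w hw hw2
    have hc := continuousAt_leftInverse hU hF hG hw2.1
    rw [hw2.2] at hc
    have he := eventually_right_inverse hU hF hG hw2.1
    rw [hw2.2] at he
    exact (HasDerivAt.of_local_left_inverse hc (hdiff _ hw2.1).hasDerivAt hw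
      (he.mono fun _ h => h.2)).differentiableAt
  have hGd : DifferentiableAt ℂ G (F z) :=
    (Complex.analyticAt_of_differentiable_on_punctured_nhds_of_continuousAt hdG
      hcont).differentiableAt
  have hcomp := hGd.hasDerivAt.comp z (hdiff z hz).hasDerivAt
  have hid : HasDerivAt (G ∘ F) 1 z := by
    refine (hasDerivAt_id z).congr_of_eventuallyEq ?_
    filter_upwards [hU.mem_nhds hz] with w hw
    simp [hG w hw]
  intro h0
  have := hcomp.unique hid
  simp [h0] at this

theorem hasDerivAt_leftInverse {F G : ℂ → ℂ} {U : Set ℂ} {z : ℂ} (hU : IsOpen U)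
    (hF : DifferentiableOn ℂ F U) (hG : ∀ z ∈ U, G (F z) = z) (hz : z ∈ U) :
    HasDerivAt G (deriv F z)⁻¹ (F z) := by
  refine HasDerivAt.of_local_left_inverse (continuousAt_leftInverse hU hF hG hz) ?_
    (deriv_ne_zero_of_leftInverse hU hF hG hz)
    ((eventually_right_inverse hU hF hG hz).mono fun _ h => h.2)
  rw [hG z hz]
  exact (hF.differentiableAt (hU.mem_nhds hz)).hasDerivAt

theorem deriv_ne_zero_of_injOn {F : ℂ → ℂ} {U : Set ℂ} {z : ℂ} (hU : IsOpen U)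
    (hF : DifferentiableOn ℂ F U) (hinj : Set.InjOn F U) (hz : z ∈ U) : deriv F z ≠ 0 :=
  deriv_ne_zero_of_leftInverse hU hF (G := Function.invFunOn F U)
    (fun _ hw => hinj.leftInvOn_invFunOn hw) hz

/-! ### The Schwarz-Pick lemma in the right half plane -/

/-- The open right half plane. -/
def rightHalfPlane : Set ℂ := {z | 0 < z.re}

theorem mem_rightHalfPlane {z : ℂ} : z ∈ rightHalfPlane ↔ 0 < z.re := Iff.rfl

theorem isOpen_rightHalfPlane : IsOpen rightHalfPlane := isOpen_lt continuous_const Complex.continuous_re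

theorem convex_rightHalfPlane : Convex ℝ rightHalfPlane := convex_halfSpace_re_gt 0

theorem normSq_add_conj (a b : ℂ) :
    ‖a + conj b‖ ^ 2 = ‖a - b‖ ^ 2 + 4 * a.re * b.re := by
  simp only [Complex.sq_norm, Complex.normSq_apply, Complex.add_re, Complex.sub_re, Complex.add_im,
    Complex.sub_im, Complex.conj_re, Complex.conj_im]
  ring

theorem add_conj_ne_zero {a b : ℂ} (ha : 0 < a.re) (hb : 0 < b.re) : a + conj b ≠ 0 := by
  intro h
  have := congrArg Complex.re h
  simp at this
  linarith

/-- The Schwarz lemma in the disk, conjugated by Cayley maps centred at `b` and `φ b`, evaluated at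
`(a - b)/(a + conj b)`. The division-free form is convenient for taking limits. -/
theorem schwarzPick_aux {φ : ℂ → ℂ} (hφ : DifferentiableOn ℂ φ rightHalfPlane)
    (hpos : ∀ ζ ∈ rightHalfPlane, 0 < (φ ζ).re) {a b : ℂ} (ha : 0 < a.re) (hb : 0 < b.re) :
    ‖φ a - φ b‖ ^ 2 * (a.re * b.re) ≤ ‖a - b‖ ^ 2 * ((φ a).re * (φ b).re) := by
  have hball : ∀ z ∈ Metric.ball (0 : ℂ) 1, 1 - z ≠ 0 := by
    intro z hz h
    rw [mem_ball_zero_iff] at hz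
    rw [← sub_eq_zero.1 h] at hz
    simp at hz
  set κ : ℂ → ℂ := fun z => (b + conj b * z) / (1 - z) with hκ
  have hκmem : ∀ z ∈ Metric.ball (0 : ℂ) 1, κ z ∈ rightHalfPlane := by
    intro z hz
    have h1 := hball z hz
    rw [mem_ball_zero_iff] at hz
    have hn : 0 < Complex.normSq (1 - z) := Complex.normSq_pos.2 h1
    have h2 : z.re ^ 2 + z.im ^ 2 < 1 := by
      have : ‖z‖ ^ 2 < 1 := by nlinarith [norm_nonneg z]
      rw [Complex.sq_norm, Complex.normSq_apply] at this
      nlinarith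
    rw [mem_rightHalfPlane, hκ]
    simp only [Complex.div_re, ← add_div]
    apply div_pos _ hn
    simp
    nlinarith
  set Ψ : ℂ → ℂ := fun z => (φ (κ z) - φ b) / (φ (κ z) + conj (φ b)) with hΨ
  have hφb := hpos b hb
  have hden : ∀ z ∈ Metric.ball (0 : ℂ) 1, φ (κ z) + conj (φ b) ≠ 0 := fun z hz =>
    add_conj_ne_zero (hpos _ (hκmem z hz)) hφb
  have hκd : DifferentiableOn ℂ κ (Metric.ball 0 1) := by
    apply DifferentiableOn.div (by fun_prop) (by fun_prop) hball
  have hφκ : DifferentiableOn ℂ (fun z => φ (κ z)) (Metric.ball 0 1) := hφ.comp hκd hκmem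
  have hΨd : DifferentiableOn ℂ Ψ (Metric.ball 0 1) :=
    (hφκ.sub_const _).div (hφκ.add_const _) hden
  have hΨm : Set.MapsTo Ψ (Metric.ball 0 1) (Metric.closedBall 0 1) := by
    intro z hz
    rw [mem_closedBall_zero_iff, hΨ]
    simp only [norm_div]
    apply div_le_one_of_le₀ _ (norm_nonneg _)
    refine abs_le_of_sq_le_sq' ?_ (norm_nonneg _) |>.2
    rw [normSq_add_conj]
    have := mul_pos (hpos _ (hκmem z hz)) hφb
    nlinarith
  have hκ0 : κ 0 = b := by simp [hκ]
  have hΨ0 : Ψ 0 = 0 := by simp [hΨ, hκ0]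
  have hab := add_conj_ne_zero ha hb
  have hba := add_conj_ne_zero hb ha
  set z : ℂ := (a - b) / (a + conj b) with hz
  have hzn : ‖z‖ ^ 2 * (‖a - b‖ ^ 2 + 4 * a.re * b.re) = ‖a - b‖ ^ 2 := by
    rw [← normSq_add_conj, hz, norm_div, div_pow]
    have : ‖a + conj b‖ ^ 2 ≠ 0 := by positivity
    field_simp
  have hz1 : ‖z‖ < 1 := by
    by_contra h
    push Not at h
    have h1 : 1 ≤ ‖z‖ ^ 2 := one_le_pow₀ h
    have h2 := mul_pos ha hb
    have h3 := mul_le_mul_of_nonneg_right h1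
      (show 0 ≤ ‖a - b‖ ^ 2 + 4 * a.re * b.re by nlinarith [sq_nonneg ‖a - b‖])
    nlinarith
  have hκz : κ z = a := by
    have h1 : (1 : ℂ) - z ≠ 0 := hball z (mem_ball_zero_iff.2 hz1)
    simp only [hκ]
    rw [div_eq_iff h1, hz]
    field_simp
    ring
  have key := Complex.norm_le_norm_of_mapsTo_ball hΨd hΨm hΨ0 hz1
  simp only [hΨ, hκz, norm_div] at key
  have hφa := hpos a ha
  have hn := normSq_add_conj (φ a) (φ b)
  have hn0 : 0 < ‖φ a + conj (φ b)‖ := norm_pos_iff.2 (add_conj_ne_zero hφa hφb)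
  rw [div_le_iff₀ hn0] at key
  have key2 : ‖φ a - φ b‖ ^ 2 ≤ ‖z‖ ^ 2 * (‖φ a - φ b‖ ^ 2 + 4 * (φ a).re * (φ b).re) := by
    rw [← hn, ← mul_pow]
    exact pow_le_pow_left₀ (norm_nonneg _) key 2
  set t := ‖φ a - φ b‖ ^ 2
  set s := ‖a - b‖ ^ 2
  set Q := ‖z‖ ^ 2
  have hs : 0 ≤ s := sq_nonneg _
  have hP := mul_pos ha hb
  have hP' := mul_pos hφa hφb
  have hs' : 0 < s + 4 * a.re * b.re := by nlinarith
  have h3 := mul_le_mul_of_nonneg_right key2 hs'.le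
  have h4 : Q * (t + 4 * (φ a).re * (φ b).re) * (s + 4 * a.re * b.re)
      = s * (t + 4 * (φ a).re * (φ b).re) := by
    linear_combination (t + 4 * (φ a).re * (φ b).re) * hzn
  rw [h4] at h3
  nlinarith

/-- The Schwarz-Pick lemma for functions with nonnegative real part in the half plane. -/
theorem schwarzPick {φ : ℂ → ℂ} (hφ : DifferentiableOn ℂ φ rightHalfPlane)
    (hpos : ∀ ζ ∈ rightHalfPlane, 0 ≤ (φ ζ).re) {a b : ℂ} (ha : 0 < a.re) (hb : 0 < b.re) :
    ‖φ a - φ b‖ ^ 2 * (a.re * b.re) ≤ ‖a - b‖ ^ 2 * ((φ a).re * (φ b).re) := by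
  -- Adding `δ` makes the real part strictly positive; then `δ → 0`.
  have h : ∀ δ : ℝ, 0 < δ → ‖φ a - φ b‖ ^ 2 * (a.re * b.re) ≤
      ‖a - b‖ ^ 2 * (((φ a).re + δ) * ((φ b).re + δ)) := by
    intro δ hδ
    have := schwarzPick_aux (φ := fun ζ => φ ζ + (δ : ℂ)) (hφ.add_const _)
      (fun ζ hζ => by simpa using add_pos_of_nonneg_of_pos (hpos ζ hζ) hδ) ha hb
    simpa using this
  have hlim : Tendsto (fun δ : ℝ => ‖a - b‖ ^ 2 * (((φ a).re + δ) * ((φ b).re + δ))) (𝓝[>] 0)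
      (𝓝 (‖a - b‖ ^ 2 * (((φ a).re + 0) * ((φ b).re + 0)))) := by
    apply Tendsto.mono_left _ nhdsWithin_le_nhds
    apply Continuous.tendsto
    fun_prop
  simpa using ge_of_tendsto hlim (eventually_nhdsWithin_of_forall fun δ hδ => h δ hδ)

/-- The infinitesimal Schwarz-Pick lemma in the half plane. -/
theorem norm_deriv_mul_re_le {φ : ℂ → ℂ} (hφ : DifferentiableOn ℂ φ rightHalfPlane)
    (hpos : ∀ ζ ∈ rightHalfPlane, 0 ≤ (φ ζ).re) {b : ℂ} (hb : 0 < b.re) :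
    ‖deriv φ b‖ * b.re ≤ (φ b).re := by
  have hd : HasDerivAt φ (deriv φ b) b :=
    (hφ.differentiableAt (isOpen_rightHalfPlane.mem_nhds hb)).hasDerivAt
  have h1 : Tendsto (fun a => ‖slope φ b a‖ ^ 2 * (a.re * b.re)) (𝓝[≠] b)
      (𝓝 (‖deriv φ b‖ ^ 2 * (b.re * b.re))) := by
    refine ((hasDerivAt_iff_tendsto_slope.1 hd).norm.pow 2).mul ?_
    exact ((Complex.continuous_re.tendsto b).mono_left nhdsWithin_le_nhds).mul_const _
  have h2 : Tendsto (fun a => (φ a).re * (φ b).re) (𝓝[≠] b) (𝓝 ((φ b).re * (φ b).re)) := by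
    refine Tendsto.mul_const _ ?_
    exact ((Complex.continuous_re.tendsto _).comp hd.continuousAt.tendsto).mono_left
      nhdsWithin_le_nhds
  have h3 : ‖deriv φ b‖ ^ 2 * (b.re * b.re) ≤ (φ b).re * (φ b).re := by
    refine le_of_tendsto_of_tendsto h1 h2 ?_
    filter_upwards [nhdsWithin_le_nhds (isOpen_rightHalfPlane.mem_nhds hb),
      self_mem_nhdsWithin] with a ha hab
    have hab' : 0 < ‖a - b‖ := norm_pos_iff.2 (sub_ne_zero.2 hab)
    have := schwarzPick hφ hpos ha hb
    rw [slope_def_field, norm_div, div_pow, div_mul_eq_mul_div, div_le_iff₀ (by positivity)]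
    linarith
  refine abs_le_of_sq_le_sq' ?_ (hpos b hb) |>.2
  nlinarith

/-! ### Concave maps of the half plane: dilation semigroups and starlikeness -/

theorem hasDerivAt_log_norm {g : ℝ → ℂ} {g' : ℂ} {x : ℝ} (hg : HasDerivAt g g' x)
    (h0 : g x ≠ 0) : HasDerivAt (fun t => Real.log ‖g t‖) (g' / g x).re x := by
  have h1 : HasDerivAt (fun t => ‖g t‖ ^ 2) (2 * inner ℝ (g x) g') x := hg.norm_sq
  have hn : ‖g x‖ ^ 2 ≠ 0 := by positivity
  have h2 := (h1.log hn).const_mul (1 / 2 : ℝ)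
  have h3 : (fun t => 1 / 2 * Real.log (‖g t‖ ^ 2)) = fun t => Real.log ‖g t‖ := by
    funext t
    rw [Real.log_pow]
    push_cast
    ring
  rw [h3] at h2
  refine h2.congr_deriv ?_
  rw [Complex.inner, Complex.div_re, Complex.sq_norm]
  have : Complex.normSq (g x) ≠ 0 := by simpa using h0
  simp
  field_simp

theorem nonneg_deriv_of_nonneg_right {Q : ℝ → ℝ} {Q' : ℝ} (hQ : HasDerivAt Q Q' 0)
    (h0 : Q 0 = 0) (hnn : ∀ t, 0 < t → 0 ≤ Q t) : 0 ≤ Q' := by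
  have h := (hasDerivWithinAt_iff_tendsto_slope' (by simp)).1 (hQ.hasDerivWithinAt (s := Set.Ioi 0))
  refine ge_of_tendsto h (eventually_nhdsWithin_of_forall fun t ht => ?_)
  rw [slope_def_field, h0, sub_zero, sub_zero]
  exact div_nonneg (hnn t ht) (le_of_lt ht)

/-- Conformal maps of the right half plane onto the complement of a convex set
which fix the point at infinity. -/
structure IsConcaveHalfPlane (F : ℂ → ℂ) : Prop where
  diff : DifferentiableOn ℂ F rightHalfPlane
  inj : Set.InjOn F rightHalfPlane
  convex : Convex ℝ (F '' rightHalfPlane)ᶜ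
  tendsto : Tendsto F (Bornology.cobounded ℂ ⊓ 𝓟 rightHalfPlane) (Bornology.cobounded ℂ)

namespace IsConcaveHalfPlane

variable {F : ℂ → ℂ}

theorem hasDerivAt (hF : IsConcaveHalfPlane F) {ζ : ℂ} (hζ : 0 < ζ.re) :
    HasDerivAt F (deriv F ζ) ζ :=
  (hF.diff.differentiableAt (isOpen_rightHalfPlane.mem_nhds hζ)).hasDerivAt

theorem deriv_ne_zero (hF : IsConcaveHalfPlane F) {ζ : ℂ} (hζ : 0 < ζ.re) : deriv F ζ ≠ 0 :=
  deriv_ne_zero_of_injOn isOpen_rightHalfPlane hF.diff hF.inj hζ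

theorem isClosed_compl (hF : IsConcaveHalfPlane F) : IsClosed (F '' rightHalfPlane)ᶜ :=
  (isOpen_image_of_injOn isOpen_rightHalfPlane hF.diff hF.inj).isClosed_compl

theorem sub_ne_zero (_hF : IsConcaveHalfPlane F) {ζ k : ℂ} (hζ : 0 < ζ.re)
    (hk : k ∈ (F '' rightHalfPlane)ᶜ) : F ζ - k ≠ 0 := fun h =>
  hk ⟨ζ, hζ, _root_.sub_eq_zero.1 h⟩

theorem exists_inverse (hF : IsConcaveHalfPlane F) :
    ∃ G : ℂ → ℂ, (∀ ζ ∈ rightHalfPlane, G (F ζ) = ζ) ∧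
      (∀ w ∈ F '' rightHalfPlane, G w ∈ rightHalfPlane ∧ F (G w) = w) ∧
      (∀ ζ ∈ rightHalfPlane, HasDerivAt G (deriv F ζ)⁻¹ (F ζ)) ∧
      DifferentiableOn ℂ G (F '' rightHalfPlane) := by
  have h1 : ∀ ζ ∈ rightHalfPlane, Function.invFunOn F rightHalfPlane (F ζ) = ζ :=
    fun _ hw => hF.inj.leftInvOn_invFunOn hw
  have h2 : ∀ ζ ∈ rightHalfPlane,
      HasDerivAt (Function.invFunOn F rightHalfPlane) (deriv F ζ)⁻¹ (F ζ) :=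
    fun ζ hζ => hasDerivAt_leftInverse isOpen_rightHalfPlane hF.diff h1 hζ
  refine ⟨Function.invFunOn F rightHalfPlane, h1, ?_, h2, ?_⟩
  · rintro _ ⟨ζ, hζ, rfl⟩
    rw [h1 ζ hζ]
    exact ⟨hζ, rfl⟩
  · rintro _ ⟨ζ, hζ, rfl⟩
    exact (h2 ζ hζ).differentiableAt.differentiableWithinAt

theorem add_smul_mem (hF : IsConcaveHalfPlane F) {w k : ℂ} (hw : w ∈ F '' rightHalfPlane)
    (hk : k ∈ (F '' rightHalfPlane)ᶜ) {t : ℝ} (ht : 0 ≤ t) :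
    w + t * (w - k) ∈ F '' rightHalfPlane := by
  by_contra h
  have h1 : (1 + t) ≠ 0 := by positivity
  have := hF.convex h hk (a := 1 / (1 + t)) (b := t / (1 + t)) (by positivity) (by positivity)
    (by field_simp)
  apply this
  convert hw using 1
  have h2 : (1 + t : ℂ) ≠ 0 := by exact_mod_cast h1
  simp only [Complex.real_smul]
  push_cast
  field_simp
  ring

/-- Two-point inequality for the generator `(F - k) / F'` of the semigroup of dilations with
center `k`. -/
theorem generator_two_point (hF : IsConcaveHalfPlane F) {k : ℂ}
    (hk : k ∈ (F '' rightHalfPlane)ᶜ) {a b : ℂ} (ha : 0 < a.re) (hb : 0 < b.re) :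
    2 * (((F a - k) / deriv F a - (F b - k) / deriv F b) * conj (a - b)).re * (a.re * b.re) ≤
      ‖a - b‖ ^ 2 * (((F a - k) / deriv F a).re * b.re + a.re * ((F b - k) / deriv F b).re) := by
  obtain ⟨G, hG1, hG2, hG3, hG4⟩ := hF.exists_inverse
  -- Dilation by `1 + t` about `k`, conjugated by `F`: a self-map of the half plane with `ω 0 = id`
  -- and initial velocity `(F - k)/F'`.
  set ω : ℝ → ℂ → ℂ := fun t ζ => G (F ζ + t * (F ζ - k)) with hω
  have hmem : ∀ t : ℝ, 0 ≤ t → ∀ ζ ∈ rightHalfPlane, ω t ζ ∈ rightHalfPlane := fun t ht ζ hζ =>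
    (hG2 _ (hF.add_smul_mem ⟨ζ, hζ, rfl⟩ hk ht)).1
  have hdiff : ∀ t : ℝ, 0 ≤ t → DifferentiableOn ℂ (ω t) rightHalfPlane := fun t ht =>
    hG4.comp (hF.diff.add ((hF.diff.sub_const k).const_mul _))
      fun ζ hζ => hF.add_smul_mem ⟨ζ, hζ, rfl⟩ hk ht
  have hω0 : ∀ ζ ∈ rightHalfPlane, ω 0 ζ = ζ := fun ζ hζ => by simp [hω, hG1 ζ hζ]
  have hder : ∀ ζ ∈ rightHalfPlane,
      HasDerivAt (fun t : ℝ => ω t ζ) ((F ζ - k) / deriv F ζ) 0 := by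
    intro ζ hζ
    have h1 : HasDerivAt (fun t : ℝ => F ζ + (t : ℂ) * (F ζ - k)) (F ζ - k) 0 := by
      simpa using ((Complex.ofRealCLM.hasDerivAt (x := (0 : ℝ))).mul_const (F ζ - k)).const_add (F ζ)
    have h2 : HasDerivAt G (deriv F ζ)⁻¹ (F ζ + ((0 : ℝ) : ℂ) * (F ζ - k)) := by
      simpa using hG3 ζ hζ
    have h3 := h2.scomp (0 : ℝ) h1
    rw [smul_eq_mul, ← div_eq_mul_inv] at h3
    exact h3
  have hre : ∀ ζ ∈ rightHalfPlane,
      HasDerivAt (fun t : ℝ => (ω t ζ).re) ((F ζ - k) / deriv F ζ).re 0 := fun ζ hζ =>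
    (Complex.reCLM.hasFDerivAt.comp_hasDerivAt (0 : ℝ) (hder ζ hζ))
  have him : ∀ ζ ∈ rightHalfPlane,
      HasDerivAt (fun t : ℝ => (ω t ζ).im) ((F ζ - k) / deriv F ζ).im 0 := fun ζ hζ =>
    (Complex.imCLM.hasFDerivAt.comp_hasDerivAt (0 : ℝ) (hder ζ hζ))
  set pa := (F a - k) / deriv F a
  set pb := (F b - k) / deriv F b
  -- The defect in Schwarz-Pick for `ω t` is nonnegative for `t > 0` and vanishes at `t = 0`; its
  -- derivative at `0` is the claim.
  have hQ := (((hre a ha).mul (hre b hb)).const_mul (‖a - b‖ ^ 2)).sub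
    (((((hre a ha).sub (hre b hb)).pow 2).add (((him a ha).sub (him b hb)).pow 2)).mul_const
      (a.re * b.re))
  have hres := nonneg_deriv_of_nonneg_right hQ ?_ ?_
  · simp only [Pi.sub_apply, hω0 a ha, hω0 b hb] at hres
    simp only [Complex.mul_re, Complex.conj_re, Complex.conj_im, Complex.sub_re,
      Complex.sub_im]
    norm_num at hres
    nlinarith [hres]
  · simp only [Pi.sub_apply, Pi.mul_apply, Pi.add_apply, Pi.pow_apply, hω0 a ha, hω0 b hb,
      Complex.sq_norm, Complex.normSq_apply, Complex.sub_re, Complex.sub_im]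
    ring
  · intro t ht
    have h := schwarzPick (hdiff t ht.le) (fun ζ hζ => le_of_lt (hmem t ht.le ζ hζ)) ha hb
    simp only [Pi.sub_apply, Pi.mul_apply, Pi.add_apply, Pi.pow_apply]
    rw [Complex.sq_norm (ω t a - ω t b), Complex.normSq_apply, Complex.sub_re, Complex.sub_im] at h
    nlinarith [h]

theorem tendsto_ofReal (hF : IsConcaveHalfPlane F) :
    Tendsto (fun N : ℝ => F N) atTop (Bornology.cobounded ℂ) := by
  refine hF.tendsto.comp (tendsto_inf.2 ⟨?_, ?_⟩)
  · rw [← tendsto_norm_atTop_iff_cobounded]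
    simpa using tendsto_abs_atTop_atTop
  · rw [tendsto_principal]
    filter_upwards [eventually_gt_atTop 0] with N hN
    simpa [mem_rightHalfPlane] using hN

/-- Otherwise `log |F N - k| + c / N` would decrease for large `N`, although `F → ∞`. -/
theorem frequently_logDeriv_gt (hF : IsConcaveHalfPlane F) {k : ℂ}
    (hk : k ∈ (F '' rightHalfPlane)ᶜ) (c : ℝ) :
    ∃ᶠ N : ℝ in atTop, c / N ^ 2 < (deriv F N / (F N - k)).re := by
  intro hcon
  simp only [not_lt] at hcon
  obtain ⟨N₀, hN₀⟩ := eventually_atTop.1 (hcon.and (eventually_gt_atTop 0))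
  have hpos : ∀ x, N₀ ≤ x → 0 < x := fun x hx => (hN₀ x hx).2
  have hd : ∀ x, N₀ ≤ x → HasDerivAt (fun t : ℝ => Real.log ‖F t - k‖ + c / t)
      ((deriv F x / (F x - k)).re + -c / x ^ 2) x := by
    intro x hx
    have h1 : HasDerivAt (fun t : ℝ => F t - k) (deriv F x) x :=
      ((hF.hasDerivAt (ζ := x) (by simpa using hpos x hx)).comp_ofReal).sub_const k
    have h2 := hasDerivAt_log_norm h1
      (hF.sub_ne_zero (by simpa using hpos x hx) hk)
    have h3 : HasDerivAt (fun t : ℝ => c / t) (-c / x ^ 2) x := by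
      have := (hasDerivAt_inv (hpos x hx).ne').const_mul c
      simp only [div_eq_mul_inv]
      exact this.congr_deriv (by ring)
    exact h2.add h3
  have hanti : AntitoneOn (fun t : ℝ => Real.log ‖F t - k‖ + c / t) (Set.Ici N₀) := by
    refine antitoneOn_of_deriv_nonpos (convex_Ici _)
      (fun x hx => (hd x hx).continuousAt.continuousWithinAt)
      (fun x hx => (hd x (interior_subset hx)).differentiableAt.differentiableWithinAt) ?_
    intro x hx
    have hx' : N₀ ≤ x := interior_subset hx
    rw [(hd x hx').deriv]
    have := (hN₀ x hx').1
    rw [neg_div]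
    linarith
  have hlim : Tendsto (fun t : ℝ => Real.log ‖F t - k‖ + c / t) atTop atTop := by
    refine Tendsto.atTop_add (C := 0) ?_ ?_
    · refine Real.tendsto_log_atTop.comp ?_
      have := (tendsto_norm_cobounded_atTop (E := ℂ)).comp hF.tendsto_ofReal
      refine tendsto_atTop_mono' _ ?_ (tendsto_atTop_add_const_right _ (-‖k‖) this)
      filter_upwards with x
      simpa [sub_eq_add_neg] using norm_sub_norm_le (F x) k
    · exact tendsto_const_nhds.div_atTop tendsto_id
  obtain ⟨x, hx, hx2⟩ := ((hlim.eventually_gt_atTop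
    (Real.log ‖F N₀ - k‖ + c / N₀)).and (eventually_ge_atTop N₀)).exists
  exact absurd (hanti Set.self_mem_Ici hx2 hx2) (not_le.2 hx)

/-- `F` is starlike with respect to each point of the complement of its image, relative to the
boundary point at infinity. -/
theorem re_div_deriv_nonneg (hF : IsConcaveHalfPlane F) {k : ℂ}
    (hk : k ∈ (F '' rightHalfPlane)ᶜ) {a : ℂ} (ha : 0 < a.re) :
    0 ≤ ((F a - k) / deriv F a).re := by
  set p : ℂ → ℂ := fun ζ => (F ζ - k) / deriv F ζ with hp
  -- Two-point inequality with `b = N`, along those `N` where `Re 1/p(N) > c/N²`. There `Re p(N) >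
  -- 0` and `|p(N)| ≤ N²/c`; division by `N³` leaves an error of order `1/c`, and `c` is arbitrary.
  have key : ∀ c : ℝ, 0 < c → -(2 * a.re * ‖a‖) * c⁻¹ ≤ (p a).re := by
    intro c hc
    have hlim : Tendsto (fun N : ℝ => (‖a - N‖ / N) ^ 2 * (p a).re
        + 2 * a.re * ‖p a‖ * (‖a - N‖ / N * N⁻¹)) atTop
        (𝓝 (1 ^ 2 * (p a).re + 2 * a.re * ‖p a‖ * (1 * 0))) := by
      have h1 : Tendsto (fun N : ℝ => ‖a - N‖ / N) atTop (𝓝 1) := by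
        have h2 : Tendsto (fun N : ℝ => ‖a * ((N⁻¹ : ℝ) : ℂ) - 1‖) atTop
            (𝓝 ‖a * ((0 : ℝ) : ℂ) - 1‖) :=
          ((((Complex.continuous_ofReal.tendsto 0).comp tendsto_inv_atTop_zero).const_mul a).sub_const
            1).norm
        simp only [Complex.ofReal_zero, mul_zero, zero_sub, norm_neg, norm_one] at h2
        refine h2.congr' ?_
        filter_upwards [eventually_gt_atTop 0] with N hN
        rw [eq_div_iff hN.ne']
        nth_rewrite 2 [← Real.norm_of_nonneg hN.le]
        rw [← Complex.norm_real, ← norm_mul]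
        congr 1
        have : (N : ℂ) ≠ 0 := by exact_mod_cast hN.ne'
        push_cast
        field_simp
      exact ((h1.pow 2).mul_const _).add ((h1.mul tendsto_inv_atTop_zero).const_mul _)
    simp only [one_pow, one_mul, mul_zero, add_zero] at hlim
    by_contra hcon
    push Not at hcon
    have hev := hlim.eventually (gt_mem_nhds hcon)
    obtain ⟨N, hN, hNlt, hNa, hN1⟩ := ((hF.frequently_logDeriv_gt hk c).and_eventually
      (hev.and ((eventually_gt_atTop ‖a‖).and (eventually_gt_atTop 0)))).exists
    have hNre : 0 < (N : ℂ).re := by simpa using hN1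
    have h2 := hF.generator_two_point hk ha hNre
    change 2 * ((p a - p N) * conj (a - N)).re * (a.re * (N : ℂ).re) ≤
      ‖a - N‖ ^ 2 * ((p a).re * (N : ℂ).re + a.re * (p N).re) at h2
    have hpN : deriv F N / (F N - k) = (p N)⁻¹ := by simp [hp]
    rw [hpN] at hN
    have hcN : 0 < c / N ^ 2 := by positivity
    have hpN0 : p N ≠ 0 := by
      intro h
      rw [h] at hN
      simp at hN
      linarith
    have hpre : 0 < (p N).re := by
      rw [Complex.inv_re] at hN
      exact (div_pos_iff_of_pos_right (Complex.normSq_pos.2 hpN0)).1 (hcN.trans hN)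
    have hpn : ‖p N‖ ≤ N ^ 2 / c := by
      have h3 : c / N ^ 2 < ‖p N‖⁻¹ := by
        rw [← norm_inv]
        exact hN.trans_le (Complex.re_le_norm _)
      have := (lt_inv_comm₀ hcN (norm_pos_iff.2 hpN0)).1 h3
      rw [inv_div] at this
      exact this.le
    have hcs : -(‖p a‖ * ‖a - N‖) ≤ (p a * conj (a - N)).re := by
      have := Complex.abs_re_le_norm (p a * conj (a - N))
      rw [norm_mul, RCLike.norm_conj] at this
      exact (abs_le.1 this).1
    have hna : ‖a‖ ^ 2 < N ^ 2 := pow_lt_pow_left₀ hNa (norm_nonneg _) two_ne_zero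
    have him : |a.im| ≤ ‖a‖ := Complex.abs_im_le_norm a
    have himp : |(p N).im| ≤ ‖p N‖ := Complex.abs_im_le_norm _
    have hprod : (p N).im * a.im ≤ N ^ 2 / c * ‖a‖ := by
      calc (p N).im * a.im ≤ |(p N).im * a.im| := le_abs_self _
        _ = |(p N).im| * |a.im| := abs_mul _ _
        _ ≤ N ^ 2 / c * ‖a‖ := mul_le_mul (himp.trans hpn) him (abs_nonneg _) (by positivity)
    have hsqn : ‖a - N‖ ^ 2 = (a.re - N) ^ 2 + a.im ^ 2 := by
      rw [Complex.sq_norm, Complex.normSq_apply]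
      simp
      ring
    have hsqa : ‖a‖ ^ 2 = a.re ^ 2 + a.im ^ 2 := by
      rw [Complex.sq_norm, Complex.normSq_apply]
      ring
    -- After collecting terms, `Re p(N)` has coefficient `a.re (2N(N - a.re) - |a - N|²) = a.re (N²
    -- - |a|²)`, so it can be dropped.
    have hbr : 0 ≤ a.re * ((N ^ 2 - ‖a‖ ^ 2) * (p N).re) :=
      mul_nonneg ha.le (mul_nonneg (by linarith) hpre.le)
    have hprod2 := mul_le_mul_of_nonneg_left hprod (show 0 ≤ 2 * N * a.re by positivity)
    have hcs2 := mul_le_mul_of_nonneg_left hcs (show 0 ≤ 2 * N * a.re by positivity)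
    have hmain : -(2 * N * a.re * (‖p a‖ * ‖a - N‖)) - 2 * N * a.re * (N ^ 2 / c * ‖a‖) ≤
        ‖a - N‖ ^ 2 * N * (p a).re := by
      simp only [Complex.mul_re, Complex.conj_re, Complex.conj_im, Complex.sub_re,
        Complex.sub_im, Complex.ofReal_re, Complex.ofReal_im] at h2 hcs2
      rw [hsqa] at hbr
      rw [hsqn] at h2 ⊢
      nlinarith [h2, hcs2, hprod2, hbr]
    have hfin : -(2 * a.re * ‖a‖) * c⁻¹ ≤ (‖a - N‖ / N) ^ 2 * (p a).re
        + 2 * a.re * ‖p a‖ * (‖a - N‖ / N * N⁻¹) := by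
      have hN3 : (0 : ℝ) < N ^ 3 := by positivity
      have e1 : -(2 * N * a.re * (‖p a‖ * ‖a - N‖)) - 2 * N * a.re * (N ^ 2 / c * ‖a‖) =
        N ^ 3 * (-(2 * a.re * ‖a‖) * c⁻¹ - 2 * a.re * ‖p a‖ * (‖a - N‖ / N * N⁻¹)) := by
        field_simp
        ring
      have e2 : ‖a - N‖ ^ 2 * N * (p a).re = N ^ 3 * ((‖a - N‖ / N) ^ 2 * (p a).re) := by
        field_simp
      rw [e1, e2] at hmain
      have := le_of_mul_le_mul_left hmain hN3
      linarith
    linarith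
  have hlim : Tendsto (fun c : ℝ => -(2 * a.re * ‖a‖) * c⁻¹) atTop (𝓝 0) := by
    simpa using tendsto_inv_atTop_zero.const_mul (-(2 * a.re * ‖a‖))
  exact le_of_tendsto hlim ((eventually_gt_atTop 0).mono fun c hc => key c hc)

theorem re_deriv_div_nonneg (hF : IsConcaveHalfPlane F) {k : ℂ}
    (hk : k ∈ (F '' rightHalfPlane)ᶜ) {a : ℂ} (ha : 0 < a.re) :
    0 ≤ (deriv F a / (F a - k)).re := by
  have := hF.re_div_deriv_nonneg hk ha
  rw [← inv_div, Complex.inv_re]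
  exact div_nonneg this (Complex.normSq_nonneg _)

end IsConcaveHalfPlane

/-- The minimum principle for the real part of a holomorphic function in the half plane, with
boundary values prescribed along the imaginary axis and at infinity. -/
theorem re_nonneg_of_boundary {N : ℂ → ℂ} (hN : DifferentiableOn ℂ N rightHalfPlane)
    (hbd : ∀ y δ : ℝ, 0 < δ → ∀ᶠ η in 𝓝[rightHalfPlane] (y * Complex.I), -δ < (N η).re)
    (hinf : ∀ δ : ℝ, 0 < δ → ∀ᶠ η in Bornology.cobounded ℂ ⊓ 𝓟 rightHalfPlane, -δ < (N η).re)
    {η : ℂ} (hη : η ∈ rightHalfPlane) : 0 ≤ (N η).re := by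
  by_contra hcon
  push Not at hcon
  -- Half the deficit at `η`: the sublevel set `A` contains `η`, and the boundary hypotheses for
  -- this `δ` make `A` compact.
  set δ : ℝ := -(N η).re / 2 with hδ
  have hδ0 : 0 < δ := by rw [hδ]; linarith
  set A : Set ℂ := {w ∈ rightHalfPlane | (N w).re ≤ -δ} with hA
  have hηA : η ∈ A := ⟨hη, by rw [hδ]; linarith⟩
  have hbdd : Bornology.IsBounded A := by
    have h := hinf δ hδ0
    rw [eventually_inf_principal] at h
    rw [← Bornology.isCobounded_compl_iff]
    refine mem_of_superset h fun w hw hwA => ?_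
    exact absurd (hw hwA.1) (not_lt.2 hwA.2)
  have hclosed : IsClosed A := by
    rw [← closure_subset_iff_isClosed]
    intro w hw
    have hre : 0 ≤ w.re := by
      have : closure A ⊆ {z : ℂ | 0 ≤ z.re} :=
        closure_minimal (fun z hz => show 0 ≤ z.re from le_of_lt hz.1) (isClosed_le continuous_const Complex.continuous_re)
      exact this hw
    rw [mem_closure_iff_frequently] at hw
    rcases hre.eq_or_lt with h0 | h0
    · exfalso
      have hwy : w = w.im * Complex.I := by
        apply Complex.ext <;> simp [← h0]
      have h1 := hbd w.im δ hδ0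
      rw [← hwy, eventually_nhdsWithin_iff] at h1
      obtain ⟨z, hz, hz2⟩ := (hw.and_eventually h1).exists
      exact absurd (hz2 hz.1) (not_lt.2 hz.2)
    · refine ⟨h0, ?_⟩
      have hc : ContinuousAt (fun z => (N z).re) w :=
        Complex.continuous_re.continuousAt.comp
          (hN.differentiableAt (isOpen_rightHalfPlane.mem_nhds h0)).continuousAt
      by_contra h
      push Not at h
      have h1 := hc.eventually (lt_mem_nhds h)
      obtain ⟨z, hz, hz2⟩ := (hw.and_eventually h1).exists
      exact absurd hz.2 (not_le.2 hz2)
  have hcomp : IsCompact A := Metric.isCompact_of_isClosed_isBounded hclosed hbdd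
  have hE : DifferentiableOn ℂ (fun w => Complex.exp (-N w)) rightHalfPlane := hN.neg.cexp
  obtain ⟨w₀, hw₀, hmax⟩ := hcomp.exists_isMaxOn ⟨η, hηA⟩
    ((hE.continuousOn.mono fun w hw => hw.1).norm)
  -- Off `A`, `|exp (-N)| < exp δ`, which is at most its values on `A`. The maximum over `A` is thus
  -- global, `exp (-N)` is constant, and the behaviour at infinity is contradicted.
  have hmax' : IsMaxOn (norm ∘ fun w => Complex.exp (-N w)) rightHalfPlane w₀ := by
    intro w hw
    by_cases h : (N w).re ≤ -δ
    · exact hmax ⟨hw, h⟩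
    · have h2 := hw₀.2
      push Not at h
      simp only [Function.comp, Complex.norm_exp, Complex.neg_re, Set.mem_ofPred_eq, Real.exp_le_exp]
      linarith
  have hconst := Complex.eqOn_of_isPreconnected_of_isMaxOn_norm
    convex_rightHalfPlane.isPreconnected isOpen_rightHalfPlane hE hw₀.1 hmax'
  have hcob : (Bornology.cobounded ℂ ⊓ 𝓟 rightHalfPlane).NeBot := by
    have : Tendsto (fun N : ℝ => (N : ℂ)) atTop (Bornology.cobounded ℂ ⊓ 𝓟 rightHalfPlane) := by
      refine tendsto_inf.2 ⟨?_, ?_⟩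
      · rw [← tendsto_norm_atTop_iff_cobounded]
        simpa using tendsto_abs_atTop_atTop
      · rw [tendsto_principal]
        filter_upwards [eventually_gt_atTop 0] with N hN
        simpa [mem_rightHalfPlane] using hN
    exact this.neBot
  obtain ⟨w, hw, hw2⟩ := ((hinf δ hδ0).and (mem_inf_of_right (mem_principal_self _) :
    ∀ᶠ w in Bornology.cobounded ℂ ⊓ 𝓟 rightHalfPlane, w ∈ rightHalfPlane)).exists
  have h1 := congrArg norm (hconst hw2)
  have h2 := hw₀.2
  simp only [Function.const, Complex.norm_exp, Complex.neg_re, Real.exp_eq_exp] at h1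
  linarith

/-! ### Distance to the complement and the two-point inequality -/

namespace IsConcaveHalfPlane

variable {F : ℂ → ℂ}

/-- If `k + l (w - k)` were in the complement, so would be the segment to it from `k`. At parameter
`s` with `s |l|² ≤ Re l` one has `|1 - s l|² ≤ 1 - s Re l < 1`, a point closer to `w` than `k`. -/
theorem halfPlane_subset_of_nearest (hF : IsConcaveHalfPlane F) {w k : ℂ}
    (hk : k ∈ (F '' rightHalfPlane)ᶜ)
    (hmin : ∀ k' ∈ (F '' rightHalfPlane)ᶜ, ‖w - k‖ ≤ ‖w - k'‖) (hwk : w ≠ k)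
    {l : ℂ} (hl : 0 < l.re) : k + l * (w - k) ∈ F '' rightHalfPlane := by
  by_contra h
  have hl0 : 0 < ‖l‖ ^ 2 := by
    have : l ≠ 0 := by rintro rfl; simp at hl
    positivity
  set s : ℝ := min 1 (l.re / ‖l‖ ^ 2) with hs
  have hs0 : 0 < s := lt_min one_pos (by positivity)
  have hs1 : s ≤ 1 := min_le_left _ _
  have hs2 : s * ‖l‖ ^ 2 ≤ l.re := by
    rw [← le_div_iff₀ hl0]
    exact min_le_right _ _
  have hmem := hF.convex hk h (a := 1 - s) (b := s) (by linarith) hs0.le (by ring)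
  have h1 := hmin _ hmem
  have h2 : w - ((1 - s) • k + s • (k + l * (w - k))) = (w - k) * (1 - s * l) := by
    simp only [Complex.real_smul]
    push_cast
    ring
  rw [h2, norm_mul] at h1
  have hpos : 0 < ‖w - k‖ := norm_pos_iff.2 (_root_.sub_ne_zero.2 hwk)
  have h3 : 1 ≤ ‖1 - (s : ℂ) * l‖ := by
    by_contra h4
    push Not at h4
    nlinarith
  have h4 : 1 ≤ ‖1 - (s : ℂ) * l‖ ^ 2 := one_le_pow₀ h3
  rw [Complex.sq_norm, Complex.normSq_apply] at h4
  rw [Complex.sq_norm, Complex.normSq_apply] at hs2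
  simp at h4
  nlinarith

/-- The map `l ↦ G (k + l (F ζ - k))`, defined through the supporting half plane at the nearest
point `k`, is a self-map of the right half plane sending `1` to `ζ`. The infinitesimal Schwarz-Pick
lemma at `1` is the distance estimate. -/
theorem exists_nearest (hF : IsConcaveHalfPlane F) (hne : (F '' rightHalfPlane)ᶜ.Nonempty)
    {ζ : ℂ} (hζ : 0 < ζ.re) : ∃ k ∈ (F '' rightHalfPlane)ᶜ,
      Metric.infDist (F ζ) (F '' rightHalfPlane)ᶜ = ‖F ζ - k‖ ∧
      ‖F ζ - k‖ ≤ ζ.re * ‖deriv F ζ‖ := by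
  obtain ⟨k, hk, hdist⟩ := hF.isClosed_compl.exists_infDist_eq_dist hne (F ζ)
  rw [dist_eq_norm] at hdist
  refine ⟨k, hk, hdist, ?_⟩
  have hmin : ∀ k' ∈ (F '' rightHalfPlane)ᶜ, ‖F ζ - k‖ ≤ ‖F ζ - k'‖ := fun k' hk' => by
    rw [← hdist, ← dist_eq_norm]
    exact Metric.infDist_le_dist_of_mem hk'
  have hwk : F ζ ≠ k := _root_.sub_ne_zero.1 (hF.sub_ne_zero hζ hk)
  obtain ⟨G, hG1, hG2, hG3, hG4⟩ := hF.exists_inverse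
  have hsub : ∀ l ∈ rightHalfPlane, k + l * (F ζ - k) ∈ F '' rightHalfPlane := fun l hl =>
    hF.halfPlane_subset_of_nearest hk hmin hwk hl
  have hφd : DifferentiableOn ℂ (fun l => G (k + l * (F ζ - k))) rightHalfPlane :=
    hG4.comp (by fun_prop) hsub
  have h1 := norm_deriv_mul_re_le hφd (fun l hl => le_of_lt (hG2 _ (hsub l hl)).1) (b := 1) (by simp)
  have h2 : HasDerivAt (fun l : ℂ => k + l * (F ζ - k)) (F ζ - k) 1 := by
    simpa using ((hasDerivAt_id (1 : ℂ)).mul_const (F ζ - k)).const_add k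
  have h3 : HasDerivAt G (deriv F ζ)⁻¹ (k + 1 * (F ζ - k)) := by
    simpa using hG3 ζ hζ
  have h4 := h3.comp (1 : ℂ) h2
  have h5 : deriv (fun l => G (k + l * (F ζ - k))) 1 = (deriv F ζ)⁻¹ * (F ζ - k) := h4.deriv
  rw [h5] at h1
  have hd := norm_pos_iff.2 (hF.deriv_ne_zero hζ)
  simp only [norm_mul, norm_inv, Complex.one_re, mul_one, one_mul, add_sub_cancel, hG1 ζ hζ] at h1
  rw [inv_mul_le_iff₀ hd] at h1
  linarith

/-- `log |F - k|` is nondecreasing along horizontal rays, because `Re F'/(F - k) ≥ 0`. This bounds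
`F` near each finite boundary point. -/
theorem norm_sub_le_norm_add (hF : IsConcaveHalfPlane F) {k : ℂ}
    (hk : k ∈ (F '' rightHalfPlane)ᶜ) {ζ : ℂ} (hζ : 0 < ζ.re) {s : ℝ} (hs : 0 ≤ s) :
    ‖F ζ - k‖ ≤ ‖F (ζ + s) - k‖ := by
  have hre : ∀ t : ℝ, 0 ≤ t → 0 < (ζ + (t : ℂ)).re := fun t ht => by
    simp
    linarith
  have hd : ∀ t : ℝ, 0 ≤ t → HasDerivAt (fun t : ℝ => Real.log ‖F (ζ + t) - k‖)
      (deriv F (ζ + t) / (F (ζ + t) - k)).re t := by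
    intro t ht
    refine hasDerivAt_log_norm (g := fun t : ℝ => F (ζ + t) - k) ?_ (hF.sub_ne_zero (hre t ht) hk)
    have h1 : HasDerivAt (fun u : ℂ => F (ζ + u)) (deriv F (ζ + t)) t :=
      (hF.hasDerivAt (hre t ht)).comp_const_add ζ _
    exact h1.comp_ofReal.sub_const k
  have hmono : MonotoneOn (fun t : ℝ => Real.log ‖F (ζ + t) - k‖) (Set.Ici 0) := by
    refine monotoneOn_of_deriv_nonneg (convex_Ici _)
      (fun x hx => (hd x hx).continuousAt.continuousWithinAt)
      (fun x hx => (hd x (interior_subset hx)).differentiableAt.differentiableWithinAt) ?_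
    intro x hx
    have hx' : 0 ≤ x := interior_subset hx
    rw [(hd x hx').deriv]
    exact hF.re_deriv_div_nonneg hk (hre x hx')
  have := hmono Set.self_mem_Ici hs hs
  simp only [Complex.ofReal_zero, add_zero] at this
  exact (Real.log_le_log_iff (norm_pos_iff.2 (hF.sub_ne_zero hζ hk))
    (norm_pos_iff.2 (hF.sub_ne_zero (hre s hs) hk))).1 this

/-- Properness: near `iy` the values of `F` stay bounded, and bounded values at distance at least
`ε` from the complement form a compact subset of the image. Its preimage is compact in the open half
plane, hence away from `iy`. -/
theorem tendsto_infDist (hF : IsConcaveHalfPlane F) (hne : (F '' rightHalfPlane)ᶜ.Nonempty)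
    (y : ℝ) : Tendsto (fun η => Metric.infDist (F η) (F '' rightHalfPlane)ᶜ)
      (𝓝[rightHalfPlane] (y * Complex.I)) (𝓝 0) := by
  obtain ⟨k, hk⟩ := hne
  obtain ⟨G, hG1, hG2, hG3, hG4⟩ := hF.exists_inverse
  have hy1 : 0 < ((y : ℂ) * Complex.I + 1).re := by simp
  have hbdd : ∀ᶠ η in 𝓝[rightHalfPlane] (y * Complex.I),
      ‖F η - k‖ ≤ ‖F (y * Complex.I + 1) - k‖ + 1 := by
    have hc : ContinuousAt (fun η => ‖F (η + 1) - k‖) ((y : ℂ) * Complex.I) := by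
      have h1 : ContinuousAt (fun η : ℂ => F (η + 1)) ((y : ℂ) * Complex.I) :=
        ContinuousAt.comp (g := F) (hF.hasDerivAt hy1).continuousAt (by fun_prop)
      exact (h1.sub continuousAt_const).norm
    have h1 : ∀ᶠ η in 𝓝 ((y : ℂ) * Complex.I),
        ‖F (η + 1) - k‖ < ‖F (y * Complex.I + 1) - k‖ + 1 :=
      hc.eventually (gt_mem_nhds (by linarith))
    filter_upwards [nhdsWithin_le_nhds h1, self_mem_nhdsWithin] with η h2 hη
    have := hF.norm_sub_le_norm_add hk hη zero_le_one
    push_cast at this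
    linarith
  rw [tendsto_order]
  refine ⟨fun a ha => Eventually.of_forall fun η => ha.trans_le Metric.infDist_nonneg, ?_⟩
  intro ε hε
  set C : Set ℂ := {w | ‖w - k‖ ≤ ‖F (y * Complex.I + 1) - k‖ + 1 ∧
    ε ≤ Metric.infDist w (F '' rightHalfPlane)ᶜ} with hC
  have hCc : IsCompact C := by
    refine Metric.isCompact_of_isClosed_isBounded ?_ ?_
    · have h1 : Continuous fun w : ℂ => ‖w - k‖ := by fun_prop
      exact (isClosed_le h1 continuous_const).inter
        (isClosed_le continuous_const (Metric.continuous_infDist_pt _))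
    · refine Metric.isBounded_closedBall (x := k) (r := ‖F (y * Complex.I + 1) - k‖ + 1)
        |>.subset fun w hw => ?_
      rw [Metric.mem_closedBall, dist_eq_norm]
      exact hw.1
  have hCΩ : C ⊆ F '' rightHalfPlane := by
    intro w hw
    by_contra h
    have : Metric.infDist w (F '' rightHalfPlane)ᶜ = 0 := Metric.infDist_zero_of_mem h
    have := hw.2
    linarith
  have hGC : IsCompact (G '' C) := hCc.image_of_continuousOn (hG4.continuousOn.mono hCΩ)
  have hnot : (y : ℂ) * Complex.I ∉ G '' C := by
    rintro ⟨w, hw, h⟩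
    have := (hG2 w (hCΩ hw)).1
    rw [h, mem_rightHalfPlane] at this
    simp at this
  filter_upwards [hbdd, nhdsWithin_le_nhds (hGC.isClosed.isOpen_compl.mem_nhds hnot),
    self_mem_nhdsWithin] with η h1 h2 hη
  by_contra h3
  push Not at h3
  exact h2 ⟨F η, ⟨h1, h3⟩, hG1 η hη⟩

/-- A quantitative Julia inequality: Schwarz-Pick for `φ = F'/(F - k)` between `ζ` and `η`, where
`|φ η| ≥ 1 / η.re`. As `η → iy` with `b` fixed, the lower bound tends to `Re 1/(ζ - iy)`. -/
theorem boundary_lower_bound (hF : IsConcaveHalfPlane F) {ζ η k : ℂ} (hζ : 0 < ζ.re)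
    (hη : 0 < η.re) (hk : k ∈ (F '' rightHalfPlane)ᶜ) (hkη : ‖F η - k‖ ≤ η.re * ‖deriv F η‖)
    {b : ℝ} (hb : ‖deriv F ζ / (F ζ - k)‖ ≤ b) (hbη : b * η.re ≤ 1) (hne : ζ ≠ η) :
    (1 - b * η.re) ^ 2 * ζ.re / ‖ζ - η‖ ^ 2 ≤ (deriv F ζ / (F ζ - k)).re := by
  set φ : ℂ → ℂ := fun ζ => deriv F ζ / (F ζ - k) with hφ
  have hφd : DifferentiableOn ℂ φ rightHalfPlane :=
    (hF.diff.deriv isOpen_rightHalfPlane).div (hF.diff.sub_const k)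
      fun ζ hζ => hF.sub_ne_zero hζ hk
  have hφp : ∀ ζ ∈ rightHalfPlane, 0 ≤ (φ ζ).re := fun ζ hζ => hF.re_deriv_div_nonneg hk hζ
  have hsp := schwarzPick hφd hφp hζ hη
  have hB : 1 ≤ η.re * ‖φ η‖ := by
    simp only [hφ, norm_div]
    rw [← mul_div_assoc, le_div_iff₀ (norm_pos_iff.2 (hF.sub_ne_zero hη hk))]
    linarith
  have hB0 : 0 < ‖φ η‖ := by
    by_contra h
    have : ‖φ η‖ = 0 := le_antisymm (not_lt.1 h) (norm_nonneg _)
    rw [this] at hB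
    linarith
  have hd : 0 < ‖ζ - η‖ ^ 2 := by
    have := _root_.sub_ne_zero.2 hne
    positivity
  rw [div_le_iff₀ hd]
  have hbn : 0 ≤ b := (norm_nonneg _).trans hb
  have h1 : (1 - b * η.re) * ‖φ η‖ ≤ ‖φ ζ - φ η‖ := by
    have h2 : ‖φ η‖ - ‖φ ζ‖ ≤ ‖φ ζ - φ η‖ := by
      rw [norm_sub_rev]
      exact norm_sub_norm_le _ _
    have h3 : b ≤ b * (η.re * ‖φ η‖) := le_mul_of_one_le_right hbn hB
    have h4 : ‖φ ζ‖ ≤ b := hb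
    nlinarith
  have h5 : ((1 - b * η.re) * ‖φ η‖) ^ 2 ≤ ‖φ ζ - φ η‖ ^ 2 :=
    pow_le_pow_left₀ (mul_nonneg (by linarith) hB0.le) h1 2
  have h6 : (φ η).re ≤ ‖φ η‖ := Complex.re_le_norm _
  have h7 : ((1 - b * η.re) * ‖φ η‖) ^ 2 * (ζ.re * η.re) ≤
      ‖ζ - η‖ ^ 2 * ((φ ζ).re * ‖φ η‖) := by
    calc _ ≤ ‖φ ζ - φ η‖ ^ 2 * (ζ.re * η.re) := by gcongr
      _ ≤ ‖ζ - η‖ ^ 2 * ((φ ζ).re * (φ η).re) := hsp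
      _ ≤ _ := by
        gcongr
        exact hφp ζ hζ
  have h8 : (1 - b * η.re) ^ 2 * ζ.re * (η.re * ‖φ η‖) ≤ ‖ζ - η‖ ^ 2 * (φ ζ).re := by
    refine le_of_mul_le_mul_right ?_ hB0
    linarith
  have h9 : 0 ≤ (1 - b * η.re) ^ 2 * ζ.re := by positivity
  calc (1 - b * η.re) ^ 2 * ζ.re ≤ (1 - b * η.re) ^ 2 * ζ.re * (η.re * ‖φ η‖) :=
        le_mul_of_one_le_right h9 hB
    _ ≤ _ := h8
    _ = _ := mul_comm _ _

end IsConcaveHalfPlane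

theorem tendsto_div_const_sub_cobounded {ι : Type*} {l : Filter ι} {f : ι → ℂ}
    (hf : Tendsto f l (Bornology.cobounded ℂ)) (c w : ℂ) :
    Tendsto (fun x => c / (w - f x)) l (𝓝 0) := by
  have h1 : Tendsto (fun x => w - f x) l (Bornology.cobounded ℂ) := by
    rw [← tendsto_norm_atTop_iff_cobounded] at hf ⊢
    refine tendsto_atTop_mono' _ ?_ (tendsto_atTop_add_const_right _ (-‖w‖) hf)
    filter_upwards with x
    rw [norm_sub_rev, ← sub_eq_add_neg]
    exact norm_sub_norm_le (f x) w
  simpa [div_eq_mul_inv] using (Filter.tendsto_inv₀_cobounded.comp h1).const_mul c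

namespace IsConcaveHalfPlane

variable {F : ℂ → ℂ}

/-- With `k` a complement point nearest to `F η`, replacing `F η` by `k` costs `O(|F η - k|)`, which
tends to `0`; then `boundary_lower_bound` applies. As `k` moves with `η`, the bound `b = D / d` is
chosen independent of `k`. -/
theorem eventually_twoPoint_gt (hF : IsConcaveHalfPlane F)
    (hne : (F '' rightHalfPlane)ᶜ.Nonempty) {ζ : ℂ} (hζ : 0 < ζ.re) (y δ : ℝ) (hδ : 0 < δ) :
    ∀ᶠ η in 𝓝[rightHalfPlane] ((y : ℂ) * Complex.I),
      -δ < (deriv F ζ / (F ζ - F η) - 1 / (ζ - η)).re := by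
  set K := (F '' rightHalfPlane)ᶜ with hK
  set d := Metric.infDist (F ζ) K with hd
  have hd0 : 0 < d := (hF.isClosed_compl.notMem_iff_infDist_pos hne).1 fun h => h ⟨ζ, hζ, rfl⟩
  set D := ‖deriv F ζ‖ with hD
  set b := D / d with hb
  have hζy : ζ - (y : ℂ) * Complex.I ≠ 0 := by
    intro h
    have := congrArg Complex.re h
    simp at this
    linarith
  have hre : Tendsto (fun η : ℂ => η.re) (𝓝[rightHalfPlane] ((y : ℂ) * Complex.I)) (𝓝 0) := by
    have := (Complex.continuous_re.tendsto ((y : ℂ) * Complex.I)).mono_left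
      (nhdsWithin_le_nhds (s := rightHalfPlane))
    simpa using this
  have hinf := hF.tendsto_infDist hne y
  have hnorm : Tendsto (fun η : ℂ => ‖ζ - η‖ ^ 2) (𝓝[rightHalfPlane] ((y : ℂ) * Complex.I))
      (𝓝 (‖ζ - (y : ℂ) * Complex.I‖ ^ 2)) := by
    have h1 : Continuous fun η : ℂ => ‖ζ - η‖ ^ 2 := by fun_prop
    exact (h1.tendsto _).mono_left nhdsWithin_le_nhds
  have hnorm0 : ‖ζ - (y : ℂ) * Complex.I‖ ^ 2 ≠ 0 := by positivity
  have hlim : Tendsto (fun η => (1 - b * η.re) ^ 2 * ζ.re / ‖ζ - η‖ ^ 2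
      - (ζ.re - η.re) / ‖ζ - η‖ ^ 2 - 2 * D / d ^ 2 * Metric.infDist (F η) K)
      (𝓝[rightHalfPlane] ((y : ℂ) * Complex.I))
      (𝓝 ((1 - b * 0) ^ 2 * ζ.re / ‖ζ - (y : ℂ) * Complex.I‖ ^ 2
      - (ζ.re - 0) / ‖ζ - (y : ℂ) * Complex.I‖ ^ 2 - 2 * D / d ^ 2 * 0)) := by
    exact ((((((hre.const_mul b).const_sub 1).pow 2).mul_const _).div hnorm hnorm0).sub
      ((hre.const_sub _).div hnorm hnorm0)).sub (hinf.const_mul _)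
  have hlim0 : (1 - b * 0) ^ 2 * ζ.re / ‖ζ - (y : ℂ) * Complex.I‖ ^ 2
      - (ζ.re - 0) / ‖ζ - (y : ℂ) * Complex.I‖ ^ 2 - 2 * D / d ^ 2 * 0 = 0 := by ring
  rw [hlim0] at hlim
  have hbre : ∀ᶠ η in 𝓝[rightHalfPlane] ((y : ℂ) * Complex.I), b * η.re < 1 := by
    have := hre.const_mul b
    rw [mul_zero] at this
    exact this.eventually (gt_mem_nhds one_pos)
  have hηζ : ∀ᶠ η in 𝓝[rightHalfPlane] ((y : ℂ) * Complex.I), η.re < ζ.re :=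
    hre.eventually (gt_mem_nhds hζ)
  filter_upwards [hlim.eventually (lt_mem_nhds (neg_lt_zero.2 hδ)), hbre, hηζ,
    hinf.eventually (gt_mem_nhds (half_pos hd0)), self_mem_nhdsWithin] with η h1 h2 h3 h4 hη
  obtain ⟨k, hk, hki, hkη⟩ := hF.exists_nearest hne hη
  rw [hki] at h1 h4
  have hdk : d ≤ ‖F ζ - k‖ := by
    rw [← dist_eq_norm]
    exact Metric.infDist_le_dist_of_mem hk
  have hne' : ζ ≠ η := fun h => by rw [h] at h3; exact lt_irrefl _ h3
  have hbk : ‖deriv F ζ / (F ζ - k)‖ ≤ b := by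
    rw [norm_div, hb]
    gcongr
  have hlow := hF.boundary_lower_bound hζ hη hk hkη hbk h2.le hne'
  have hFne : F ζ - F η ≠ 0 := _root_.sub_ne_zero.2 fun h => hne' (hF.inj hζ hη h)
  have hkne := hF.sub_ne_zero hζ hk
  have hd2 : d / 2 ≤ ‖F ζ - F η‖ := by
    have : ‖F ζ - k‖ ≤ ‖F ζ - F η‖ + ‖F η - k‖ := by
      simpa using norm_add_le (F ζ - F η) (F η - k)
    linarith
  have hdiff : deriv F ζ / (F ζ - F η) - deriv F ζ / (F ζ - k) =
      deriv F ζ * (F η - k) / ((F ζ - F η) * (F ζ - k)) := by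
    field_simp
    ring
  have hdn : ‖deriv F ζ / (F ζ - F η) - deriv F ζ / (F ζ - k)‖ ≤ 2 * D / d ^ 2 * ‖F η - k‖ := by
    rw [hdiff, norm_div, norm_mul, norm_mul]
    calc D * ‖F η - k‖ / (‖F ζ - F η‖ * ‖F ζ - k‖) ≤ D * ‖F η - k‖ / (d / 2 * d) := by gcongr
      _ = _ := by field_simp
  have hdr := (abs_le.1 ((Complex.abs_re_le_norm _).trans hdn)).1
  have hinv : (1 / (ζ - η)).re = (ζ.re - η.re) / ‖ζ - η‖ ^ 2 := by
    rw [one_div, Complex.inv_re, Complex.sq_norm, Complex.sub_re]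
  rw [Complex.sub_re] at hdr ⊢
  rw [hinv]
  linarith

/-- The two-point inequality expressing the convexity of the complement. -/
theorem re_twoPoint_nonneg (hF : IsConcaveHalfPlane F)
    (hne : (F '' rightHalfPlane)ᶜ.Nonempty) {ζ η : ℂ} (hζ : 0 < ζ.re) (hη : 0 < η.re)
    (hζη : ζ ≠ η) : 0 ≤ (deriv F ζ / (F ζ - F η) - 1 / (ζ - η)).re := by
  have hζn : rightHalfPlane ∈ 𝓝 ζ := isOpen_rightHalfPlane.mem_nhds hζ
  -- As a function of `η` the expression equals `dslope S ζ / S`, which removes the singularity at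
  -- `η = ζ`. The minimum principle then needs only the boundary values.
  set S := dslope F ζ with hS
  have hSd : DifferentiableOn ℂ S rightHalfPlane := (Complex.differentiableOn_dslope hζn).2 hF.diff
  have hTd : DifferentiableOn ℂ (dslope S ζ) rightHalfPlane :=
    (Complex.differentiableOn_dslope hζn).2 hSd
  have hSζ : S ζ = deriv F ζ := dslope_same _ _
  have hSη : ∀ w, w ≠ ζ → S w = (F w - F ζ) / (w - ζ) := fun w hw => by
    rw [hS, dslope_of_ne _ hw, slope_def_field]
  have hS0 : ∀ w ∈ rightHalfPlane, S w ≠ 0 := by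
    intro w hw
    rcases eq_or_ne w ζ with rfl | h
    · rw [hSζ]
      exact hF.deriv_ne_zero hζ
    · rw [hSη w h]
      exact div_ne_zero (_root_.sub_ne_zero.2 fun h' => h (hF.inj hw hζ h'))
        (_root_.sub_ne_zero.2 h)
  have hNeq : ∀ w ∈ rightHalfPlane, w ≠ ζ →
      dslope S ζ w / S w = deriv F ζ / (F ζ - F w) - 1 / (ζ - w) := by
    intro w hw h
    have h1 := hS0 w hw
    rw [dslope_of_ne _ h, slope_def_field, hSζ]
    rw [hSη w h] at h1 ⊢
    have h2 : w - ζ ≠ 0 := _root_.sub_ne_zero.2 h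
    have h3 : F w - F ζ ≠ 0 := fun h' => h1 (by rw [h', zero_div])
    rw [← neg_sub (F w), ← neg_sub w]
    field_simp
    ring
  have hN := re_nonneg_of_boundary (hTd.div hSd hS0) ?_ ?_ (η := η) hη
  · rw [Pi.div_apply, hNeq η hη hζη.symm] at hN
    exact hN
  · intro y δ hδ
    have hζy : ∀ᶠ w in 𝓝[rightHalfPlane] ((y : ℂ) * Complex.I), w ≠ ζ := by
      refine nhdsWithin_le_nhds (isOpen_ne.mem_nhds ?_)
      intro h
      rw [← h] at hζ
      simp at hζ
    filter_upwards [hF.eventually_twoPoint_gt hne hζ y δ hδ, self_mem_nhdsWithin, hζy]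
      with w h1 h2 h3
    rw [Pi.div_apply, hNeq w h2 h3]
    exact h1
  · intro δ hδ
    have h1 : Tendsto (fun w => deriv F ζ / (F ζ - F w) - 1 / (ζ - w))
        (Bornology.cobounded ℂ ⊓ 𝓟 rightHalfPlane) (𝓝 (0 - 0)) :=
      (tendsto_div_const_sub_cobounded hF.tendsto _ _).sub
        (tendsto_div_const_sub_cobounded (tendsto_id.mono_left inf_le_left) _ _)
    have h2 := (Complex.continuous_re.tendsto _).comp h1
    simp only [sub_zero, Complex.zero_re] at h2
    have hζy : ∀ᶠ w in Bornology.cobounded ℂ ⊓ 𝓟 rightHalfPlane, w ≠ ζ :=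
      mem_inf_of_left (Bornology.isBounded_singleton)
    filter_upwards [h2.eventually (lt_mem_nhds (neg_lt_zero.2 hδ)), hζy,
      mem_inf_of_right (mem_principal_self _)] with w h3 h4 h5
    rw [Pi.div_apply, hNeq w h5 h4]
    exact h3

/-- On the vertical line through `ζ` the term `1/(ζ - η)` is imaginary, so the two-point inequality
says that `t ↦ Re (F(ζ + it)/F'(ζ))` is maximal at `t = 0`. Its second derivative there is `-Re
F''/F'`. -/
theorem re_deriv_deriv_div_nonneg (hF : IsConcaveHalfPlane F)
    (hne : (F '' rightHalfPlane)ᶜ.Nonempty) {ζ : ℂ} (hζ : 0 < ζ.re) :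
    0 ≤ (deriv (deriv F) ζ / deriv F ζ).re := by
  have hre : ∀ t : ℝ, 0 < (ζ + t * Complex.I).re := fun t => by simpa using hζ
  have h0 := hF.deriv_ne_zero hζ
  set g : ℝ → ℝ := fun t => (F (ζ + t * Complex.I) / deriv F ζ).re with hg
  have hline : ∀ t : ℝ, HasDerivAt (fun t : ℝ => ζ + t * Complex.I) Complex.I t := fun t => by
    simpa using ((Complex.ofRealCLM.hasDerivAt (x := t)).mul_const Complex.I).const_add ζ
  have hg1 : ∀ t : ℝ, HasDerivAt g ((Complex.I * deriv F (ζ + t * Complex.I)) / deriv F ζ).re t := by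
    intro t
    have h1 := (hF.hasDerivAt (hre t)).scomp t (hline t)
    exact Complex.reCLM.hasFDerivAt.comp_hasDerivAt t (h1.div_const (deriv F ζ))
  have hdd : HasDerivAt (deriv F) (deriv (deriv F) ζ) (ζ + (0 : ℝ) * Complex.I) := by
    have := ((hF.diff.deriv isOpen_rightHalfPlane).differentiableAt
      (isOpen_rightHalfPlane.mem_nhds hζ)).hasDerivAt
    simpa using this
  have hdg : deriv g = fun t : ℝ => ((Complex.I * deriv F (ζ + t * Complex.I)) / deriv F ζ).re :=
    funext fun t => (hg1 t).deriv
  have hg2 : deriv (deriv g) 0 = -(deriv (deriv F) ζ / deriv F ζ).re := by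
    rw [hdg]
    have h1 := hdd.scomp (0 : ℝ) (hline 0)
    have h2 := Complex.reCLM.hasFDerivAt.comp_hasDerivAt (0 : ℝ)
      ((h1.const_mul Complex.I).div_const (deriv F ζ))
    have h3 := h2.deriv
    refine h3.trans ?_
    simp only [smul_eq_mul, ← mul_assoc, Complex.I_mul_I, Complex.reCLM_apply]
    rw [neg_one_mul, neg_div, Complex.neg_re]
  have hmax : ∀ t, g t ≤ g 0 := by
    intro t
    rcases eq_or_ne t 0 with rfl | ht
    · rfl
    have htI : (t : ℂ) * Complex.I ≠ 0 := by simpa using ht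
    have h1 := hF.re_twoPoint_nonneg hne hζ (hre t) (by simpa using ht)
    have h2 : (1 / (ζ - (ζ + t * Complex.I))).re = 0 := by
      simp [Complex.inv_re]
    rw [Complex.sub_re, h2, sub_zero, ← inv_div, Complex.inv_re] at h1
    have h3 : F ζ - F (ζ + t * Complex.I) ≠ 0 := _root_.sub_ne_zero.2 fun h => by
      have := hF.inj hζ (hre t) h
      simp [ht] at this
    have h4 := Complex.normSq_pos.2 (div_ne_zero h3 h0)
    have h5 := mul_nonneg h1 h4.le
    rw [div_mul_cancel₀ _ h4.ne'] at h5
    rw [sub_div, Complex.sub_re] at h5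
    simpa [hg] using h5
  by_contra hcon
  push Not at hcon
  have hmin : IsLocalMin g 0 := by
    refine isLocalMin_of_deriv_deriv_pos (by rw [hg2]; linarith) ?_ (hg1 0).continuousAt
    rw [hdg]
    simp [mul_div_assoc, div_self h0]
  have heq : g =ᶠ[𝓝 0] fun _ => g 0 := hmin.mono fun t ht => le_antisymm (hmax t) ht
  have h1 := heq.deriv.deriv_eq
  simp only [deriv_const'] at h1
  rw [hg2] at h1
  simp at h1
  linarith

end IsConcaveHalfPlane

/-! ### The Cayley transform and primitives in the half plane -/

/-- The Cayley transform, mapping the unit disk onto the right half plane. -/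
def cayley (z : ℂ) : ℂ := (1 + z) / (1 - z)

/-- The inverse of the Cayley transform. -/
def cayleyInv (ζ : ℂ) : ℂ := (ζ - 1) / (ζ + 1)

theorem one_sub_ne_zero_of_mem_unitDisk {z : ℂ} (hz : z ∈ unitDisk) : 1 - z ≠ 0 := by
  intro h
  rw [unitDisk, mem_ball_zero_iff, ← sub_eq_zero.1 h] at hz
  simp at hz

theorem add_one_ne_zero_of_re_pos {ζ : ℂ} (hζ : 0 < ζ.re) : ζ + 1 ≠ 0 := by
  intro h
  have := congrArg Complex.re h
  simp at this
  linarith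

theorem cayley_mem {z : ℂ} (hz : z ∈ unitDisk) : cayley z ∈ rightHalfPlane := by
  have hn := Complex.normSq_pos.2 (one_sub_ne_zero_of_mem_unitDisk hz)
  rw [unitDisk, mem_ball_zero_iff] at hz
  have h2 : ‖z‖ ^ 2 < 1 := by nlinarith [norm_nonneg z]
  rw [Complex.sq_norm, Complex.normSq_apply] at h2
  rw [mem_rightHalfPlane, cayley]
  simp only [Complex.div_re, ← add_div]
  apply div_pos _ hn
  simp
  nlinarith

theorem cayleyInv_mem {ζ : ℂ} (hζ : ζ ∈ rightHalfPlane) : cayleyInv ζ ∈ unitDisk := by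
  have h := norm_pos_iff.2 (add_one_ne_zero_of_re_pos hζ)
  rw [mem_rightHalfPlane] at hζ
  rw [unitDisk, mem_ball_zero_iff, cayleyInv, norm_div, div_lt_one h]
  refine lt_of_pow_lt_pow_left₀ 2 (norm_nonneg _) ?_
  simp only [Complex.sq_norm, Complex.normSq_apply]
  simp
  nlinarith

theorem cayleyInv_cayley {z : ℂ} (hz : z ∈ unitDisk) : cayleyInv (cayley z) = z := by
  have h := one_sub_ne_zero_of_mem_unitDisk hz
  have h2 := add_one_ne_zero_of_re_pos (cayley_mem hz)
  rw [cayleyInv, div_eq_iff h2, cayley]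
  field_simp
  ring

theorem cayley_cayleyInv {ζ : ℂ} (hζ : ζ ∈ rightHalfPlane) : cayley (cayleyInv ζ) = ζ := by
  have h := add_one_ne_zero_of_re_pos hζ
  have h2 := one_sub_ne_zero_of_mem_unitDisk (cayleyInv_mem hζ)
  rw [cayley, div_eq_iff h2, cayleyInv]
  field_simp
  ring

theorem hasDerivAt_cayley {z : ℂ} (hz : z ∈ unitDisk) :
    HasDerivAt cayley (2 / (1 - z) ^ 2) z := by
  have h := one_sub_ne_zero_of_mem_unitDisk hz
  have h1 := ((hasDerivAt_id z).const_add 1).div ((hasDerivAt_id z).const_sub 1) h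
  refine h1.congr_deriv ?_
  simp only [id]
  congr 1
  ring

theorem hasDerivAt_cayleyInv {ζ : ℂ} (hζ : ζ ∈ rightHalfPlane) :
    HasDerivAt cayleyInv (2 / (ζ + 1) ^ 2) ζ := by
  have h := add_one_ne_zero_of_re_pos hζ
  have h1 := ((hasDerivAt_id ζ).sub_const 1).div ((hasDerivAt_id ζ).add_const 1) h
  refine h1.congr_deriv ?_
  simp only [id]
  congr 1
  ring

theorem isOpen_unitDisk : IsOpen unitDisk := Metric.isOpen_ball

theorem exists_primitive_rightHalfPlane {h : ℂ → ℂ} (hh : DifferentiableOn ℂ h rightHalfPlane) :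
    ∃ Φ : ℂ → ℂ, ∀ ζ ∈ rightHalfPlane, HasDerivAt Φ (h ζ) ζ := by
  have h1 : DifferentiableOn ℂ (fun z => h (cayley z) * (2 / (1 - z) ^ 2)) (Metric.ball 0 1) := by
    refine DifferentiableOn.mul ?_ ?_
    · exact hh.comp (fun z hz => (hasDerivAt_cayley hz).differentiableAt.differentiableWithinAt)
        fun z hz => cayley_mem hz
    · exact DifferentiableOn.div (by fun_prop) (by fun_prop)
        fun z hz => pow_ne_zero 2 (one_sub_ne_zero_of_mem_unitDisk hz)
  obtain ⟨Φ, hΦ⟩ := h1.isExactOn_ball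
  refine ⟨fun ζ => Φ (cayleyInv ζ), fun ζ hζ => ?_⟩
  have h2 := (hΦ _ (cayleyInv_mem hζ)).comp ζ (hasDerivAt_cayleyInv hζ)
  refine h2.congr_deriv ?_
  have h3 := one_sub_ne_zero_of_mem_unitDisk (cayleyInv_mem hζ)
  have h4 := add_one_ne_zero_of_re_pos hζ
  dsimp only
  rw [cayley_cayleyInv hζ, mul_assoc]
  have h5 : 1 - cayleyInv ζ = 2 / (ζ + 1) := by
    rw [cayleyInv]
    field_simp
    ring
  rw [h5]
  field_simp

theorem exists_log_rightHalfPlane {h : ℂ → ℂ} (hh : DifferentiableOn ℂ h rightHalfPlane)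
    (h0 : ∀ ζ ∈ rightHalfPlane, h ζ ≠ 0) :
    ∃ L : ℂ → ℂ, (∀ ζ ∈ rightHalfPlane, HasDerivAt L (deriv h ζ / h ζ) ζ) ∧
      ∀ ζ ∈ rightHalfPlane, Complex.exp (L ζ) = h ζ := by
  obtain ⟨Φ, hΦ⟩ := exists_primitive_rightHalfPlane
    ((hh.deriv isOpen_rightHalfPlane).div hh h0)
  have h1m : (1 : ℂ) ∈ rightHalfPlane := by simp [mem_rightHalfPlane]
  set L : ℂ → ℂ := fun ζ => Φ ζ - Φ 1 + Complex.log (h 1) with hL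
  have hLd : ∀ ζ ∈ rightHalfPlane, HasDerivAt L (deriv h ζ / h ζ) ζ := fun ζ hζ =>
    ((hΦ ζ hζ).sub_const _).add_const _
  refine ⟨L, hLd, fun ζ hζ => ?_⟩
  have hd : ∀ w ∈ rightHalfPlane, HasDerivAt (fun w => h w * Complex.exp (-L w)) 0 w := by
    intro w hw
    have h2 := (hh.differentiableAt (isOpen_rightHalfPlane.mem_nhds hw)).hasDerivAt.mul
      (hLd w hw).neg.cexp
    refine h2.congr_deriv ?_
    have := h0 w hw
    field_simp
    ring
  have hc := isOpen_rightHalfPlane.is_const_of_deriv_eq_zero convex_rightHalfPlane.isPreconnected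
    (fun w hw => (hd w hw).differentiableAt.differentiableWithinAt) (fun w hw => (hd w hw).deriv)
    hζ h1m
  have hL1 : L 1 = Complex.log (h 1) := by simp [hL]
  simp only [hL1, Complex.exp_neg, Complex.exp_log (h0 1 h1m)] at hc
  rw [mul_inv_cancel₀ (h0 1 h1m), mul_inv_eq_one₀ (Complex.exp_ne_zero _)] at hc
  exact hc.symm

/-! ### Angular measure -/

theorem volume_inter_Ioc_eq_of_periodic {B : Set ℝ} (hB : MeasurableSet B)
    (hper : ∀ θ : ℝ, θ + 2 * Real.pi ∈ B ↔ θ ∈ B) (c : ℝ) :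
    volume (B ∩ Set.Ioc (-Real.pi) Real.pi) = volume (B ∩ Set.Ioc c (c + 2 * Real.pi)) := by
  have h1 := isAddFundamentalDomain_Ioc Real.two_pi_pos (-Real.pi) (volume : Measure ℝ)
  have h2 := isAddFundamentalDomain_Ioc Real.two_pi_pos c (volume : Measure ℝ)
  have h3 := h1.measure_set_eq h2 hB ?_
  · rw [← h3]
    congr 3
    ring
  · rintro ⟨g, hg⟩
    obtain ⟨n, rfl⟩ := AddSubgroup.mem_zmultiples_iff.1 hg
    have hz : ∀ n : ℤ, ∀ θ : ℝ, θ + n * (2 * Real.pi) ∈ B ↔ θ ∈ B := by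
      intro n
      induction n using Int.induction_on with
      | zero => simp
      | succ n ih =>
        intro θ
        rw [← ih θ, ← hper (θ + (n : ℤ) * _)]
        push_cast
        ring_nf
      | pred n ih =>
        intro θ
        rw [← ih θ, ← hper (θ + _)]
        push_cast
        ring_nf
    ext θ
    have := hz n θ
    rw [Set.mem_preimage, ← this]
    simp [AddSubgroup.vadd_def, add_comm]

/-- Two closed half circles of directions meet in the arc from `A₂ + π/2` to `A₁ + 3π/2`. In the
extreme case `A₂ = A₁ + π` the opposite point `A₂ - π/2` also belongs to both; it is null. -/
theorem volume_cos_nonpos_le {A₁ A₂ : ℝ} (h₂ : A₂ ≤ A₁ + Real.pi) :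
    volume ({θ : ℝ | Real.cos (θ - A₁) ≤ 0 ∧ Real.cos (θ - A₂) ≤ 0} ∩
      Set.Ioc (-Real.pi) Real.pi) ≤ ENNReal.ofReal (Real.pi - (A₂ - A₁)) := by
  have hpi := Real.pi_pos
  rw [volume_inter_Ioc_eq_of_periodic _ _ A₁]
  · have hsub : {θ : ℝ | Real.cos (θ - A₁) ≤ 0 ∧ Real.cos (θ - A₂) ≤ 0} ∩
        Set.Ioc A₁ (A₁ + 2 * Real.pi) ⊆
        Set.Icc (A₂ + Real.pi / 2) (A₁ + 3 * Real.pi / 2) ∪ {A₂ - Real.pi / 2} := by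
      rintro θ ⟨⟨h3, h4⟩, h5, h6⟩
      have h7 : A₁ + Real.pi / 2 ≤ θ := by
        by_contra h
        push Not at h
        exact absurd h3 (not_le.2 (Real.cos_pos_of_mem_Ioo ⟨by linarith, by linarith⟩))
      have h8 : θ ≤ A₁ + 3 * Real.pi / 2 := by
        by_contra h
        push Not at h
        have : 0 < Real.cos (θ - A₁ - 2 * Real.pi) :=
          Real.cos_pos_of_mem_Ioo ⟨by linarith, by linarith⟩
        rw [Real.cos_sub_two_pi] at this
        linarith
      by_cases h9 : A₂ + Real.pi / 2 ≤ θ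
      · exact Or.inl ⟨h9, h8⟩
      · right
        push Not at h9
        by_contra h10
        rw [Set.mem_singleton_iff] at h10
        have h11 : A₂ - Real.pi / 2 < θ := lt_of_le_of_ne (by linarith) (Ne.symm h10)
        exact absurd h4 (not_le.2 (Real.cos_pos_of_mem_Ioo ⟨by linarith, by linarith⟩))
    refine (measure_mono hsub).trans ((measure_union_le _ _).trans ?_)
    rw [Real.volume_Icc, Real.volume_singleton, add_zero]
    apply le_of_eq
    congr 1
    ring
  · have hc : ∀ A : ℝ, Continuous fun θ : ℝ => Real.cos (θ - A) := fun A => by fun_prop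
    exact (isClosed_le (hc A₁) continuous_const).measurableSet.inter
      (isClosed_le (hc A₂) continuous_const).measurableSet
  · intro θ
    have h : ∀ A, Real.cos (θ + 2 * Real.pi - A) = Real.cos (θ - A) := fun A => by
      rw [add_sub_right_comm, Real.cos_add_two_pi]
    simp [h]

theorem le_volume_not_eventually {Ω : Set ℂ} {α : ℝ} (hα : 0 ≤ α)
    (h : openingAngleAtInfty Ω ≤ Real.pi * α) :
    ENNReal.ofReal (2 * Real.pi - Real.pi * α) ≤ volume {θ : ℝ | θ ∈ Set.Ioc (-Real.pi) Real.pi ∧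
      ¬ ∀ᶠ r : ℝ in atTop, (r : ℂ) * Complex.exp (θ * Complex.I) ∈ Ω} := by
  set S := {θ : ℝ | θ ∈ Set.Ioc (-Real.pi) Real.pi ∧
    ∀ᶠ r : ℝ in atTop, (r : ℂ) * Complex.exp (θ * Complex.I) ∈ Ω} with hS
  set T := {θ : ℝ | θ ∈ Set.Ioc (-Real.pi) Real.pi ∧
    ¬ ∀ᶠ r : ℝ in atTop, (r : ℂ) * Complex.exp (θ * Complex.I) ∈ Ω} with hT
  have hsub : Set.Ioc (-Real.pi) Real.pi ⊆ S ∪ T := by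
    intro θ hθ
    by_cases h1 : ∀ᶠ r : ℝ in atTop, (r : ℂ) * Complex.exp (θ * Complex.I) ∈ Ω
    · exact Or.inl ⟨hθ, h1⟩
    · exact Or.inr ⟨hθ, h1⟩
  have hfin : volume S ≠ ⊤ := by
    refine ne_top_of_le_ne_top ?_ (measure_mono (show S ⊆ Set.Ioc (-Real.pi) Real.pi from
      fun θ hθ => hθ.1))
    simp
  have h1 : volume S ≤ ENNReal.ofReal (Real.pi * α) :=
    ENNReal.le_ofReal_iff_toReal_le hfin (by positivity) |>.2 h
  have h2 := (measure_mono (μ := volume) hsub).trans (measure_union_le S T)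
  rw [Real.volume_Ioc] at h2
  have h3 : ENNReal.ofReal (2 * Real.pi) ≤ ENNReal.ofReal (Real.pi * α) + volume T := by
    refine le_trans ?_ (h2.trans (by gcongr))
    apply le_of_eq
    congr 1
    ring
  rw [ENNReal.ofReal_sub _ (by positivity)]
  exact tsub_le_iff_left.2 h3

/-! ### Recession directions, oscillation of `arg F'`, bounds for `F''/F'` -/

namespace IsConcaveHalfPlane

variable {F : ℂ → ℂ}

/-- Liouville: if `F` were onto, `exp (-G)` would be a bounded entire function. -/
theorem compl_nonempty (hF : IsConcaveHalfPlane F) : (F '' rightHalfPlane)ᶜ.Nonempty := by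
  obtain ⟨G, hG1, hG2, hG3, hG4⟩ := hF.exists_inverse
  by_contra h
  rw [Set.not_nonempty_iff_eq_empty, Set.compl_empty_iff] at h
  rw [h] at hG2 hG4
  have hd : Differentiable ℂ fun w => Complex.exp (-G w) :=
    (differentiableOn_univ.1 hG4).neg.cexp
  have hb : Bornology.IsBounded (Set.range fun w => Complex.exp (-G w)) := by
    refine Metric.isBounded_closedBall (x := (0 : ℂ)) (r := 1) |>.subset ?_
    rintro _ ⟨w, rfl⟩
    rw [mem_closedBall_zero_iff, Complex.norm_exp, Real.exp_le_one_iff, Complex.neg_re]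
    have := (hG2 w trivial).1
    rw [mem_rightHalfPlane] at this
    linarith
  have h2 := congrArg norm (hd.apply_eq_apply_of_bounded hb (F 1) (F 2))
  rw [hG1 1 (by simp [mem_rightHalfPlane]), hG1 2 (by simp [mem_rightHalfPlane])] at h2
  simp [Complex.norm_exp] at h2

/-- A circle about `k` enclosing the complement would lie in the image, where `1/(w - k)` has the
primitive `L ∘ G` (`L` a logarithm of `F - k`); yet its integral is `2πi`. -/
theorem not_isBounded_compl (hF : IsConcaveHalfPlane F) :
    ¬ Bornology.IsBounded (F '' rightHalfPlane)ᶜ := by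
  intro hb
  obtain ⟨k, hk⟩ := hF.compl_nonempty
  obtain ⟨R, hR⟩ := hb.subset_ball_lt 0 k
  obtain ⟨hR0, hR⟩ := hR
  obtain ⟨G, hG1, hG2, hG3, hG4⟩ := hF.exists_inverse
  obtain ⟨L, hL, -⟩ := exists_log_rightHalfPlane (h := fun ζ => F ζ - k) (hF.diff.sub_const k)
    fun ζ hζ => hF.sub_ne_zero hζ hk
  have hz : (∮ w in C(k, R), (w - k)⁻¹) = 0 := by
    refine circleIntegral.integral_eq_zero_of_hasDerivWithinAt (f := fun w => L (G w)) hR0.le ?_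
    intro w hw
    have hwΩ : w ∈ F '' rightHalfPlane := by
      by_contra h
      have := hR h
      rw [Metric.mem_ball] at this
      rw [Metric.mem_sphere] at hw
      linarith
    obtain ⟨h1, h2⟩ := hG2 w hwΩ
    have h3 := hG3 _ h1
    rw [h2] at h3
    have h4 := (hL _ h1).comp w h3
    refine (h4.congr_deriv ?_).hasDerivWithinAt
    rw [deriv_sub_const, h2]
    have := hF.deriv_ne_zero h1
    field_simp
  rw [circleIntegral.integral_sub_center_inv k hR0.ne'] at hz
  simp at hz

/-- The ray meets the complement at arbitrarily large radii `r`. Convex combinations of `k` and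
these points, with weight `t / r`, converge to `k + t e^{iθ}`, and the complement is closed. -/
theorem recession_of_not_eventually (hF : IsConcaveHalfPlane F) {θ : ℝ}
    (h : ¬ ∀ᶠ r : ℝ in atTop, (r : ℂ) * Complex.exp (θ * Complex.I) ∈ F '' rightHalfPlane)
    {k : ℂ} (hk : k ∈ (F '' rightHalfPlane)ᶜ) {t : ℝ} (ht : 0 ≤ t) :
    k + t * Complex.exp (θ * Complex.I) ∈ (F '' rightHalfPlane)ᶜ := by
  set e := Complex.exp (θ * Complex.I)
  have hlim : Tendsto (fun r : ℝ => k + t * e - ((t / r : ℝ) : ℂ) * k) atTop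
      (𝓝 (k + t * e - ((0 : ℝ) : ℂ) * k)) := by
    refine Tendsto.const_sub _ (Tendsto.mul_const _ ?_)
    exact (Complex.continuous_ofReal.tendsto 0).comp (tendsto_const_nhds.div_atTop tendsto_id)
  simp only [Complex.ofReal_zero, zero_mul, sub_zero] at hlim
  refine hF.isClosed_compl.mem_of_frequently_of_tendsto ?_ hlim
  rw [not_eventually] at h
  refine (h.and_eventually ((eventually_ge_atTop t).and (eventually_gt_atTop 0))).mono ?_
  rintro r ⟨hr, hrt, hr0⟩
  have hmem := hF.convex hk hr (a := 1 - t / r) (b := t / r)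
    (by rw [sub_nonneg, div_le_one hr0]; exact hrt) (by positivity) (by ring)
  convert hmem using 1
  have : (r : ℂ) ≠ 0 := by exact_mod_cast hr0.ne'
  simp only [Complex.real_smul]
  push_cast
  field_simp
  ring

theorem exists_recession (hF : IsConcaveHalfPlane F) :
    ∃ θ : ℝ, ∀ k ∈ (F '' rightHalfPlane)ᶜ, ∀ t : ℝ, 0 ≤ t →
      k + t * Complex.exp (θ * Complex.I) ∈ (F '' rightHalfPlane)ᶜ := by
  have hub := hF.not_isBounded_compl
  have hex : ∀ n : ℕ, ∃ w ∈ (F '' rightHalfPlane)ᶜ, (n : ℝ) < ‖w‖ := by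
    intro n
    by_contra h
    push Not at h
    exact hub (Metric.isBounded_closedBall (x := (0 : ℂ)) (r := n) |>.subset fun w hw => by
      simpa using h w hw)
  choose w hwK hwn using hex
  have hmem : ∀ n, w n / ‖w n‖ ∈ Metric.sphere (0 : ℂ) 1 := by
    intro n
    have : ‖w n‖ ≠ 0 := ((Nat.cast_nonneg n).trans_lt (hwn n)).ne'
    simp [this]
  obtain ⟨v, hv, φ, hφ, hlim⟩ := (isCompact_sphere (0 : ℂ) 1).tendsto_subseq hmem
  have hv1 : ‖v‖ = 1 := by simpa using hv
  refine ⟨v.arg, fun k hk t ht => ?_⟩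
  have hve : Complex.exp (v.arg * Complex.I) = v := by
    have := Complex.norm_mul_exp_arg_mul_I v
    rwa [hv1, Complex.ofReal_one, one_mul] at this
  rw [hve]
  have hnorm : Tendsto (fun n => ‖w (φ n)‖) atTop atTop := by
    refine tendsto_atTop_mono (fun n => (hwn (φ n)).le) ?_
    exact tendsto_natCast_atTop_atTop.comp hφ.tendsto_atTop
  have hl2 : Tendsto (fun n => k - ((t / ‖w (φ n)‖ : ℝ) : ℂ) * k + t * (w (φ n) / ‖w (φ n)‖)) atTop
      (𝓝 (k - ((0 : ℝ) : ℂ) * k + t * v)) := by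
    refine Tendsto.add (Tendsto.const_sub _ (Tendsto.mul_const _ ?_)) (hlim.const_mul _)
    exact (Complex.continuous_ofReal.tendsto 0).comp (tendsto_const_nhds.div_atTop hnorm)
  simp only [Complex.ofReal_zero, zero_mul, sub_zero] at hl2
  refine hF.isClosed_compl.mem_of_tendsto hl2 ?_
  filter_upwards [hnorm.eventually_ge_atTop t, hnorm.eventually_gt_atTop 0] with n h1 h2
  have hmem := hF.convex hk (hwK (φ n)) (a := 1 - t / ‖w (φ n)‖) (b := t / ‖w (φ n)‖)
    (by rw [sub_nonneg, div_le_one h2]; exact h1) (by positivity) (by ring)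
  convert hmem using 1
  have : (‖w (φ n)‖ : ℂ) ≠ 0 := by exact_mod_cast h2.ne'
  simp only [Complex.real_smul]
  push_cast
  field_simp

/-- `Re (F - k - tv)/F' ≥ 0` for all `t ≥ 0` forces the coefficient of `t` to have the right sign.
-/
theorem re_recession_nonpos (hF : IsConcaveHalfPlane F) {v k : ℂ}
    (hv : ∀ t : ℝ, 0 ≤ t → k + t * v ∈ (F '' rightHalfPlane)ᶜ) {ζ : ℂ} (hζ : 0 < ζ.re) :
    (v / deriv F ζ).re ≤ 0 := by
  by_contra hcon
  push Not at hcon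
  set A := ((F ζ - k) / deriv F ζ).re with hA
  set B := (v / deriv F ζ).re with hB
  have h := hF.re_div_deriv_nonneg (hv ((|A| + 1) / B) (by positivity)) hζ
  have h2 : (F ζ - (k + (((|A| + 1) / B : ℝ) : ℂ) * v)) / deriv F ζ =
      (F ζ - k) / deriv F ζ - (((|A| + 1) / B : ℝ) : ℂ) * (v / deriv F ζ) := by ring
  rw [h2, Complex.sub_re, Complex.re_ofReal_mul, ← hA, ← hB, div_mul_cancel₀ _ hcon.ne'] at h
  linarith [le_abs_self A]

end IsConcaveHalfPlane

theorem cos_sub_nonpos_of_re_nonpos {θ : ℝ} {L w : ℂ} (hL : Complex.exp L = w)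
    (h : (Complex.exp (θ * Complex.I) / w).re ≤ 0) : Real.cos (θ - L.im) ≤ 0 := by
  have h1 : Complex.exp (θ * Complex.I) / w =
      (Real.exp (-L.re) : ℂ) * Complex.exp ((θ - L.im : ℝ) * Complex.I) := by
    rw [← hL, ← Complex.exp_sub, Complex.ofReal_exp, ← Complex.exp_add]
    congr 1
    apply Complex.ext <;> simp
  rw [h1, Complex.re_ofReal_mul, Complex.exp_ofReal_mul_I_re] at h
  exact nonpos_of_mul_nonpos_right h (Real.exp_pos _)

/-- An interval on which `cos (θ - ·)` is nonpositive has length at most `π`. -/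
theorem le_add_pi_of_cos_nonpos {θ A₁ A₂ : ℝ}
    (h : ∀ t ∈ Set.Icc A₁ A₂, Real.cos (θ - t) ≤ 0) : A₂ ≤ A₁ + Real.pi := by
  by_contra hcon
  push Not at hcon
  have hpi := Real.pi_pos
  have hz : ∀ t, A₁ ≤ t → t + Real.pi ≤ A₂ → Real.cos (θ - t) = 0 := by
    intro t h1 h2
    have h3 := h t ⟨h1, by linarith⟩
    have h4 := h (t + Real.pi) ⟨by linarith, h2⟩
    rw [← sub_sub, Real.cos_sub_pi] at h4
    linarith
  set δ := min (A₂ - A₁ - Real.pi) (Real.pi / 2) with hδ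
  have hδ0 : 0 < δ := lt_min (by linarith) (by linarith)
  have hδ1 : δ ≤ A₂ - A₁ - Real.pi := min_le_left _ _
  have hδ2 : δ ≤ Real.pi / 2 := min_le_right _ _
  have h1 := hz A₁ le_rfl hcon.le
  have h2 := hz (A₁ + δ) (by linarith) (by linarith)
  rw [← sub_sub, Real.cos_sub, h1, zero_mul, zero_add] at h2
  rcases mul_eq_zero.1 h2 with h3 | h3
  · have := Real.sin_sq_add_cos_sq (θ - A₁)
    rw [h1, h3] at this
    norm_num at this
  · exact (Real.sin_pos_of_pos_of_lt_pi hδ0 (by linarith)).ne' h3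

namespace IsConcaveHalfPlane

variable {F : ℂ → ℂ}

/-- The oscillation of the argument of `F'` is controlled by the opening angle. -/
theorem im_log_sub_le (hF : IsConcaveHalfPlane F) {α : ℝ} (hα₁ : 1 < α)
    (hangle : openingAngleAtInfty (F '' rightHalfPlane) ≤ Real.pi * α) {L : ℂ → ℂ}
    (hLc : ContinuousOn L rightHalfPlane)
    (hL : ∀ ζ ∈ rightHalfPlane, Complex.exp (L ζ) = deriv F ζ) {ζ₁ ζ₂ : ℂ}
    (h₁ : ζ₁ ∈ rightHalfPlane) (h₂ : ζ₂ ∈ rightHalfPlane) :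
    (L ζ₂).im - (L ζ₁).im ≤ Real.pi * (α - 1) := by
  have hpi := Real.pi_pos
  rcases le_total (L ζ₂).im (L ζ₁).im with hle | hle
  · have : 0 ≤ Real.pi * (α - 1) := mul_nonneg hpi.le (by linarith)
    linarith
  obtain ⟨θ₀, hθ₀⟩ := hF.exists_recession
  obtain ⟨k, hk⟩ := hF.compl_nonempty
  -- A single recession direction already limits the oscillation to `π`, by intermediate values; the
  -- arc estimate `volume_cos_nonpos_le` requires this.
  have hosc : (L ζ₂).im ≤ (L ζ₁).im + Real.pi := by
    refine le_add_pi_of_cos_nonpos (θ := θ₀) fun t ht => ?_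
    have hpre : IsPreconnected ((fun ζ => (L ζ).im) '' rightHalfPlane) :=
      convex_rightHalfPlane.isPreconnected.image _ (Complex.continuous_im.comp_continuousOn hLc)
    obtain ⟨ζ, hζ, rfl⟩ := hpre.Icc_subset ⟨ζ₁, h₁, rfl⟩ ⟨ζ₂, h₂, rfl⟩ ht
    exact cos_sub_nonpos_of_re_nonpos (hL ζ hζ) (hF.re_recession_nonpos (hθ₀ k hk) hζ)
  -- Directions not eventually in the image lie in both half circles, so `2π - πα ≤ π - (A₂ - A₁)`.
  have h1 := le_volume_not_eventually (by linarith) hangle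
  have h2 := h1.trans (measure_mono (t := {θ : ℝ | Real.cos (θ - (L ζ₁).im) ≤ 0 ∧
      Real.cos (θ - (L ζ₂).im) ≤ 0} ∩ Set.Ioc (-Real.pi) Real.pi) ?_)
  · have h3 := h2.trans (volume_cos_nonpos_le hosc)
    rw [ENNReal.ofReal_le_ofReal_iff (by linarith)] at h3
    linarith
  · rintro θ ⟨hθ, hθ2⟩
    have hrec := fun t ht => hF.recession_of_not_eventually hθ2 hk (t := t) ht
    exact ⟨⟨cos_sub_nonpos_of_re_nonpos (hL _ h₁) (hF.re_recession_nonpos hrec h₁),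
      cos_sub_nonpos_of_re_nonpos (hL _ h₂) (hF.re_recession_nonpos hrec h₂)⟩, hθ⟩

/-- After a rotation centring its argument, `F'` raised to the power `1/(α - 1)` has nonnegative
real part. The infinitesimal Schwarz-Pick lemma bounds its logarithmic derivative. -/
theorem norm_preSchwarzian_mul_re_le (hF : IsConcaveHalfPlane F) {α : ℝ} (hα₁ : 1 < α)
    (hangle : openingAngleAtInfty (F '' rightHalfPlane) ≤ Real.pi * α) {ζ : ℂ}
    (hζ : 0 < ζ.re) : ‖preSchwarzian F ζ‖ * ζ.re ≤ α - 1 := by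
  have hm : 0 < α - 1 := by linarith
  obtain ⟨L, hLd, hL⟩ := exists_log_rightHalfPlane (hF.diff.deriv isOpen_rightHalfPlane)
    fun ζ hζ => hF.deriv_ne_zero hζ
  have hLdiff : DifferentiableOn ℂ L rightHalfPlane := fun w hw =>
    (hLd w hw).differentiableAt.differentiableWithinAt
  set B : Set ℝ := (fun w => (L w).im) '' rightHalfPlane with hB
  have hosc : ∀ s ∈ B, ∀ t ∈ B, t - s ≤ Real.pi * (α - 1) := by
    rintro _ ⟨w₁, h₁, rfl⟩ _ ⟨w₂, h₂, rfl⟩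
    exact hF.im_log_sub_le hα₁ hangle hLdiff.continuousOn hL h₁ h₂
  have hBne : B.Nonempty := ⟨_, ζ, hζ, rfl⟩
  have hsup : ∀ s ∈ B, sSup B ≤ s + Real.pi * (α - 1) := fun s hs =>
    csSup_le hBne fun t ht => by linarith [hosc s hs t ht]
  have hbdd : BddAbove B := by
    obtain ⟨s, hs⟩ := hBne
    exact ⟨s + Real.pi * (α - 1), fun t ht => by linarith [hosc s hs t ht]⟩
  set c := sSup B - Real.pi * (α - 1) / 2 with hc
  have hAc : ∀ w ∈ rightHalfPlane, |(L w).im - c| ≤ Real.pi * (α - 1) / 2 := by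
    intro w hw
    have hwB : (L w).im ∈ B := ⟨w, hw, rfl⟩
    rw [abs_le, hc]
    constructor
    · linarith [hsup _ hwB]
    · linarith [le_csSup hbdd hwB]
  set h : ℂ → ℂ := fun w => Complex.exp ((L w - c * Complex.I) / ((α - 1 : ℝ) : ℂ)) with hh
  have hhd : ∀ w ∈ rightHalfPlane,
      HasDerivAt h (h w * (preSchwarzian F w / ((α - 1 : ℝ) : ℂ))) w := fun w hw =>
    (((hLd w hw).sub_const _).div_const _).cexp
  have hhp : ∀ w ∈ rightHalfPlane, 0 ≤ (h w).re := by
    intro w hw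
    rw [hh]
    simp only [Complex.exp_re]
    refine mul_nonneg (Real.exp_pos _).le (Real.cos_nonneg_of_mem_Icc ?_)
    have h1 := hAc w hw
    rw [Complex.div_ofReal_im]
    have h2 : (L w - c * Complex.I).im = (L w).im - c := by simp
    rw [h2]
    have h3 := abs_le.1 h1
    constructor
    · rw [le_div_iff₀ hm]; linarith [h3.1]
    · rw [div_le_iff₀ hm]; linarith [h3.2]
  have hsp := norm_deriv_mul_re_le (φ := h)
    (fun w hw => (hhd w hw).differentiableAt.differentiableWithinAt) hhp hζ
  rw [(hhd ζ hζ).deriv, norm_mul, norm_div, Complex.norm_real, Real.norm_of_nonneg hm.le] at hsp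
  have hh0 : 0 < ‖h ζ‖ := norm_pos_iff.2 (Complex.exp_ne_zero _)
  have h4 := hsp.trans (Complex.re_le_norm (h ζ))
  have h5 : ‖h ζ‖ * (‖preSchwarzian F ζ‖ * ζ.re) ≤ ‖h ζ‖ * (α - 1) := by
    have : ‖h ζ‖ * (‖preSchwarzian F ζ‖ / (α - 1)) * ζ.re * (α - 1) =
      ‖h ζ‖ * (‖preSchwarzian F ζ‖ * ζ.re) := by field_simp
    rw [← this]
    gcongr
  exact le_of_mul_le_mul_left h5 hh0

theorem differentiableOn_preSchwarzian (hF : IsConcaveHalfPlane F) :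
    DifferentiableOn ℂ (preSchwarzian F) rightHalfPlane :=
  ((hF.diff.deriv isOpen_rightHalfPlane).deriv isOpen_rightHalfPlane).div
    (hF.diff.deriv isOpen_rightHalfPlane) fun _ hζ => hF.deriv_ne_zero hζ

/-- The sharp differential inequality for the pre-Schwarzian derivative. -/
theorem re_mul_normSq_preSchwarzian_le (hF : IsConcaveHalfPlane F) {α : ℝ} (hα₁ : 1 < α)
    (hangle : openingAngleAtInfty (F '' rightHalfPlane) ≤ Real.pi * α) {ζ : ℂ}
    (hζ : 0 < ζ.re) :
    ζ.re * ‖preSchwarzian F ζ‖ ^ 2 ≤ (α - 1) * (preSchwarzian F ζ).re := by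
  set q := preSchwarzian F with hq
  have hqd : DifferentiableOn ℂ q rightHalfPlane := hF.differentiableOn_preSchwarzian
  have hqp : ∀ w ∈ rightHalfPlane, 0 ≤ (q w).re := fun w hw =>
    hF.re_deriv_deriv_div_nonneg hF.compl_nonempty hw
  -- This decay makes `Re q(N)` at most `(α - 1)/N`. Schwarz-Pick for `q` between `ζ` and `N`,
  -- divided by `N`, has the claim as its limit.
  have hbound : ∀ N : ℝ, 0 < N → ‖q N‖ ≤ (α - 1) / N := fun N hN => by
    rw [le_div_iff₀ hN]
    exact hF.norm_preSchwarzian_mul_re_le hα₁ hangle (ζ := N) (by simpa using hN)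
  have hqN : Tendsto (fun N : ℝ => q N) atTop (𝓝 0) := by
    refine squeeze_zero_norm' ((eventually_gt_atTop 0).mono hbound) ?_
    exact tendsto_const_nhds.div_atTop tendsto_id
  have h1 : Tendsto (fun N : ℝ => ‖q ζ - q N‖ ^ 2 * ζ.re) atTop (𝓝 (‖q ζ - 0‖ ^ 2 * ζ.re)) :=
    ((hqN.const_sub _).norm.pow 2).mul_const _
  have h2 : Tendsto (fun N : ℝ => ‖ζ * ((N⁻¹ : ℝ) : ℂ) - 1‖ ^ 2 * ((q ζ).re * (α - 1))) atTop
      (𝓝 (‖ζ * ((0 : ℝ) : ℂ) - 1‖ ^ 2 * ((q ζ).re * (α - 1)))) :=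
    (((((Complex.continuous_ofReal.tendsto 0).comp tendsto_inv_atTop_zero).const_mul
      ζ).sub_const 1).norm.pow 2).mul_const _
  have h3 := le_of_tendsto_of_tendsto h1 h2 ?_
  · simp only [sub_zero, Complex.ofReal_zero, mul_zero, zero_sub, norm_neg, norm_one, one_pow,
      one_mul] at h3
    linarith
  · filter_upwards [eventually_gt_atTop 0] with N hN
    have hN' : 0 < (N : ℂ).re := by simpa using hN
    have hsp := schwarzPick hqd hqp hζ hN'
    have hqN2 : (q N).re ≤ (α - 1) / N := (Complex.re_le_norm _).trans (hbound N hN)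
    have h4 : ‖q ζ - q N‖ ^ 2 * (ζ.re * N) ≤ ‖ζ - N‖ ^ 2 * ((q ζ).re * ((α - 1) / N)) := by
      refine hsp.trans ?_
      gcongr
      exact hqp ζ hζ
    have h5 : ‖ζ - N‖ = ‖ζ * ((N⁻¹ : ℝ) : ℂ) - 1‖ * N := by
      nth_rewrite 3 [← Real.norm_of_nonneg hN.le]
      rw [← Complex.norm_real, ← norm_mul]
      congr 1
      have : (N : ℂ) ≠ 0 := by exact_mod_cast hN.ne'
      push_cast
      field_simp
    rw [h5] at h4
    have h6 : (‖ζ * ((N⁻¹ : ℝ) : ℂ) - 1‖ * N) ^ 2 * ((q ζ).re * ((α - 1) / N)) =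
        ‖ζ * ((N⁻¹ : ℝ) : ℂ) - 1‖ ^ 2 * ((q ζ).re * (α - 1)) * N := by
      field_simp
    rw [h6, ← mul_assoc] at h4
    exact le_of_mul_le_mul_right h4 hN

end IsConcaveHalfPlane

/-- The half-plane form of the characterization of concave functions by a function with
nonnegative real part. -/
theorem re_caratheodory_nonneg {m : ℝ} (hm : 0 < m) {ζ q : ℂ} (hζ : 0 < ζ.re)
    (h : ζ.re * ‖q‖ ^ 2 ≤ m * q.re) : 0 ≤ (m * ζ - (ζ ^ 2 - 1) * q).re := by
  rcases eq_or_ne q 0 with rfl | hq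
  · simp
    positivity
  have hn : 0 < Complex.normSq q := Complex.normSq_pos.2 hq
  -- In terms of `s` the hypothesis is `Re s ≥ 0`, and the expression is `m (ζ s + 1)/(ζ + s)`.
  set s : ℂ := m / q - ζ with hs
  have hs0 : 0 ≤ s.re := by
    have h1 : s.re = m * q.re / Complex.normSq q - ζ.re := by
      rw [hs, Complex.sub_re, div_eq_mul_inv, Complex.re_ofReal_mul, Complex.inv_re]
      ring
    rw [h1, sub_nonneg, le_div_iff₀ hn, ← Complex.sq_norm]
    exact h
  have hζs : 0 < (ζ + s).re := by
    rw [Complex.add_re]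
    linarith
  have hζs0 : ζ + s ≠ 0 := fun h => by rw [h] at hζs; simp at hζs
  have hqe : q = m / (ζ + s) := by
    rw [hs]
    have : (m : ℂ) ≠ 0 := by exact_mod_cast hm.ne'
    rw [add_sub_cancel]
    field_simp
  have he : m * ζ - (ζ ^ 2 - 1) * q = m * ((ζ * s + 1) / (ζ + s)) := by
    rw [hqe]
    field_simp
    ring
  rw [he, Complex.re_ofReal_mul]
  refine mul_nonneg hm.le ?_
  rw [Complex.div_re, ← add_div]
  refine div_nonneg ?_ (Complex.normSq_nonneg _)
  simp only [Complex.mul_re, Complex.mul_im, Complex.add_re, Complex.add_im, Complex.one_re,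
    Complex.one_im, add_zero]
  have e : (ζ.re * s.re - ζ.im * s.im + 1) * (ζ.re + s.re) +
      (ζ.re * s.im + ζ.im * s.re) * (ζ.im + s.im) =
      (ζ.re ^ 2 + ζ.im ^ 2) * s.re + (s.re ^ 2 + s.im ^ 2) * ζ.re + ζ.re + s.re := by ring
  rw [e]
  positivity

/-! ### Transfer between the disk and the half plane -/

theorem hasDerivAt_comp_cayley {F f : ℂ → ℂ} (hF : DifferentiableOn ℂ F rightHalfPlane)
    (hf : ∀ z ∈ unitDisk, f z = F (cayley z)) {z : ℂ} (hz : z ∈ unitDisk) :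
    HasDerivAt f (deriv F (cayley z) * (2 / (1 - z) ^ 2)) z := by
  have h1 := ((hF.differentiableAt (isOpen_rightHalfPlane.mem_nhds
    (cayley_mem hz))).hasDerivAt).comp z (hasDerivAt_cayley hz)
  exact h1.congr_of_eventuallyEq ((isOpen_unitDisk.eventually_mem hz).mono hf)

theorem preSchwarzian_comp_cayley {F f : ℂ → ℂ} (hF : DifferentiableOn ℂ F rightHalfPlane)
    (hf : ∀ z ∈ unitDisk, f z = F (cayley z)) {z : ℂ} (hz : z ∈ unitDisk)
    (h0 : deriv F (cayley z) ≠ 0) :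
    preSchwarzian f z = preSchwarzian F (cayley z) * (2 / (1 - z) ^ 2) + 2 / (1 - z) := by
  have hz1 := one_sub_ne_zero_of_mem_unitDisk hz
  have h1 : deriv f z = deriv F (cayley z) * (2 / (1 - z) ^ 2) :=
    (hasDerivAt_comp_cayley hF hf hz).deriv
  have h2 := (((hF.deriv isOpen_rightHalfPlane).differentiableAt (isOpen_rightHalfPlane.mem_nhds
    (cayley_mem hz))).hasDerivAt).comp z (hasDerivAt_cayley hz)
  have h3 : HasDerivAt (fun w : ℂ => 2 / (1 - w) ^ 2) (4 / (1 - z) ^ 3) z := by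
    have := (hasDerivAt_const z (2 : ℂ)).div (((hasDerivAt_id z).const_sub 1).pow 2)
      (pow_ne_zero 2 hz1)
    refine this.congr_deriv ?_
    simp only [id, Pi.pow_apply]
    field_simp
    norm_num
    ring
  have h4 := (h2.mul h3).congr_of_eventuallyEq (f₁ := deriv f)
    ((isOpen_unitDisk.eventually_mem hz).mono fun w hw => (hasDerivAt_comp_cayley hF hf hw).deriv)
  rw [preSchwarzian, preSchwarzian, h4.deriv, h1]
  simp only [Function.comp]
  field_simp
  ring

theorem tendsto_cayleyInv_cobounded :
    Tendsto cayleyInv (Bornology.cobounded ℂ ⊓ 𝓟 rightHalfPlane) (𝓝[unitDisk] 1) := by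
  refine tendsto_nhdsWithin_iff.2 ⟨?_, ?_⟩
  · have h1 : Tendsto (fun ζ : ℂ => 1 + 2 / (-1 - ζ)) (Bornology.cobounded ℂ ⊓ 𝓟 rightHalfPlane)
        (𝓝 (1 + 0)) :=
      (tendsto_div_const_sub_cobounded (tendsto_id.mono_left inf_le_left) _ _).const_add 1
    rw [add_zero] at h1
    refine h1.congr' ?_
    filter_upwards [mem_inf_of_right (mem_principal_self _)] with ζ hζ
    have := add_one_ne_zero_of_re_pos hζ
    have h2 : -1 - ζ ≠ 0 := fun h => this (by linear_combination -h)
    rw [cayleyInv]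
    field_simp
    ring
  · filter_upwards [mem_inf_of_right (mem_principal_self _)] with ζ hζ
    exact cayleyInv_mem hζ

theorem image_comp_cayleyInv (f : ℂ → ℂ) :
    (fun ζ => f (cayleyInv ζ)) '' rightHalfPlane = f '' unitDisk := by
  ext w
  constructor
  · rintro ⟨ζ, hζ, rfl⟩
    exact ⟨_, cayleyInv_mem hζ, rfl⟩
  · rintro ⟨z, hz, rfl⟩
    exact ⟨_, cayley_mem hz, by simp only [cayleyInv_cayley hz]⟩

theorem IsConcaveUnivalent.isConcaveHalfPlane {α : ℝ} {f : ℂ → ℂ} (hf : IsConcaveUnivalent α f) :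
    IsConcaveHalfPlane fun ζ => f (cayleyInv ζ) where
  diff := hf.analytic.comp
    (fun ζ hζ => (hasDerivAt_cayleyInv hζ).differentiableAt.differentiableWithinAt)
    fun ζ hζ => cayleyInv_mem hζ
  inj := fun a ha b hb h => by
    rw [← cayley_cayleyInv ha, ← cayley_cayleyInv hb,
      hf.univalent (cayleyInv_mem ha) (cayleyInv_mem hb) h]
  convex := by
    rw [image_comp_cayleyInv]
    exact hf.convex_compl
  tendsto := hf.pole.comp tendsto_cayleyInv_cobounded

/-! ### The Schwarz-Pick lemma in the disk -/

theorem normSq_one_sub_sub_normSq_sub (v w : ℂ) :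
    ‖1 - conj v * w‖ ^ 2 - ‖w - v‖ ^ 2 = (1 - ‖v‖ ^ 2) * (1 - ‖w‖ ^ 2) := by
  simp only [Complex.sq_norm, Complex.normSq_apply, Complex.sub_re, Complex.sub_im,
    Complex.mul_re, Complex.mul_im, Complex.conj_re, Complex.conj_im, Complex.one_re,
    Complex.one_im]
  ring

theorem one_add_ne_zero_of_norm_lt_one {w : ℂ} (hw : ‖w‖ < 1) : 1 + w ≠ 0 := by
  intro h
  rw [← norm_neg, ← eq_neg_of_add_eq_zero_left h] at hw
  simp at hw

/-- Scaling `φ` by `r < 1` keeps the Möbius denominators nonzero; then `r → 1`. Without division the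
case `|φ 0| = 1` is included, and there it forces `φ z = φ 0`. -/
theorem schwarzPick_unitDisk {φ : ℂ → ℂ} (hφ : DifferentiableOn ℂ φ unitDisk)
    (h1 : ∀ z ∈ unitDisk, ‖φ z‖ ≤ 1) {z : ℂ} (hz : z ∈ unitDisk) :
    ‖φ z - φ 0‖ ≤ ‖z‖ * ‖1 - conj (φ 0) * φ z‖ := by
  have h0 : (0 : ℂ) ∈ unitDisk := by simp [unitDisk]
  have key : ∀ r : ℝ, r ∈ Set.Ioo (0 : ℝ) 1 →
      ‖r * φ z - r * φ 0‖ ≤ ‖z‖ * ‖1 - conj (r * φ 0) * (r * φ z)‖ := by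
    intro r hr
    have hlt : ∀ w ∈ unitDisk, ‖(r : ℂ) * φ w‖ < 1 := fun w hw => by
      rw [norm_mul, Complex.norm_real, Real.norm_of_nonneg hr.1.le]
      nlinarith [h1 w hw, hr.1, hr.2]
    have hne : ∀ w ∈ unitDisk, 1 - conj (r * φ 0) * (r * φ w) ≠ 0 := by
      intro w hw
      have : ‖-(conj (r * φ 0) * (r * φ w))‖ < 1 := by
        rw [norm_neg, norm_mul, RCLike.norm_conj]
        nlinarith [hlt 0 h0, hlt w hw, norm_nonneg ((r : ℂ) * φ 0), norm_nonneg ((r : ℂ) * φ w)]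
      simpa [sub_eq_add_neg] using one_add_ne_zero_of_norm_lt_one this
    have hd : DifferentiableOn ℂ
        (fun w => (r * φ w - r * φ 0) / (1 - conj (r * φ 0) * (r * φ w))) (Metric.ball 0 1) :=
      ((hφ.const_mul _).sub_const _).div (((hφ.const_mul _).const_mul _).const_sub _) hne
    have hm : Set.MapsTo (fun w => (r * φ w - r * φ 0) / (1 - conj (r * φ 0) * (r * φ w)))
        (Metric.ball 0 1) (Metric.closedBall 0 1) := by
      intro w hw
      rw [mem_closedBall_zero_iff, norm_div]
      refine div_le_one_of_le₀ ?_ (norm_nonneg _)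
      refine (abs_le_of_sq_le_sq' ?_ (norm_nonneg _)).2
      have h2 := normSq_one_sub_sub_normSq_sub (r * φ 0) (r * φ w)
      have h3 : 0 ≤ (1 - ‖r * φ 0‖ ^ 2) * (1 - ‖r * φ w‖ ^ 2) := by
        apply mul_nonneg
        · nlinarith [hlt 0 h0, norm_nonneg ((r : ℂ) * φ 0)]
        · nlinarith [hlt w hw, norm_nonneg ((r : ℂ) * φ w)]
      linarith
    have hs := Complex.norm_le_norm_of_mapsTo_ball hd hm (by simp) (mem_ball_zero_iff.1 hz)
    rwa [norm_div, div_le_iff₀ (norm_pos_iff.2 (hne z hz))] at hs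
  have hc1 : Continuous fun r : ℝ => ‖r * φ z - r * φ 0‖ := by fun_prop
  have hc2 : Continuous fun r : ℝ => ‖z‖ * ‖1 - conj (r * φ 0) * (r * φ z)‖ := by
    simp only [map_mul, Complex.conj_ofReal]
    fun_prop
  have := le_of_tendsto_of_tendsto ((hc1.tendsto 1).mono_left (nhdsWithin_le_nhds (s := Set.Iio 1)))
    ((hc2.tendsto 1).mono_left (nhdsWithin_le_nhds (s := Set.Iio 1))) ?_
  · simpa using this
  · filter_upwards [Ioo_mem_nhdsLT (zero_lt_one' ℝ)] with r hr
    exact key r hr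

/-! ### Representation of the pre-Schwarzian derivative -/

theorem IsConcaveUnivalent.exists_schur {α : ℝ} (hα₁ : 1 < α) {f : ℂ → ℂ}
    (hf : IsConcaveUnivalent α f) :
    ∃ φ : ℂ → ℂ, DifferentiableOn ℂ φ unitDisk ∧ (∀ z ∈ unitDisk, ‖φ z‖ ≤ 1) ∧
      ∀ z ∈ unitDisk, 1 + z * φ z ≠ 0 ∧
        preSchwarzian f z = (α + 1) / (1 - z) + (α - 1) * (φ z / (1 + z * φ z)) := by
  have hF := hf.isConcaveHalfPlane
  set F : ℂ → ℂ := fun ζ => f (cayleyInv ζ) with hFdef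
  have hm : 0 < α - 1 := by linarith
  have hmC : (α - 1 : ℂ) ≠ 0 := by exact_mod_cast hm.ne'
  have hfF : ∀ z ∈ unitDisk, f z = F (cayley z) := fun z hz => by
    simp only [hFdef, cayleyInv_cayley hz]
  have hT : ∀ z ∈ unitDisk, preSchwarzian f z =
      preSchwarzian F (cayley z) * (2 / (1 - z) ^ 2) + 2 / (1 - z) := fun z hz =>
    preSchwarzian_comp_cayley hF.diff hfF hz (hF.deriv_ne_zero (cayley_mem hz))
  have hTd : DifferentiableOn ℂ (preSchwarzian f) unitDisk := by
    refine DifferentiableOn.congr (f := fun z => preSchwarzian F (cayley z) * (2 / (1 - z) ^ 2) +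
      2 / (1 - z)) ?_ hT
    refine DifferentiableOn.add (DifferentiableOn.mul ?_ ?_) ?_
    · exact hF.differentiableOn_preSchwarzian.comp
        (fun z hz => (hasDerivAt_cayley hz).differentiableAt.differentiableWithinAt)
        fun z hz => cayley_mem hz
    · exact DifferentiableOn.div (by fun_prop) (by fun_prop)
        fun z hz => pow_ne_zero 2 (one_sub_ne_zero_of_mem_unitDisk hz)
    · exact DifferentiableOn.div (by fun_prop) (by fun_prop)
        fun z hz => one_sub_ne_zero_of_mem_unitDisk hz
  -- The half-plane expression `mζ - (ζ² - 1) q` at `ζ = cayley z`, rewritten through `T_f`. Since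
  -- `P 0 = α - 1`, the bounded function `(m - P)/(m + P)` vanishes at `0`.
  set P : ℂ → ℂ := fun z => (α - 1) * ((1 + z) / (1 - z)) - 2 * z * preSchwarzian f z +
    4 * z / (1 - z) with hP
  have hPre : ∀ z ∈ unitDisk, 0 ≤ (P z).re := by
    intro z hz
    have hz1 := one_sub_ne_zero_of_mem_unitDisk hz
    have hangle : openingAngleAtInfty (F '' rightHalfPlane) ≤ Real.pi * α := by
      rw [image_comp_cayleyInv]
      exact hf.opening_angle
    have h := re_caratheodory_nonneg hm (cayley_mem hz)
      (hF.re_mul_normSq_preSchwarzian_le hα₁ hangle (cayley_mem hz))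
    convert h using 2
    rw [hP]
    simp only [hT z hz, cayley]
    push_cast
    field_simp
    ring
  have hPd : DifferentiableOn ℂ P unitDisk := by
    refine ((DifferentiableOn.const_mul (DifferentiableOn.div (by fun_prop) (by fun_prop) ?_) _).sub
      (DifferentiableOn.mul (by fun_prop) hTd)).add
      (DifferentiableOn.div (by fun_prop) (by fun_prop) ?_)
    · exact fun z hz => one_sub_ne_zero_of_mem_unitDisk hz
    · exact fun z hz => one_sub_ne_zero_of_mem_unitDisk hz
  have hden : ∀ z ∈ unitDisk, (α - 1 : ℂ) + P z ≠ 0 := by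
    intro z hz h
    have h1 := congrArg Complex.re h
    simp at h1
    linarith [hPre z hz]
  -- Chosen so that `z φ z = (m - P)/(m + P)` with no division by `z`; the Schwarz lemma for `zφ`
  -- then bounds `φ`, also at `0`.
  set φ : ℂ → ℂ := fun z => 2 * (preSchwarzian f z - (α + 1) / (1 - z)) / ((α - 1) + P z) with hφ
  have hφd : DifferentiableOn ℂ φ unitDisk := by
    refine DifferentiableOn.div (DifferentiableOn.const_mul (hTd.sub ?_) _) (hPd.const_add _) hden
    exact DifferentiableOn.div (by fun_prop) (by fun_prop)
      fun z hz => one_sub_ne_zero_of_mem_unitDisk hz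
  have hzφ : ∀ z ∈ unitDisk, z * φ z = ((α - 1) - P z) / ((α - 1) + P z) := by
    intro z hz
    have hz1 := one_sub_ne_zero_of_mem_unitDisk hz
    have h2 := hden z hz
    rw [eq_div_iff h2, hφ]
    simp only
    rw [mul_assoc, div_mul_cancel₀ _ h2, hP]
    field_simp
    ring
  have hφ1 : ∀ z ∈ unitDisk, ‖φ z‖ ≤ 1 := by
    intro z hz
    have hm : Set.MapsTo (fun w => w * φ w) (Metric.ball 0 1)
        (Metric.closedBall ((fun w => w * φ w) 0) 1) := by
      intro w hw
      simp only [zero_mul]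
      rw [mem_closedBall_zero_iff, hzφ w hw, norm_div]
      refine div_le_one_of_le₀ ?_ (norm_nonneg _)
      refine (abs_le_of_sq_le_sq' ?_ (norm_nonneg _)).2
      have := mul_nonneg hm.le (hPre w hw)
      have e : (α - 1 : ℂ) = ((α - 1 : ℝ) : ℂ) := by push_cast; ring
      simp only [e, Complex.sq_norm, Complex.normSq_apply, Complex.sub_re, Complex.sub_im,
        Complex.add_re, Complex.add_im, Complex.ofReal_re, Complex.ofReal_im]
      nlinarith
    have hd : DifferentiableOn ℂ (fun w => w * φ w) (Metric.ball 0 1) := differentiableOn_id.mul hφd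
    have h := Complex.norm_dslope_le_div_of_mapsTo_ball hd hm hz
    rw [div_one] at h
    rcases eq_or_ne z 0 with rfl | h0
    · have hφ0 := (hφd.differentiableAt (isOpen_unitDisk.mem_nhds hz)).hasDerivAt
      have h2 := ((hasDerivAt_id (0 : ℂ)).mul hφ0).deriv
      have h3 : dslope (fun w => w * φ w) 0 0 = φ 0 := by
        rw [dslope_same]
        refine Eq.trans h2 ?_
        simp
      rwa [h3] at h
    · rw [dslope_of_ne _ h0, slope_def_field] at h
      simpa [h0] using h
  refine ⟨φ, hφd, hφ1, fun z hz => ?_⟩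
  have hz1 := one_sub_ne_zero_of_mem_unitDisk hz
  have h2 := hden z hz
  have h1 : 1 + z * φ z = 2 * (α - 1) / ((α - 1) + P z) := by
    rw [hzφ z hz]
    field_simp
    ring
  have h1ne : 1 + z * φ z ≠ 0 := by
    rw [h1]
    exact div_ne_zero (mul_ne_zero two_ne_zero hmC) h2
  refine ⟨h1ne, ?_⟩
  rw [h1, hφ]
  field_simp
  ring

/-! ### The geometry of the disk of variability -/

/-- Used with `C = 1 + az`, `A = a + conj z`, `p = 1 - conj a φ`, `s = φ - a`, `R = ‖z‖²`. The first
norm becomes that of `(1 - ‖a‖²)(1 + zφ)` and the second that of `deviation`, so Schwarz-Pick (`‖s‖²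
≤ R ‖p‖²`) bounds the deviation. -/
theorem mul_normSq_add_sub_normSq_add (A C p s : ℂ) (R : ℝ) :
    R * ‖C * p + conj A * s‖ ^ 2 - ‖conj C * s + R * (A * p)‖ ^ 2 =
      (‖C‖ ^ 2 - R * ‖A‖ ^ 2) * (R * ‖p‖ ^ 2 - ‖s‖ ^ 2) := by
  simp only [Complex.sq_norm, Complex.normSq_apply, Complex.add_re, Complex.add_im,
    Complex.mul_re, Complex.mul_im, Complex.conj_re, Complex.conj_im, Complex.ofReal_re,
    Complex.ofReal_im]
  ring

theorem normSq_sub_mul_normSq (a z : ℂ) :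
    ‖1 + a * z‖ ^ 2 - ‖z‖ ^ 2 * ‖a + conj z‖ ^ 2 =
      (1 - ‖z‖ ^ 2) * (1 + ‖z‖ ^ 2 + 2 * (a * z).re) := by
  simp only [Complex.sq_norm, Complex.normSq_apply, Complex.add_re, Complex.add_im,
    Complex.mul_re, Complex.mul_im, Complex.conj_re, Complex.conj_im, Complex.one_re,
    Complex.one_im]
  ring

theorem variability_denom_pos {a z : ℂ} (ha : ‖a‖ ≤ 1) (hz : ‖z‖ < 1) :
    0 < 1 + ‖z‖ ^ 2 + 2 * (a * z).re := by
  have h1 := (abs_le.1 (Complex.abs_re_le_norm (a * z))).1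
  rw [norm_mul] at h1
  nlinarith [norm_nonneg z, norm_nonneg a]

/-- The numerator of the deviation from the center of the disk of variability. -/
def deviation (a z φ : ℂ) : ℂ :=
  conj (1 + a * z) * (φ - a) + (‖z‖ ^ 2 : ℝ) * ((a + conj z) * (1 - conj a * φ))

theorem sub_variabilityCenter {α : ℝ} {a z φ : ℂ} (ha : ‖a‖ ≤ 1) (hz : ‖z‖ < 1)
    (hφ : 1 + z * φ ≠ 0) :
    (1 - (‖z‖ : ℂ) ^ 2) * ((α + 1) / (1 - z) + (α - 1) * (φ / (1 + z * φ))) -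
      variabilityCenter α a z =
    (α - 1) * (deviation a z φ / (((1 + ‖z‖ ^ 2 + 2 * (a * z).re : ℝ) : ℂ) * (1 + z * φ))) := by
  have hz1 := one_sub_ne_zero_of_mem_unitDisk (mem_ball_zero_iff.2 hz)
  have hD : ((1 + ‖z‖ ^ 2 + 2 * (a * z).re : ℝ) : ℂ) ≠ 0 := by
    exact_mod_cast (variability_denom_pos ha hz).ne'
  have e1 : (‖z‖ : ℂ) ^ 2 = z * conj z := (Complex.mul_conj' z).symm
  have e2 : (‖a‖ : ℂ) ^ 2 = a * conj a := (Complex.mul_conj' a).symm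
  have e3 : (2 : ℂ) * ((a * z).re : ℂ) = a * z + conj a * conj z := by
    rw [← map_mul, Complex.add_conj]
    push_cast
    ring
  rw [variabilityCenter, deviation]
  push_cast at hD ⊢
  rw [e1, e2]
  rw [e1] at hD
  rw [e3] at hD ⊢
  simp only [map_add, map_mul, map_one]
  clear e1 e2 e3
  generalize conj z = z' at *
  generalize conj a = a' at *
  generalize hDe : 1 + z * z' + (a * z + a' * z') = D at *
  field_simp
  rw [← hDe]
  ring

theorem one_sub_normSq_mul_one_add (a z φ : ℂ) :
    ((1 - ‖a‖ ^ 2 : ℝ) : ℂ) * (1 + z * φ) =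
      (1 + a * z) * (1 - conj a * φ) + conj (a + conj z) * (φ - a) := by
  have e2 : (‖a‖ : ℂ) ^ 2 = a * conj a := (Complex.mul_conj' a).symm
  push_cast
  rw [e2]
  simp only [map_add, Complex.conj_conj]
  ring

theorem norm_deviation_le {a z φ : ℂ} (ha : ‖a‖ ≤ 1) (hz : ‖z‖ < 1)
    (h : ‖φ - a‖ ≤ ‖z‖ * ‖1 - conj a * φ‖) :
    ‖deviation a z φ‖ ≤ (1 - ‖a‖ ^ 2) * ‖z‖ * ‖1 + z * φ‖ := by
  have ha2 : 0 ≤ 1 - ‖a‖ ^ 2 := by nlinarith [norm_nonneg a]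
  have h1 := mul_normSq_add_sub_normSq_add (a + conj z) (1 + a * z) (1 - conj a * φ) (φ - a)
    (‖z‖ ^ 2)
  rw [← one_sub_normSq_mul_one_add, normSq_sub_mul_normSq, norm_mul, Complex.norm_real,
    Real.norm_of_nonneg ha2] at h1
  refine (abs_le_of_sq_le_sq' ?_ (by positivity)).2
  have h2 : ‖φ - a‖ ^ 2 ≤ ‖z‖ ^ 2 * ‖1 - conj a * φ‖ ^ 2 := by
    rw [← mul_pow]
    exact pow_le_pow_left₀ (norm_nonneg _) h 2
  have h3 : 0 ≤ (1 - ‖z‖ ^ 2) * (1 + ‖z‖ ^ 2 + 2 * (a * z).re) :=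
    mul_nonneg (by nlinarith [norm_nonneg z]) (variability_denom_pos ha hz).le
  have h4 := mul_nonneg h3 (sub_nonneg.2 h2)
  rw [deviation]
  nlinarith

theorem IsConcaveUnivalent.mem_closedBall {α : ℝ} (hα₁ : 1 < α) {a : ℂ} (ha : ‖a‖ ≤ 1) {z : ℂ}
    (hz : z ∈ unitDisk) {f : ℂ → ℂ} (hf : IsConcaveUnivalent α f)
    (hfa : deriv (deriv f) 0 = (α : ℂ) + 1 + ((α : ℂ) - 1) * a) :
    (1 - (‖z‖ : ℂ) ^ 2) * preSchwarzian f z ∈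
      Metric.closedBall (variabilityCenter α a z) (variabilityRadius α a z) := by
  have hm : 0 < α - 1 := by linarith
  have hmC : (α - 1 : ℂ) ≠ 0 := by exact_mod_cast hm.ne'
  have hz1 : ‖z‖ < 1 := mem_ball_zero_iff.1 hz
  obtain ⟨φ, hφd, hφ1, hφ⟩ := hf.exists_schur hα₁
  have h0 := (hφ 0 (by simp [unitDisk])).2
  have hφ0 : φ 0 = a := by
    rw [preSchwarzian, hf.deriv_zero, hfa] at h0
    simp at h0
    exact (h0.resolve_right hmC).symm
  have hsp := schwarzPick_unitDisk hφd hφ1 hz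
  rw [hφ0] at hsp
  obtain ⟨hne, hT⟩ := hφ z hz
  have hD := variability_denom_pos ha hz1
  rw [mem_closedBall_iff_norm, hT, sub_variabilityCenter ha hz1 hne, variabilityRadius]
  have e : (α - 1 : ℂ) = ((α - 1 : ℝ) : ℂ) := by push_cast; ring
  rw [e, norm_mul, norm_div, norm_mul, Complex.norm_real, Complex.norm_real,
    Real.norm_of_nonneg hm.le, Real.norm_of_nonneg hD.le, mul_div_assoc]
  refine mul_le_mul_of_nonneg_left ?_ hm.le
  have hn := norm_pos_iff.2 hne
  rw [div_le_div_iff₀ (by positivity) hD]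
  have := mul_le_mul_of_nonneg_right (norm_deviation_le ha hz1 hsp) hD.le
  linarith

/-! ### Conformal maps with derivative of increasing argument -/

/-- Noshiro-Warschawski: `Re (c F/(b - a))` strictly increases along the segment from `a` to `b`. -/
theorem injOn_of_re_deriv_pos {F F' : ℂ → ℂ} {U : Set ℂ} (hU : Convex ℝ U) {c : ℂ}
    (hF : ∀ ζ ∈ U, HasDerivAt F (F' ζ) ζ) (hpos : ∀ ζ ∈ U, 0 < (c * F' ζ).re) :
    Set.InjOn F U := by
  intro a ha b hb hab
  by_contra hne
  have hba : b - a ≠ 0 := sub_ne_zero.2 (Ne.symm hne)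
  have hmem : ∀ t ∈ Set.Icc (0 : ℝ) 1, a + t * (b - a) ∈ U := fun t ht => by
    have := hU.add_smul_sub_mem ha hb ht
    simpa [Complex.real_smul] using this
  have hd : ∀ t ∈ Set.Icc (0 : ℝ) 1,
      HasDerivAt (fun t : ℝ => (c * (F (a + t * (b - a)) / (b - a))).re)
        (c * F' (a + t * (b - a))).re t := by
    intro t ht
    have h1 : HasDerivAt (fun t : ℝ => a + (t : ℂ) * (b - a)) (b - a) t := by
      simpa using ((Complex.ofRealCLM.hasDerivAt (x := t)).mul_const (b - a)).const_add a
    have h2 := (hF _ (hmem t ht)).scomp t h1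
    have h3 := Complex.reCLM.hasFDerivAt.comp_hasDerivAt t ((h2.div_const (b - a)).const_mul c)
    refine h3.congr_deriv ?_
    rw [smul_eq_mul, mul_div_cancel_left₀ _ hba, Complex.reCLM_apply]
  have hmono : StrictMonoOn (fun t : ℝ => (c * (F (a + t * (b - a)) / (b - a))).re)
      (Set.Icc 0 1) := by
    refine strictMonoOn_of_deriv_pos (convex_Icc _ _)
      (fun t ht => (hd t ht).continuousAt.continuousWithinAt) fun t ht => ?_
    rw [(hd t (interior_subset ht)).deriv]
    exact hpos _ (hmem t (interior_subset ht))
  have := hmono (Set.left_mem_Icc.2 zero_le_one) (Set.right_mem_Icc.2 zero_le_one) zero_lt_one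
  simp [hab] at this

/-- A primitive of `exp L` in the half plane, fixing infinity, where the imaginary part of `L`
increases along vertical lines and varies in an interval of length `π m`. -/
structure IsMonotoneArg (m β : ℝ) (F L q : ℂ → ℂ) : Prop where
  le_one : m ≤ 1
  hasDerivAt : ∀ ζ ∈ rightHalfPlane, HasDerivAt F (Complex.exp (L ζ)) ζ
  hasDerivAt_log : ∀ ζ ∈ rightHalfPlane, HasDerivAt L (q ζ) ζ
  re_nonneg : ∀ ζ ∈ rightHalfPlane, 0 ≤ (q ζ).re
  abs_im_lt : ∀ ζ ∈ rightHalfPlane, |(L ζ).im - β| < Real.pi * m / 2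
  tendsto : Tendsto F (Bornology.cobounded ℂ ⊓ 𝓟 rightHalfPlane) (Bornology.cobounded ℂ)

theorem re_exp_mul_conj_exp (u v : ℂ) :
    (Complex.exp u * conj (Complex.exp v)).re = Real.exp (u.re + v.re) * Real.cos (u.im - v.im) := by
  rw [← Complex.exp_conj, ← Complex.exp_add, Complex.exp_re]
  simp [sub_eq_add_neg]

theorem im_exp_mul_conj_exp (u v : ℂ) :
    (Complex.exp u * conj (Complex.exp v)).im = Real.exp (u.re + v.re) * Real.sin (u.im - v.im) := by
  rw [← Complex.exp_conj, ← Complex.exp_add, Complex.exp_im]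
  simp [sub_eq_add_neg]

namespace IsMonotoneArg

variable {m β : ℝ} {F L q : ℂ → ℂ}

theorem injOn (h : IsMonotoneArg m β F L q) : Set.InjOn F rightHalfPlane := by
  refine injOn_of_re_deriv_pos convex_rightHalfPlane (c := Complex.exp (-(β * Complex.I)))
    h.hasDerivAt fun ζ hζ => ?_
  rw [← Complex.exp_add, Complex.exp_re]
  refine mul_pos (Real.exp_pos _) (Real.cos_pos_of_mem_Ioo ?_)
  have h1 := abs_lt.1 (h.abs_im_lt ζ hζ)
  have h2 : Real.pi * m ≤ Real.pi := mul_le_of_le_one_right Real.pi_pos.le h.le_one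
  have e : (-(β * Complex.I) + L ζ).im = (L ζ).im - β := by
    simp
    ring
  rw [e]
  exact ⟨by linarith [h1.1], by linarith [h1.2]⟩

theorem differentiableOn (h : IsMonotoneArg m β F L q) : DifferentiableOn ℂ F rightHalfPlane :=
  fun ζ hζ => (h.hasDerivAt ζ hζ).differentiableAt.differentiableWithinAt

theorem hasDerivAt_vertical (h : IsMonotoneArg m β F L q) {x : ℝ} (hx : 0 < x) (t : ℝ) :
    HasDerivAt (fun t : ℝ => F (x + t * Complex.I))
      (Complex.I * Complex.exp (L (x + t * Complex.I))) t := by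
  have h1 : HasDerivAt (fun t : ℝ => (x : ℂ) + t * Complex.I) Complex.I t := by
    simpa using ((Complex.ofRealCLM.hasDerivAt (x := t)).mul_const Complex.I).const_add (x : ℂ)
  exact (h.hasDerivAt _ (by simpa [mem_rightHalfPlane] using hx)).scomp t h1

theorem hasDerivAt_horizontal (h : IsMonotoneArg m β F L q) {x : ℝ} (hx : 0 < x) (y : ℝ) :
    HasDerivAt (fun t : ℝ => F (t + y * Complex.I))
      (Complex.exp (L (x + y * Complex.I))) x := by
  have h1 : HasDerivAt (fun t : ℝ => (t : ℂ) + y * Complex.I) 1 x := by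
    simpa using (Complex.ofRealCLM.hasDerivAt (x := x)).add_const (y * Complex.I)
  have h2 := (h.hasDerivAt ((x : ℂ) + y * Complex.I)
    (by simpa [mem_rightHalfPlane] using hx)).scomp x h1
  rw [one_smul] at h2
  exact h2

theorem monotone_im (h : IsMonotoneArg m β F L q) {x : ℝ} (hx : 0 < x) :
    Monotone fun t : ℝ => (L (x + t * Complex.I)).im := by
  have hd : ∀ t : ℝ, HasDerivAt (fun t : ℝ => (L (x + t * Complex.I)).im)
      (q (x + t * Complex.I)).re t := by
    intro t
    have h1 : HasDerivAt (fun t : ℝ => (x : ℂ) + t * Complex.I) Complex.I t := by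
      simpa using ((Complex.ofRealCLM.hasDerivAt (x := t)).mul_const Complex.I).const_add (x : ℂ)
    have h2 := (h.hasDerivAt_log _
      (by simpa [mem_rightHalfPlane] using hx : (x : ℂ) + t * Complex.I ∈ rightHalfPlane)).scomp t h1
    refine (Complex.imCLM.hasFDerivAt.comp_hasDerivAt t h2).congr_deriv ?_
    simp
  refine monotone_of_deriv_nonneg (fun t => (hd t).differentiableAt) fun t => ?_
  rw [(hd t).deriv]
  exact h.re_nonneg _ (by simpa [mem_rightHalfPlane] using hx)

theorem abs_im_sub_im_lt (h : IsMonotoneArg m β F L q) {ζ η : ℂ} (hζ : ζ ∈ rightHalfPlane)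
    (hη : η ∈ rightHalfPlane) : |(L ζ).im - (L η).im| < Real.pi := by
  have h1 := abs_lt.1 (h.abs_im_lt ζ hζ)
  have h3 := abs_lt.1 (h.abs_im_lt η hη)
  have h2 : Real.pi * m ≤ Real.pi := mul_le_of_le_one_right Real.pi_pos.le h.le_one
  rw [abs_lt]
  exact ⟨by linarith [h1.1, h3.2], by linarith [h1.2, h3.1]⟩

/-- Vertical lines are mapped to curves which lie on one side of each tangent. -/
theorem re_vertical_nonpos (h : IsMonotoneArg m β F L q) {x : ℝ} (hx : 0 < x) (y t : ℝ) :
    ((F (x + t * Complex.I) - F (x + y * Complex.I)) *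
      conj (Complex.exp (L (x + y * Complex.I)))).re ≤ 0 := by
  have hmem : ∀ t : ℝ, (x : ℂ) + t * Complex.I ∈ rightHalfPlane := fun t => by
    simpa [mem_rightHalfPlane] using hx
  set n := Complex.exp (L (x + y * Complex.I)) with hn
  set g : ℝ → ℝ := fun t => ((F (x + t * Complex.I) - F (x + y * Complex.I)) * conj n).re with hg
  have hd : ∀ t : ℝ, HasDerivAt g (-(Complex.exp (L (x + t * Complex.I)) * conj n).im) t := by
    intro t
    have h1 := ((h.hasDerivAt_vertical hx t).sub_const (F (x + y * Complex.I))).mul_const (conj n)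
    refine (Complex.reCLM.hasFDerivAt.comp_hasDerivAt t h1).congr_deriv ?_
    rw [Complex.reCLM_apply, mul_assoc, Complex.I_mul_re]
  have hgy : g y = 0 := by simp [hg]
  have hsign : ∀ t : ℝ, -(Complex.exp (L (x + t * Complex.I)) * conj n).im =
      -(Real.exp ((L (x + t * Complex.I)).re + (L (x + y * Complex.I)).re) *
        Real.sin ((L (x + t * Complex.I)).im - (L (x + y * Complex.I)).im)) := fun t => by
    rw [hn, im_exp_mul_conj_exp]
  change g t ≤ 0
  rw [← hgy]
  rcases le_total y t with hyt | hty
  · have hanti : AntitoneOn g (Set.Ici y) := by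
      refine antitoneOn_of_deriv_nonpos (convex_Ici _)
        (fun s _ => (hd s).continuousAt.continuousWithinAt)
        (fun s _ => (hd s).differentiableAt.differentiableWithinAt) fun s hs => ?_
      have hs' : y ≤ s := interior_subset hs
      rw [(hd s).deriv, hsign, neg_nonpos]
      refine mul_nonneg (Real.exp_pos _).le (Real.sin_nonneg_of_nonneg_of_le_pi ?_ ?_)
      · exact sub_nonneg.2 (h.monotone_im hx hs')
      · exact (abs_lt.1 (h.abs_im_sub_im_lt (hmem s) (hmem y))).2.le
    exact hanti Set.self_mem_Ici hyt hyt
  · have hmono : MonotoneOn g (Set.Iic y) := by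
      refine monotoneOn_of_deriv_nonneg (convex_Iic _)
        (fun s _ => (hd s).continuousAt.continuousWithinAt)
        (fun s _ => (hd s).differentiableAt.differentiableWithinAt) fun s hs => ?_
      have hs' : s ≤ y := Set.mem_Iic.1 (interior_subset hs)
      rw [(hd s).deriv, hsign, neg_nonneg]
      refine mul_nonpos_of_nonneg_of_nonpos (Real.exp_pos _).le
        (Real.sin_nonpos_of_nonpos_of_neg_pi_le ?_ ?_)
      · exact sub_nonpos.2 (h.monotone_im hx hs')
      · exact (abs_lt.1 (h.abs_im_sub_im_lt (hmem s) (hmem y))).1.le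
    exact hmono hty Set.self_mem_Iic hty

theorem isOpen_image_level (h : IsMonotoneArg m β F L q) {x : ℝ} (hx : 0 < x) :
    IsOpen (F '' {ζ | x < ζ.re}) := by
  have hsub : {ζ : ℂ | x < ζ.re} ⊆ rightHalfPlane := fun ζ hζ => hx.trans hζ
  exact isOpen_image_of_injOn (isOpen_lt continuous_const Complex.continuous_re)
    (h.differentiableOn.mono hsub) (h.injOn.mono hsub)

/-- As `F → ∞` at infinity, a sequence with convergent images is bounded; a limit of its points has
real part at least `x`, and more than `x` is excluded. -/
theorem closure_image_level_subset (h : IsMonotoneArg m β F L q) {x : ℝ} (hx : 0 < x) {w : ℂ}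
    (hw : w ∈ closure (F '' {ζ | x < ζ.re})) (hw2 : w ∉ F '' {ζ | x < ζ.re}) :
    ∃ y : ℝ, w = F (x + y * Complex.I) := by
  obtain ⟨u, hu, hlim⟩ := mem_closure_iff_seq_limit.1 hw
  choose ζ hζ hζu using hu
  have hFlim : Tendsto (fun n => F (ζ n)) atTop (𝓝 w) := by simpa [hζu] using hlim
  have hbdd : Bornology.IsBounded (Set.range ζ) := by
    have h0 : ∀ᶠ v in Bornology.cobounded ℂ, v ∈ (Metric.closedBall (0 : ℂ) (‖w‖ + 1))ᶜ :=
      Bornology.isBounded_def.1 Metric.isBounded_closedBall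
    have h1 := h.tendsto.eventually h0
    rw [eventually_inf_principal] at h1
    have hB : Bornology.IsBounded {z | ¬ (z ∈ rightHalfPlane →
        F z ∈ (Metric.closedBall (0 : ℂ) (‖w‖ + 1))ᶜ)} := by
      rw [← Bornology.isCobounded_compl_iff]
      filter_upwards [h1] with z hz
      exact not_not.2 hz
    have h2 := hFlim.norm.eventually (gt_mem_nhds (lt_add_one ‖w‖))
    obtain ⟨N, hN⟩ := eventually_atTop.1 h2
    have hcover : Set.range ζ ⊆ (ζ '' Set.Iio N) ∪ {z | ¬ (z ∈ rightHalfPlane →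
        F z ∈ (Metric.closedBall (0 : ℂ) (‖w‖ + 1))ᶜ)} := by
      rintro _ ⟨n, rfl⟩
      rcases lt_or_ge n N with hn | hn
      · exact Or.inl ⟨n, hn, rfl⟩
      · right
        intro h3
        have h4 := h3 (hx.trans (hζ n))
        have h5 := hN n hn
        rw [Set.mem_compl_iff, mem_closedBall_zero_iff] at h4
        exact h4 h5.le
    exact (((Set.finite_Iio N).image ζ).isBounded.union hB).subset hcover
  obtain ⟨ζ₀, -, φ, hφ, hζlim⟩ := tendsto_subseq_of_bounded hbdd fun n => Set.mem_range_self n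
  have hre : x ≤ ζ₀.re := ge_of_tendsto' ((Complex.continuous_re.tendsto _).comp hζlim)
    fun n => le_of_lt (hζ (φ n))
  have hcont := (h.hasDerivAt ζ₀ (hx.trans_le hre)).continuousAt.tendsto.comp hζlim
  have heq : F ζ₀ = w := tendsto_nhds_unique hcont (hFlim.comp hφ.tendsto_atTop)
  rcases hre.eq_or_lt with h1 | h1
  · refine ⟨ζ₀.im, ?_⟩
    rw [h1, Complex.re_add_im, heq]
  · exact absurd ⟨ζ₀, h1, heq⟩ hw2

/-- The open half plane beyond the tangent at `F (x + iy)` is connected and meets the image. It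
misses the image's boundary, since the curve `F (x + it)` stays on the other side
(`re_vertical_nonpos`). -/
theorem halfPlane_subset_image_level (h : IsMonotoneArg m β F L q) {x : ℝ} (hx : 0 < x) (y : ℝ) :
    {w : ℂ | 0 < ((w - F (x + y * Complex.I)) * conj (Complex.exp (L (x + y * Complex.I)))).re} ⊆
      F '' {ζ | x < ζ.re} := by
  set n := Complex.exp (L (x + y * Complex.I)) with hn
  set γ := F (x + y * Complex.I) with hγ
  have hlin : IsLinearMap ℝ fun w : ℂ => (w * conj n).re :=
    ⟨fun u v => by simp [add_mul], fun c u => by simp; ring⟩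
  have hconv : Convex ℝ {w : ℂ | 0 < ((w - γ) * conj n).re} := by
    have h1 := convex_halfSpace_gt hlin (γ * conj n).re
    have e : {w : ℂ | 0 < ((w - γ) * conj n).re} =
        {w : ℂ | (γ * conj n).re < (w * conj n).re} := by
      ext w
      change 0 < ((w - γ) * conj n).re ↔ (γ * conj n).re < (w * conj n).re
      rw [sub_mul, Complex.sub_re, sub_pos]
    rw [e]
    exact h1
  refine hconv.isPreconnected.subset_of_closure_inter_subset (h.isOpen_image_level hx) ?_ ?_
  · have hd : HasDerivAt (fun t : ℝ => ((F (t + y * Complex.I) - γ) * conj n).re)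
        (n * conj n).re x :=
      Complex.reCLM.hasFDerivAt.comp_hasDerivAt x
        (((h.hasDerivAt_horizontal hx y).sub_const γ).mul_const (conj n))
    have hpos : 0 < (n * conj n).re := by
      rw [Complex.mul_conj, Complex.ofReal_re]
      exact Complex.normSq_pos.2 (Complex.exp_ne_zero _)
    have hs := (hasDerivWithinAt_iff_tendsto_slope' (by simp)).1
      (hd.hasDerivWithinAt (s := Set.Ioi x))
    obtain ⟨t, ht, htx⟩ := ((hs.eventually (lt_mem_nhds hpos)).and self_mem_nhdsWithin).exists
    refine ⟨F (t + y * Complex.I), ?_, ⟨t + y * Complex.I, by simpa using htx, rfl⟩⟩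
    rw [slope_def_field] at ht
    have h2 : ((F (x + y * Complex.I) - γ) * conj n).re = 0 := by simp [hγ]
    rw [h2, sub_zero] at ht
    exact (div_pos_iff_of_pos_right (sub_pos.2 htx)).1 ht
  · rintro w ⟨hw, hw2⟩
    by_contra hcon
    obtain ⟨t, rfl⟩ := h.closure_image_level_subset hx hw hcon
    exact absurd hw2 (not_lt.2 (h.re_vertical_nonpos hx y t))

/-- A complement point nearest to `w` lies on the curve `F (x + iy)`. Minimality along the curve
makes `w - k` normal to it; minimality among points to the left, also in the complement, fixes the
sign. -/
theorem exists_mem_halfPlane (h : IsMonotoneArg m β F L q) {x : ℝ} (hx : 0 < x) {w : ℂ}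
    (hw : w ∈ F '' {ζ | x < ζ.re}) :
    ∃ y : ℝ, 0 < ((w - F (x + y * Complex.I)) *
      conj (Complex.exp (L (x + y * Complex.I)))).re := by
  set Ω := F '' {ζ : ℂ | x < ζ.re} with hΩ
  have hnot : ∀ ζ : ℂ, 0 < ζ.re → ζ.re ≤ x → F ζ ∈ Ωᶜ := by
    rintro ζ h0 h1 ⟨η, hη, he⟩
    have hη' : x < η.re := hη
    have := h.injOn (hx.trans hη') h0 he
    rw [this] at hη'
    linarith
  obtain ⟨k, hk, hdist⟩ := (h.isOpen_image_level hx).isClosed_compl.exists_infDist_eq_dist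
    ⟨_, hnot x (by simpa using hx) (by simp)⟩ w
  have hmin : ∀ k' ∈ Ωᶜ, ‖w - k‖ ≤ ‖w - k'‖ := fun k' hk' => by
    rw [← dist_eq_norm, ← hdist, ← dist_eq_norm]
    exact Metric.infDist_le_dist_of_mem hk'
  have hwk : w - k ≠ 0 := sub_ne_zero.2 fun e => hk (e ▸ hw)
  have hkc : k ∈ closure Ω := by
    have hl : Tendsto (fun s : ℝ => k + s * (w - k)) (𝓝[>] 0) (𝓝 k) := by
      have : Continuous fun s : ℝ => k + s * (w - k) := by fun_prop
      simpa using (this.tendsto 0).mono_left (nhdsWithin_le_nhds (s := Set.Ioi 0))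
    refine mem_closure_of_tendsto hl ?_
    filter_upwards [Ioo_mem_nhdsGT (zero_lt_one' ℝ)] with s hs
    by_contra hcon
    have h1 := hmin _ hcon
    have h2 : w - (k + s * (w - k)) = ((1 - s : ℝ) : ℂ) * (w - k) := by
      push_cast
      ring
    rw [h2, norm_mul, Complex.norm_real, Real.norm_of_nonneg (by linarith [hs.2])] at h1
    have := norm_pos_iff.2 hwk
    nlinarith [hs.1]
  obtain ⟨y, rfl⟩ := h.closure_image_level_subset hx hkc hk
  refine ⟨y, ?_⟩
  set n := Complex.exp (L (x + y * Complex.I)) with hn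
  set d := w - F (x + y * Complex.I) with hd
  have hvert : HasDerivAt (fun t : ℝ => ‖F (x + t * Complex.I) - w‖ ^ 2)
      (2 * inner ℝ (F (x + y * Complex.I) - w) (Complex.I * n)) y :=
    ((h.hasDerivAt_vertical hx y).sub_const w).norm_sq
  have hhor : HasDerivAt (fun t : ℝ => ‖F (t + y * Complex.I) - w‖ ^ 2)
      (2 * inner ℝ (F (x + y * Complex.I) - w) n) x :=
    ((h.hasDerivAt_horizontal hx y).sub_const w).norm_sq
  have him : (d * conj n).im = 0 := by
    have h1 : IsLocalMin (fun t : ℝ => ‖F (x + t * Complex.I) - w‖ ^ 2) y := by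
      refine Eventually.of_forall fun t => ?_
      simp only
      rw [norm_sub_rev, norm_sub_rev (F (x + t * Complex.I))]
      exact pow_le_pow_left₀ (norm_nonneg _)
        (hmin _ (hnot _ (by simpa using hx) (by simp))) 2
    have h2 := h1.hasDerivAt_eq_zero hvert
    rw [Complex.inner] at h2
    simp only [map_sub, Complex.mul_re, Complex.mul_im, Complex.sub_re, Complex.sub_im,
      Complex.conj_re, Complex.conj_im, Complex.I_re, Complex.I_im, hd] at h2 ⊢
    linarith
  have hre : 0 ≤ (d * conj n).re := by
    by_contra hcon
    push Not at hcon
    have h1 : 0 < 2 * inner ℝ (F (x + y * Complex.I) - w) n := by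
      rw [Complex.inner]
      simp only [map_sub, Complex.mul_re, Complex.sub_re, Complex.sub_im,
        Complex.conj_re, Complex.conj_im, hd] at hcon ⊢
      linarith
    have hs := (hasDerivWithinAt_iff_tendsto_slope' (by simp)).1
      (hhor.hasDerivWithinAt (s := Set.Iio x))
    have h3 : ∀ᶠ t in 𝓝[<] x, 0 < t := nhdsWithin_le_nhds (lt_mem_nhds hx)
    have h5 : ∀ᶠ t in 𝓝[<] x, t < x := self_mem_nhdsWithin
    obtain ⟨t, ht, htx, ht0⟩ :=
      ((hs.eventually (lt_mem_nhds h1)).and (h5.and h3)).exists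
    rw [slope_def_field] at ht
    have h4 : ‖F (x + y * Complex.I) - w‖ ^ 2 ≤ ‖F (t + y * Complex.I) - w‖ ^ 2 := by
      rw [norm_sub_rev, norm_sub_rev (F (t + y * Complex.I))]
      exact pow_le_pow_left₀ (norm_nonneg _)
        (hmin _ (hnot _ (by simpa using ht0) (by simpa using htx.le))) 2
    exact absurd ht (not_lt.2 (div_nonpos_of_nonneg_of_nonpos (sub_nonneg.2 h4)
      (sub_nonpos.2 htx.le)))
  refine lt_of_le_of_ne hre fun h0 => ?_
  have h1 : d * conj n = 0 := Complex.ext h0.symm him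
  rcases mul_eq_zero.1 h1 with h2 | h2
  · exact hwk h2
  · rw [map_eq_zero] at h2
    exact Complex.exp_ne_zero _ h2

theorem image_rightHalfPlane (F : ℂ → ℂ) :
    F '' rightHalfPlane = ⋃ x : Set.Ioi (0 : ℝ), F '' {ζ | x.1 < ζ.re} := by
  ext w
  simp only [Set.mem_image, Set.mem_iUnion]
  constructor
  · rintro ⟨ζ, hζ, rfl⟩
    rw [mem_rightHalfPlane] at hζ
    exact ⟨⟨ζ.re / 2, half_pos hζ⟩, ζ, half_lt_self hζ, rfl⟩
  · rintro ⟨x, ζ, hζ, rfl⟩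
    exact ⟨ζ, show 0 < ζ.re from lt_trans x.2 hζ, rfl⟩

theorem mem_image_level_iff (h : IsMonotoneArg m β F L q) {x : ℝ} (hx : 0 < x) {w : ℂ} :
    w ∈ F '' {ζ | x < ζ.re} ↔ ∃ y : ℝ, 0 < ((w - F (x + y * Complex.I)) *
      conj (Complex.exp (L (x + y * Complex.I)))).re :=
  ⟨h.exists_mem_halfPlane hx, fun ⟨y, hy⟩ => h.halfPlane_subset_image_level hx y hy⟩

/-- The image is thus a union of open half planes, its complement an intersection of closed ones. -/
theorem mem_image_iff (h : IsMonotoneArg m β F L q) {w : ℂ} :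
    w ∈ F '' rightHalfPlane ↔ ∃ ζ ∈ rightHalfPlane, 0 < ((w - F ζ) *
      conj (Complex.exp (L ζ))).re := by
  rw [image_rightHalfPlane, Set.mem_iUnion]
  constructor
  · rintro ⟨x, hw⟩
    obtain ⟨y, hy⟩ := (h.mem_image_level_iff x.2).1 hw
    have hx : (0 : ℝ) < x.1 := x.2
    exact ⟨_, by simpa [mem_rightHalfPlane] using hx, hy⟩
  · rintro ⟨ζ, hζ, hw⟩
    refine ⟨⟨ζ.re, hζ⟩, (h.mem_image_level_iff hζ).2 ⟨ζ.im, ?_⟩⟩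
    simpa [Complex.re_add_im] using hw

theorem isConcaveHalfPlane (h : IsMonotoneArg m β F L q) : IsConcaveHalfPlane F where
  diff := h.differentiableOn
  inj := h.injOn
  tendsto := h.tendsto
  convex := by
    intro u hu v hv s t hs ht hst hmem
    rw [Set.mem_compl_iff, h.mem_image_iff] at hu hv
    push Not at hu hv
    obtain ⟨ζ, hζ, hpos⟩ := h.mem_image_iff.1 hmem
    have h1 := hu ζ hζ
    have h2 := hv ζ hζ
    have e : (s • u + t • v - F ζ) * conj (Complex.exp (L ζ)) =
        (s : ℂ) * ((u - F ζ) * conj (Complex.exp (L ζ))) +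
        (t : ℂ) * ((v - F ζ) * conj (Complex.exp (L ζ))) := by
      have : (s : ℂ) + t = 1 := by exact_mod_cast hst
      simp only [Complex.real_smul]
      linear_combination (F ζ) * conj (Complex.exp (L ζ)) * this
    rw [e, Complex.add_re, Complex.re_ofReal_mul, Complex.re_ofReal_mul] at hpos
    nlinarith [mul_nonneg hs (neg_nonneg.2 h1), mul_nonneg ht (neg_nonneg.2 h2)]

/-- `arg F'` is within `πm/2` of `β`, so these directions make an angle below `π/2` with every inner
normal and preserve each half plane in `mem_image_iff`. -/
theorem add_mem_image (h : IsMonotoneArg m β F L q) {w : ℂ} (hw : w ∈ F '' rightHalfPlane)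
    {θ : ℝ} (hθ : |θ - β| ≤ Real.pi * (1 - m) / 2) {t : ℝ} (ht : 0 ≤ t) :
    w + t * Complex.exp (θ * Complex.I) ∈ F '' rightHalfPlane := by
  obtain ⟨ζ, hζ, hpos⟩ := h.mem_image_iff.1 hw
  refine h.mem_image_iff.2 ⟨ζ, hζ, ?_⟩
  have e : (w + t * Complex.exp (θ * Complex.I) - F ζ) * conj (Complex.exp (L ζ)) =
      (w - F ζ) * conj (Complex.exp (L ζ)) +
        (t : ℂ) * (Complex.exp (θ * Complex.I) * conj (Complex.exp (L ζ))) := by ring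
  rw [e, Complex.add_re, Complex.re_ofReal_mul, re_exp_mul_conj_exp]
  have h1 := abs_lt.1 (h.abs_im_lt ζ hζ)
  have h2 := abs_le.1 hθ
  have h3 : (θ * Complex.I).im = θ := by simp
  rw [h3]
  refine add_pos_of_pos_of_nonneg hpos (mul_nonneg ht (mul_nonneg (Real.exp_pos _).le
    (Real.cos_nonneg_of_mem_Icc ⟨?_, ?_⟩)))
  · linarith [h1.2, h2.1]
  · linarith [h1.1, h2.2]

end IsMonotoneArg

/-! ### The opening angle at infinity -/

/-- Seen from a far point `r e^{iθ}` of the ray, `k` lies in direction `θ - π + ψ` with `ψ → 0`,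
within `δ` of `β`. If the far point were in `Ω`, so would be `k`. -/
theorem not_eventually_ray_mem {Ω : Set ℂ} {k : ℂ} (hk : k ∉ Ω) {β δ θ : ℝ}
    (h : ∀ w ∈ Ω, ∀ θ : ℝ, |θ - β| ≤ δ → ∀ t : ℝ, 0 ≤ t →
      w + t * Complex.exp (θ * Complex.I) ∈ Ω) (hθ : |θ - (β + Real.pi)| < δ) :
    ¬ ∀ᶠ r : ℝ in atTop, (r : ℂ) * Complex.exp (θ * Complex.I) ∈ Ω := by
  intro hev
  set e : ℂ := Complex.exp ((θ - Real.pi : ℝ) * Complex.I) with he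
  have he0 : e ≠ 0 := Complex.exp_ne_zero _
  have hneg : Complex.exp (θ * Complex.I) = -e := by
    have : (θ : ℂ) * Complex.I = (θ - Real.pi : ℝ) * Complex.I + Real.pi * Complex.I := by
      push_cast
      ring
    rw [this, Complex.exp_add, Complex.exp_pi_mul_I, he]
    ring
  have harg : Tendsto (fun r : ℝ => Complex.arg (1 + k / e / r)) atTop (𝓝 0) := by
    have h1 : Tendsto (fun r : ℝ => 1 + k / e / (r : ℂ)) atTop (𝓝 1) := by
      have h2 : Tendsto (fun r : ℝ => ((r⁻¹ : ℝ) : ℂ)) atTop (𝓝 0) := by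
        have := (Complex.continuous_ofReal.tendsto 0).comp tendsto_inv_atTop_zero
        rwa [Complex.ofReal_zero] at this
      simpa [div_eq_mul_inv k, div_eq_mul_inv _ (Complex.ofReal _)] using (h2.const_mul (k / e)).const_add 1
    have := (Complex.continuousAt_arg (x := 1) (by simp)).tendsto.comp h1
    rwa [Complex.arg_one] at this
  have hsmall := (tendsto_iff_norm_sub_tendsto_zero.1 harg).eventually
    (gt_mem_nhds (sub_pos.2 hθ))
  obtain ⟨r, hr, hrs, hr0⟩ := (hev.and (hsmall.and (eventually_gt_atTop 0))).exists
  set ψ := Complex.arg (1 + k / e / r) with hψ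
  refine hk ?_
  have h1 := h _ hr (θ - Real.pi + ψ) ?_ (r * ‖1 + k / e / r‖) (by positivity)
  · have h2 : ((r * ‖1 + k / e / r‖ : ℝ) : ℂ) *
        Complex.exp (((θ - Real.pi + ψ : ℝ) : ℂ) * Complex.I) = r * (1 + k / e / r) * e := by
      have h3 := Complex.norm_mul_exp_arg_mul_I (1 + k / e / r)
      have h4 : ((θ - Real.pi + ψ : ℝ) : ℂ) * Complex.I =
          (θ - Real.pi : ℝ) * Complex.I + ψ * Complex.I := by
        push_cast
        ring
      rw [h4, Complex.exp_add, ← he]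
      push_cast
      rw [← hψ] at h3
      linear_combination (r : ℂ) * e * h3
    rw [h2, hneg] at h1
    have h5 : (r : ℂ) * -e + r * (1 + k / e / r) * e = k := by
      have : (r : ℂ) ≠ 0 := by exact_mod_cast hr0.ne'
      field_simp
      ring
    rwa [h5] at h1
  · rw [sub_zero, Real.norm_eq_abs] at hrs
    have : θ - Real.pi + ψ - β = (θ - (β + Real.pi)) + ψ := by ring
    rw [this]
    exact (abs_add_le _ _).trans (by linarith)

theorem openingAngleAtInfty_le {Ω : Set ℂ} {k : ℂ} (hk : k ∉ Ω) {β δ : ℝ} (hδ0 : 0 ≤ δ)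
    (hδ : δ ≤ Real.pi) (h : ∀ w ∈ Ω, ∀ θ : ℝ, |θ - β| ≤ δ → ∀ t : ℝ, 0 ≤ t →
      w + t * Complex.exp (θ * Complex.I) ∈ Ω) :
    openingAngleAtInfty Ω ≤ 2 * Real.pi - 2 * δ := by
  set B : Set ℝ := {θ | Real.cos δ < Real.cos (θ - (β + Real.pi))} with hB
  have hBm : MeasurableSet B :=
    (isOpen_lt continuous_const (by fun_prop)).measurableSet
  have hper : ∀ θ, θ + 2 * Real.pi ∈ B ↔ θ ∈ B := fun θ => by
    change Real.cos δ < Real.cos (θ + 2 * Real.pi - (β + Real.pi)) ↔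
      Real.cos δ < Real.cos (θ - (β + Real.pi))
    rw [show θ + 2 * Real.pi - (β + Real.pi) = θ - (β + Real.pi) + 2 * Real.pi by ring,
      Real.cos_add_two_pi]
  have hbad : ∀ θ ∈ B, ¬ ∀ᶠ r : ℝ in atTop, (r : ℂ) * Complex.exp (θ * Complex.I) ∈ Ω := by
    intro θ hθ
    have hθ' : Real.cos δ < Real.cos (θ - (β + Real.pi)) := hθ
    set x := θ - (β + Real.pi) with hx
    set y := Complex.arg (Complex.exp (x * Complex.I)) with hy
    have hexp : Complex.exp (y * Complex.I) = Complex.exp (x * Complex.I) := by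
      have := Complex.norm_mul_exp_arg_mul_I (Complex.exp (x * Complex.I))
      rwa [Complex.norm_exp_ofReal_mul_I, Complex.ofReal_one, one_mul] at this
    have hcos : Real.cos y = Real.cos x := by
      have := congrArg Complex.re hexp
      rwa [Complex.exp_ofReal_mul_I_re, Complex.exp_ofReal_mul_I_re] at this
    have hyδ : |y| < δ := by
      by_contra hcon
      push Not at hcon
      have := Real.cos_le_cos_of_nonneg_of_le_pi hδ0 (Complex.abs_arg_le_pi _) hcon
      rw [← hy, Real.cos_abs, hcos] at this
      linarith
    have hθe : Complex.exp (θ * Complex.I) =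
        Complex.exp (((β + Real.pi + y : ℝ) : ℂ) * Complex.I) := by
      have h1 : (θ : ℂ) * Complex.I = ((β + Real.pi : ℝ) : ℂ) * Complex.I + x * Complex.I := by
        rw [hx]
        push_cast
        ring
      have h2 : ((β + Real.pi + y : ℝ) : ℂ) * Complex.I =
          ((β + Real.pi : ℝ) : ℂ) * Complex.I + y * Complex.I := by
        push_cast
        ring
      rw [h1, h2, Complex.exp_add, Complex.exp_add, hexp]
    rw [hθe]
    exact not_eventually_ray_mem hk h (by simpa using hyδ)
  have hvol : ENNReal.ofReal (2 * δ) ≤ volume (B ∩ Set.Ioc (-Real.pi) Real.pi) := by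
    rw [volume_inter_Ioc_eq_of_periodic hBm hper β]
    have hsub : Set.Ioo (β + Real.pi - δ) (β + Real.pi + δ) ⊆
        B ∩ Set.Ioc β (β + 2 * Real.pi) := by
      intro θ hθ
      refine ⟨?_, by linarith [hθ.1], by linarith [hθ.2]⟩
      change Real.cos δ < Real.cos (θ - (β + Real.pi))
      rw [← Real.cos_abs (θ - _)]
      refine Real.cos_lt_cos_of_nonneg_of_le_pi (abs_nonneg _) hδ ?_
      rw [abs_lt]
      exact ⟨by linarith [hθ.1], by linarith [hθ.2]⟩
    refine le_trans (le_of_eq ?_) (measure_mono hsub)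
    rw [Real.volume_Ioo]
    congr 1
    ring
  set A := B ∩ Set.Ioc (-Real.pi) Real.pi with hA
  have hAm : MeasurableSet A := hBm.inter measurableSet_Ioc
  have hsub : {θ : ℝ | θ ∈ Set.Ioc (-Real.pi) Real.pi ∧
      ∀ᶠ r : ℝ in atTop, (r : ℂ) * Complex.exp (θ * Complex.I) ∈ Ω} ⊆
      Set.Ioc (-Real.pi) Real.pi \ A := fun θ hθ => ⟨hθ.1, fun hc => hbad θ hc.1 hθ.2⟩
  have hle : volume {θ : ℝ | θ ∈ Set.Ioc (-Real.pi) Real.pi ∧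
      ∀ᶠ r : ℝ in atTop, (r : ℂ) * Complex.exp (θ * Complex.I) ∈ Ω} ≤
      ENNReal.ofReal (2 * Real.pi - 2 * δ) := by
    refine (measure_mono hsub).trans ?_
    have hAfin : volume A ≠ ⊤ :=
      ((measure_mono Set.inter_subset_right).trans_lt measure_Ioc_lt_top).ne
    rw [measure_sdiff Set.inter_subset_right hAm.nullMeasurableSet hAfin, Real.volume_Ioc,
      ENNReal.ofReal_sub (2 * Real.pi) (by linarith : 0 ≤ 2 * δ)]
    refine tsub_le_tsub (le_of_eq ?_) hvol
    congr 1
    ring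
  exact ENNReal.toReal_le_of_le_ofReal (by linarith) hle

theorem IsMonotoneArg.openingAngleAtInfty_le {m β : ℝ} {F L q : ℂ → ℂ}
    (h : IsMonotoneArg m β F L q) (hm : 0 ≤ m) :
    openingAngleAtInfty (F '' rightHalfPlane) ≤ Real.pi * (m + 1) := by
  obtain ⟨k, hk⟩ := h.isConcaveHalfPlane.compl_nonempty
  have hpi := Real.pi_pos
  have := _root_.openingAngleAtInfty_le hk (β := β) (δ := Real.pi * (1 - m) / 2)
    (by have := h.le_one; have : 0 ≤ 1 - m := by linarith
        positivity)
    (by nlinarith) fun w hw θ hθ t ht => h.add_mem_image hw hθ ht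
  linarith

/-! ### Products of powers of half plane variables -/

/-- That is, `Re ∏ w_j^{μ_j} ≥ ∏ (Re w_j)^{μ_j}`. After division by the moduli, Jensen is applied to
`cos` on `[-π/2, π/2]` and to `exp`, the missing mass `1 - ∑ μ_j` being placed at `0`. -/
theorem exp_sum_log_re_le {ι : Type*} [Fintype ι] {μ : ι → ℝ} (hμ : ∀ j, 0 ≤ μ j)
    (hμ1 : ∑ j, μ j ≤ 1) {w : ι → ℂ} (hw : ∀ j, 0 < (w j).re) :
    Real.exp (∑ j, μ j * Real.log (w j).re) ≤
      (Complex.exp (∑ j, (μ j : ℂ) * Complex.log (w j))).re := by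
  have hsum : (1 - ∑ j, μ j) + ∑ j, μ j = 1 := by ring
  have hnorm : ∀ j, 0 < ‖w j‖ := fun j => (hw j).trans_le (Complex.re_le_norm _)
  have hcos := strictConcaveOn_cos_Icc.concaveOn.map_add_sum_le (t := Finset.univ) (w := μ)
    (p := fun j => Complex.arg (w j)) (v := 1 - ∑ j, μ j) (q := 0) (fun j _ => hμ j) hsum
    (fun j _ => abs_le.1 (Complex.abs_arg_le_pi_div_two_iff.2 (hw j).le)) (by linarith)
    ⟨by linarith [Real.pi_pos], by linarith [Real.pi_pos]⟩
  have hexp := convexOn_exp.map_add_sum_le (t := Finset.univ) (w := μ)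
    (p := fun j => Real.log (w j).re - Real.log ‖w j‖) (v := 1 - ∑ j, μ j) (q := 0)
    (fun j _ => hμ j) hsum (fun j _ => Set.mem_univ _) (by linarith) (Set.mem_univ _)
  simp only [smul_eq_mul, mul_zero, zero_add, Real.cos_zero, Real.exp_zero, mul_one] at hcos hexp
  have heq : ∀ j, Real.exp (Real.log (w j).re - Real.log ‖w j‖) = Real.cos (Complex.arg (w j)) := by
    intro j
    rw [Complex.cos_arg (norm_pos_iff.1 (hnorm j)), Real.exp_sub, Real.exp_log (hw j),
      Real.exp_log (hnorm j)]
  simp only [heq] at hexp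
  have hle := hexp.trans hcos
  have hre : (∑ j, (μ j : ℂ) * Complex.log (w j)).re = ∑ j, μ j * Real.log ‖w j‖ := by
    simp [Complex.re_sum, Complex.log_re]
  have him : (∑ j, (μ j : ℂ) * Complex.log (w j)).im = ∑ j, μ j * Complex.arg (w j) := by
    simp [Complex.im_sum, Complex.log_im]
  rw [Complex.exp_re, hre, him]
  refine le_trans (le_of_eq ?_) (mul_le_mul_of_nonneg_left hle (Real.exp_pos _).le)
  rw [← Real.exp_add, ← Finset.sum_add_distrib]
  congr 1
  exact Finset.sum_congr rfl fun j _ => by ring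

/-- Integration along the segment from `1` to `ζ`: its first half lies in `Re ≥ 1/2`, so `|γ (F ζ -
F 1)| ≥ (c/2) |ζ - 1|`. -/
theorem tendsto_cobounded_of_re_deriv {F F' : ℂ → ℂ} {γ : ℂ} {c : ℝ} (hc : 0 < c)
    (hF : ∀ ζ ∈ rightHalfPlane, HasDerivAt F (F' ζ) ζ)
    (hpos : ∀ ζ ∈ rightHalfPlane, 0 ≤ (γ * F' ζ).re)
    (hge : ∀ ζ : ℂ, 1 / 2 ≤ ζ.re → c ≤ (γ * F' ζ).re) :
    Tendsto F (Bornology.cobounded ℂ ⊓ 𝓟 rightHalfPlane) (Bornology.cobounded ℂ) := by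
  have hγ : γ ≠ 0 := by
    rintro rfl
    have := hge 1 (by norm_num)
    simp at this
    linarith
  have hγ' := norm_pos_iff.2 hγ
  have key : ∀ ζ ∈ rightHalfPlane, c / 2 * ‖ζ - 1‖ ≤ ‖γ‖ * (‖F ζ‖ + ‖F 1‖) := by
    intro ζ hζ
    rcases eq_or_ne ζ 1 with rfl | hne
    · simp
      positivity
    have hba : ζ - 1 ≠ 0 := sub_ne_zero.2 hne
    have hre : ∀ t : ℝ, (1 + t * (ζ - 1)).re = 1 - t + t * ζ.re := fun t => by
      simp
      ring
    have hζ' : 0 < ζ.re := hζ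
    have hmem : ∀ t ∈ Set.Icc (0 : ℝ) 1, 1 + t * (ζ - 1) ∈ rightHalfPlane := fun t ht => by
      rw [mem_rightHalfPlane, hre]
      rcases ht.1.eq_or_lt with h | h
      · simp [← h]
      · have := mul_pos h hζ'
        linarith [ht.2]
    set g : ℝ → ℝ := fun t => (γ * (F (1 + t * (ζ - 1)) / (ζ - 1))).re with hg
    have hd : ∀ t ∈ Set.Icc (0 : ℝ) 1, HasDerivAt g (γ * F' (1 + t * (ζ - 1))).re t := by
      intro t ht
      have h1 : HasDerivAt (fun t : ℝ => 1 + (t : ℂ) * (ζ - 1)) (ζ - 1) t := by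
        simpa using ((Complex.ofRealCLM.hasDerivAt (x := t)).mul_const (ζ - 1)).const_add 1
      have h2 := (hF _ (hmem t ht)).scomp t h1
      have h3 := Complex.reCLM.hasFDerivAt.comp_hasDerivAt t ((h2.div_const (ζ - 1)).const_mul γ)
      refine h3.congr_deriv ?_
      rw [smul_eq_mul, mul_div_cancel_left₀ _ hba, Complex.reCLM_apply]
    have h1 : c * (1 / 2 - 0) ≤ g (1 / 2) - g 0 := by
      have hsub : Set.Icc (0 : ℝ) (1 / 2) ⊆ Set.Icc 0 1 := Set.Icc_subset_Icc_right (by norm_num)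
      refine (convex_Icc (0 : ℝ) (1 / 2)).mul_sub_le_image_sub_of_le_deriv
        (fun t ht => (hd t (hsub ht)).continuousAt.continuousWithinAt)
        (fun t ht => (hd t (hsub (interior_subset ht))).differentiableAt.differentiableWithinAt)
        (fun t ht => ?_) 0 (by norm_num) (1 / 2) (by norm_num) (by norm_num)
      have ht' := interior_subset ht
      rw [(hd t (hsub ht')).deriv]
      refine hge _ ?_
      rw [hre]
      have := mul_nonneg ht'.1 hζ'.le
      linarith [ht'.2]
    have h2 : g (1 / 2) ≤ g 1 := by
      have hmono : MonotoneOn g (Set.Icc 0 1) := by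
        refine monotoneOn_of_deriv_nonneg (convex_Icc _ _)
          (fun t ht => (hd t ht).continuousAt.continuousWithinAt)
          (fun t ht => (hd t (interior_subset ht)).differentiableAt.differentiableWithinAt)
          fun t ht => ?_
        rw [(hd t (interior_subset ht)).deriv]
        exact hpos _ (hmem t (interior_subset ht))
      exact hmono (by norm_num) (by norm_num) (by norm_num)
    have h3 : g 1 - g 0 = (γ * (F ζ - F 1) / (ζ - 1)).re := by
      simp only [hg]
      rw [← Complex.sub_re]
      congr 1
      simp
      ring
    have h4 : c / 2 ≤ ‖γ * (F ζ - F 1) / (ζ - 1)‖ :=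
      le_trans (by linarith) (Complex.re_le_norm _)
    rw [norm_div, le_div_iff₀ (norm_pos_iff.2 hba), norm_mul] at h4
    exact h4.trans (mul_le_mul_of_nonneg_left (norm_sub_le _ _) hγ'.le)
  rw [← tendsto_norm_atTop_iff_cobounded]
  have hlin : Tendsto (fun ζ : ℂ => c / (2 * ‖γ‖) * (‖ζ‖ - 1) - ‖F 1‖)
      (Bornology.cobounded ℂ ⊓ 𝓟 rightHalfPlane) atTop := by
    refine tendsto_atTop_add_const_right _ _ (Tendsto.const_mul_atTop (by positivity)
      (tendsto_atTop_add_const_right _ _ ?_))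
    exact tendsto_norm_cobounded_atTop.mono_left inf_le_left
  refine tendsto_atTop_mono' _ ?_ hlin
  filter_upwards [mem_inf_of_right (mem_principal_self rightHalfPlane)] with ζ hζ
  have h1 := key ζ hζ
  have h2 : ‖ζ‖ - 1 ≤ ‖ζ - 1‖ := by simpa using norm_sub_norm_le ζ 1
  have h3 := (mul_le_mul_of_nonneg_left h2 (half_pos hc).le).trans h1
  have e : c / (2 * ‖γ‖) * (‖ζ‖ - 1) = c / 2 * (‖ζ‖ - 1) / ‖γ‖ := by
    field_simp
  rw [e, sub_le_iff_le_add, div_le_iff₀ hγ']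
  linarith

theorem exists_isMonotoneArg {ι : Type*} [Fintype ι] {m : ℝ} (hm0 : 0 < m) (hm1 : m ≤ 1)
    (c : ι → ℝ) {μ : ι → ℝ} (hμ : ∀ j, 0 ≤ μ j) (hsum : ∑ j, μ j ≤ m) :
    ∃ (β : ℝ) (F L : ℂ → ℂ),
      IsMonotoneArg m β F L (fun ζ => ∑ j, (μ j : ℂ) / (ζ + c j * Complex.I)) ∧
      F 1 = 0 ∧ Complex.exp (L 1) = 1 / 2 := by
  set L₀ : ℂ → ℂ := fun ζ => ∑ j, (μ j : ℂ) * Complex.log (ζ + c j * Complex.I) with hL₀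
  -- The shift gives `exp (L 1) = 1/2`, compensating the derivative `2` of the Cayley transform at
  -- `0`.
  set L : ℂ → ℂ := fun ζ => L₀ ζ - L₀ 1 - (Real.log 2 : ℝ) with hL
  have hre : ∀ (ζ : ℂ) (j : ι), (ζ + c j * Complex.I).re = ζ.re := fun ζ j => by simp
  have hLd : ∀ ζ ∈ rightHalfPlane,
      HasDerivAt L (∑ j, (μ j : ℂ) / (ζ + c j * Complex.I)) ζ := by
    intro ζ hζ
    refine HasDerivAt.sub_const _ (HasDerivAt.sub_const _ ?_)
    refine HasDerivAt.fun_sum fun j _ => ?_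
    have h1 : HasDerivAt (fun ζ : ℂ => ζ + c j * Complex.I) 1 ζ := (hasDerivAt_id ζ).add_const _
    have h2 := (h1.clog (Or.inl (by rw [hre]; exact hζ))).const_mul (μ j : ℂ)
    exact h2.congr_deriv (by ring)
  have hLdiff : DifferentiableOn ℂ (fun ζ => Complex.exp (L ζ)) rightHalfPlane := fun ζ hζ =>
    (hLd ζ hζ).cexp.differentiableAt.differentiableWithinAt
  obtain ⟨Φ, hΦ⟩ := exists_primitive_rightHalfPlane hLdiff
  have hF : ∀ ζ ∈ rightHalfPlane, HasDerivAt (fun ζ => Φ ζ - Φ 1) (Complex.exp (L ζ)) ζ :=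
    fun ζ hζ => (hΦ ζ hζ).sub_const _
  have hexp : ∀ ζ, (2 * Complex.exp (L₀ 1)) * Complex.exp (L ζ) = Complex.exp (L₀ ζ) := by
    intro ζ
    have h1 : Complex.exp (Real.log 2 : ℝ) = 2 := by
      rw [← Complex.ofReal_exp, Real.exp_log two_pos]
      simp
    rw [hL, Complex.exp_sub, Complex.exp_sub, h1]
    field_simp
  have hlow : ∀ ζ ∈ rightHalfPlane,
      Real.exp ((∑ j, μ j) * Real.log ζ.re) ≤ ((2 * Complex.exp (L₀ 1)) * Complex.exp (L ζ)).re := by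
    intro ζ hζ
    rw [hexp]
    have := exp_sum_log_re_le hμ (hsum.trans hm1) (w := fun j => ζ + c j * Complex.I)
      fun j => by rw [hre]; exact hζ
    simp only [hre] at this
    rwa [← Finset.sum_mul] at this
  refine ⟨-(L₀ 1).im, fun ζ => Φ ζ - Φ 1, L, ⟨hm1, hF, hLd, fun ζ hζ => ?_, fun ζ hζ => ?_, ?_⟩,
    sub_self _, ?_⟩
  · rw [Complex.re_sum]
    refine Finset.sum_nonneg fun j _ => ?_
    rw [div_eq_mul_inv, Complex.re_ofReal_mul, Complex.inv_re, hre]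
    exact mul_nonneg (hμ j) (div_nonneg (le_of_lt hζ) (Complex.normSq_nonneg _))
  · have h1 : (L ζ).im - -(L₀ 1).im = ∑ j, μ j * Complex.arg (ζ + c j * Complex.I) := by
      simp only [hL, Complex.sub_im, Complex.ofReal_im]
      have : (L₀ ζ).im = ∑ j, μ j * Complex.arg (ζ + c j * Complex.I) := by
        simp [hL₀, Complex.im_sum, Complex.log_im]
      rw [this]
      ring
    have harg : ∀ j, |Complex.arg (ζ + c j * Complex.I)| < Real.pi / 2 := fun j =>
      Complex.abs_arg_lt_pi_div_two_iff.2 (Or.inl (by rw [hre]; exact hζ))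
    have hpi := Real.pi_pos
    rw [h1]
    refine (Finset.abs_sum_le_sum_abs _ _).trans_lt ?_
    simp only [abs_mul, abs_of_nonneg (hμ _)]
    by_cases hall : ∀ j, μ j = 0
    · simp only [hall, zero_mul, Finset.sum_const_zero]
      positivity
    · push Not at hall
      obtain ⟨i, hi⟩ := hall
      have h2 : ∑ j, μ j * |Complex.arg (ζ + c j * Complex.I)| < ∑ j, μ j * (Real.pi / 2) :=
        Finset.sum_lt_sum (fun j _ => mul_le_mul_of_nonneg_left (harg j).le (hμ j))
          ⟨i, Finset.mem_univ i, mul_lt_mul_of_pos_left (harg i) ((hμ i).lt_of_ne' hi)⟩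
      rw [← Finset.sum_mul] at h2
      nlinarith
  -- On `Re ζ ≥ 1/2` the lower bound is `(Re ζ)^{∑ μ_j} ≥ 1/2`, because `∑ μ_j ≤ 1`.
  · refine tendsto_cobounded_of_re_deriv (γ := 2 * Complex.exp (L₀ 1)) (c := 1 / 2) (by norm_num) hF
      (fun ζ hζ => (Real.exp_pos _).le.trans (hlow ζ hζ)) fun ζ hζ => ?_
    refine le_trans ?_ (hlow ζ (lt_of_lt_of_le (by norm_num) hζ))
    have h0 : (0 : ℝ) ≤ ∑ j, μ j := Finset.sum_nonneg fun j _ => hμ j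
    have h2 : -Real.log 2 ≤ (∑ j, μ j) * Real.log ζ.re := by
      have h3 : -Real.log 2 ≤ Real.log ζ.re := by
        rw [← Real.log_inv]
        exact Real.log_le_log (by norm_num) (by simpa using hζ)
      have h4 := Real.log_pos one_lt_two
      rcases le_total 0 (Real.log ζ.re) with h | h
      · have := mul_nonneg h0 h
        linarith
      · nlinarith [hsum.trans hm1]
    calc (1 / 2 : ℝ) = Real.exp (-Real.log 2) := by
          rw [Real.exp_neg, Real.exp_log two_pos, one_div]
      _ ≤ _ := Real.exp_le_exp.2 h2
  · have h2 := Complex.exp_ne_zero (L₀ 1)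
    have h3 : (2 * Complex.exp (L 1) - 1) * Complex.exp (L₀ 1) = 0 := by
      linear_combination hexp 1
    rcases mul_eq_zero.1 h3 with h | h
    · linear_combination h / 2
    · exact absurd h h2

/-! ### Concave functions with prescribed pre-Schwarzian derivative -/

theorem tendsto_cayley_cobounded :
    Tendsto cayley (𝓝[unitDisk] 1) (Bornology.cobounded ℂ ⊓ 𝓟 rightHalfPlane) := by
  refine tendsto_inf.2 ⟨?_, tendsto_principal.2 ?_⟩
  · rw [← tendsto_norm_atTop_iff_cobounded]
    have h1 : Tendsto (fun z : ℂ => ‖1 + z‖) (𝓝[unitDisk] 1) (𝓝 2) := by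
      have : Continuous fun z : ℂ => ‖1 + z‖ := by fun_prop
      have h := (this.tendsto 1).mono_left (nhdsWithin_le_nhds (s := unitDisk))
      norm_num at h
      exact h
    have h2 : Tendsto (fun z : ℂ => ‖1 - z‖) (𝓝[unitDisk] 1) (𝓝[>] 0) := by
      refine tendsto_nhdsWithin_iff.2 ⟨?_, ?_⟩
      · have : Continuous fun z : ℂ => ‖1 - z‖ := by fun_prop
        simpa using (this.tendsto 1).mono_left (nhdsWithin_le_nhds (s := unitDisk))
      · filter_upwards [self_mem_nhdsWithin] with z hz
        exact norm_pos_iff.2 (one_sub_ne_zero_of_mem_unitDisk hz)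
    refine (h1.pos_mul_atTop two_pos (tendsto_inv_nhdsGT_zero.comp h2)).congr fun z => ?_
    rw [cayley, norm_div, div_eq_mul_inv]
    rfl
  · filter_upwards [self_mem_nhdsWithin] with z hz
    exact cayley_mem hz

theorem image_comp_cayley (F : ℂ → ℂ) :
    (fun z => F (cayley z)) '' unitDisk = F '' rightHalfPlane := by
  ext w
  constructor
  · rintro ⟨z, hz, rfl⟩
    exact ⟨_, cayley_mem hz, rfl⟩
  · rintro ⟨ζ, hζ, rfl⟩
    exact ⟨_, cayleyInv_mem hζ, by simp only [cayley_cayleyInv hζ]⟩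

theorem IsMonotoneArg.isConcaveUnivalent {m β : ℝ} {F L q : ℂ → ℂ} (h : IsMonotoneArg m β F L q)
    (hm : 0 ≤ m) (h1 : F 1 = 0) (hL : Complex.exp (L 1) = 1 / 2) :
    IsConcaveUnivalent (m + 1) fun z => F (cayley z) where
  analytic := fun z hz => (hasDerivAt_comp_cayley h.differentiableOn (fun _ _ => rfl)
    hz).differentiableAt.differentiableWithinAt
  map_zero := by simpa [cayley] using h1
  deriv_zero := by
    rw [(hasDerivAt_comp_cayley h.differentiableOn (fun _ _ => rfl)
      (show (0 : ℂ) ∈ unitDisk by simp [unitDisk])).deriv]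
    have : cayley 0 = 1 := by simp [cayley]
    rw [this, (h.hasDerivAt 1 (by simp [mem_rightHalfPlane])).deriv, hL]
    norm_num
  pole := h.tendsto.comp tendsto_cayley_cobounded
  univalent := fun z hz w hw hzw => by
    rw [← cayleyInv_cayley hz, ← cayleyInv_cayley hw, h.injOn (cayley_mem hz) (cayley_mem hw) hzw]
  convex_compl := by
    rw [image_comp_cayley]
    exact h.isConcaveHalfPlane.convex
  opening_angle := by
    rw [image_comp_cayley]
    exact h.openingAngleAtInfty_le hm

theorem IsMonotoneArg.preSchwarzian_comp_cayley {m β : ℝ} {F L q : ℂ → ℂ}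
    (h : IsMonotoneArg m β F L q) {z : ℂ} (hz : z ∈ unitDisk) :
    preSchwarzian (fun z => F (cayley z)) z =
      q (cayley z) * (2 / (1 - z) ^ 2) + 2 / (1 - z) := by
  have hd : deriv F (cayley z) = Complex.exp (L (cayley z)) :=
    (h.hasDerivAt _ (cayley_mem hz)).deriv
  have hdd : deriv (deriv F) (cayley z) = Complex.exp (L (cayley z)) * q (cayley z) := by
    refine HasDerivAt.deriv ?_
    refine (h.hasDerivAt_log _ (cayley_mem hz)).cexp.congr_of_eventuallyEq ?_
    filter_upwards [isOpen_rightHalfPlane.mem_nhds (cayley_mem hz)] with ζ hζ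
    exact (h.hasDerivAt ζ hζ).deriv
  rw [_root_.preSchwarzian_comp_cayley h.differentiableOn (fun _ _ => rfl) hz
    (by rw [hd]; exact Complex.exp_ne_zero _)]
  congr 2
  rw [preSchwarzian, hd, hdd]
  field_simp

theorem one_sub_mul_ne_zero {e z : ℂ} (he : ‖e‖ = 1) (hz : z ∈ unitDisk) : 1 - e * z ≠ 0 := by
  refine one_sub_ne_zero_of_mem_unitDisk ?_
  rw [unitDisk, mem_ball_zero_iff, norm_mul, he, one_mul]
  exact mem_ball_zero_iff.1 hz

/-- For `e ≠ 1` the number `(1 + e)/(1 - e)` is imaginary and the factor vanishes at `z = conj e`.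
The value `e = 1` corresponds to infinity and contributes nothing, hence the conditional. -/
theorem div_cayley_add {e z : ℂ} (he : ‖e‖ = 1) (hz : z ∈ unitDisk) :
    (if e = 1 then (0 : ℂ) else 1) / (cayley z + ((1 + e) / (1 - e)).im * Complex.I) *
      (2 / (1 - z) ^ 2) = 1 / (1 - z) - e / (1 - e * z) := by
  split_ifs with h1
  · simp [h1]
  have hc : ((1 + e) / (1 - e) : ℂ) = ((1 + e) / (1 - e)).im * Complex.I := by
    have he0 : e ≠ 0 := by
      rintro rfl
      simp at he
    have hconj : conj e = e⁻¹ := by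
      rw [Complex.inv_def, Complex.normSq_eq_norm_sq, he]
      simp
    have h2 : 1 - e ≠ 0 := sub_ne_zero.2 (Ne.symm h1)
    have h3 : e - 1 ≠ 0 := sub_ne_zero.2 h1
    have h4 : conj ((1 + e) / (1 - e)) = -((1 + e) / (1 - e)) := by
      rw [map_div₀, map_add, map_sub, map_one, hconj, ← div_neg, neg_sub]
      have h5 : 1 - e⁻¹ ≠ 0 := by
        rw [sub_ne_zero]
        intro h
        exact h1 (inv_eq_one.1 h.symm)
      rw [div_eq_div_iff h5 h3]
      field_simp
      ring
    have h6 : ((1 + e) / (1 - e)).re = 0 := by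
      have := congrArg Complex.re h4
      rw [Complex.conj_re, Complex.neg_re] at this
      linarith
    apply Complex.ext <;> simp [h6]
  have h2 : 1 - e ≠ 0 := sub_ne_zero.2 (Ne.symm h1)
  have h3 := one_sub_ne_zero_of_mem_unitDisk hz
  have h4 := one_sub_mul_ne_zero he hz
  have h5 : cayley z + ((1 + e) / (1 - e)).im * Complex.I =
      2 * (1 - e * z) / ((1 - z) * (1 - e)) := by
    rw [← hc, cayley]
    field_simp
    ring
  rw [h5]
  field_simp
  ring

theorem exists_isConcaveUnivalent {ι : Type*} [Fintype ι] {α : ℝ} (hα₁ : 1 < α) (hα₂ : α ≤ 2)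
    {e : ι → ℂ} {t : ι → ℝ} (he : ∀ j, ‖e j‖ = 1) (ht : ∀ j, 0 ≤ t j) (hsum : ∑ j, t j = 1) :
    ∃ f, IsConcaveUnivalent α f ∧ ∀ z ∈ unitDisk, preSchwarzian f z =
      (α + 1) / (1 - z) - (α - 1) * ∑ j, t j * (e j / (1 - e j * z)) := by
  have hm : 0 < α - 1 := by linarith
  -- Mass at `e = 1` is discarded, which is why only `∑ μ_j ≤ α - 1` holds.
  set μ : ι → ℝ := fun j => (α - 1) * t j * if e j = 1 then 0 else 1 with hμ
  have hle : ∀ j, μ j ≤ (α - 1) * t j := fun j => by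
    refine mul_le_of_le_one_right (mul_nonneg hm.le (ht j)) ?_
    split_ifs <;> norm_num
  obtain ⟨β, F, L, h, hF1, hL1⟩ := exists_isMonotoneArg (m := α - 1) hm (by linarith)
    (fun j => ((1 + e j) / (1 - e j)).im) (μ := μ)
    (fun j => mul_nonneg (mul_nonneg hm.le (ht j)) (by split_ifs <;> norm_num))
    ((Finset.sum_le_sum fun j _ => hle j).trans (by rw [← Finset.mul_sum, hsum, mul_one]))
  refine ⟨fun z => F (cayley z), by simpa using h.isConcaveUnivalent hm.le hF1 hL1, fun z hz => ?_⟩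
  rw [h.preSchwarzian_comp_cayley hz, Finset.sum_mul]
  have hterm : ∀ j, ((μ j : ℝ) : ℂ) / (cayley z + ((1 + e j) / (1 - e j)).im * Complex.I) *
      (2 / (1 - z) ^ 2) = (α - 1) / (1 - z) * t j - (α - 1) * (t j * (e j / (1 - e j * z))) := by
    intro j
    have h1 := div_cayley_add (he j) hz
    have h2 : ((μ j : ℝ) : ℂ) = (α - 1) * t j * if e j = 1 then 0 else 1 := by
      simp only [hμ]
      push_cast
      split_ifs <;> simp
    rw [h2, mul_div_assoc, mul_assoc, h1]
    ring
  have hsumC : ∑ j, (t j : ℂ) = 1 := by exact_mod_cast hsum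
  simp only [hterm]
  rw [Finset.sum_sub_distrib, ← Finset.mul_sum, ← Finset.mul_sum, hsumC]
  ring

/-! ### Two-point measures for the boundary circle -/

theorem exists_unimodular_pair {a c : ℂ} (ha : ‖a‖ ≤ 1) (hc : ‖c‖ = 1) :
    ∃ (e₁ e₂ : ℂ) (t : ℝ), ‖e₁‖ = 1 ∧ ‖e₂‖ = 1 ∧ 0 ≤ t ∧ t ≤ 1 ∧ e₁ * e₂ = c ∧
      e₁ + e₂ = -(a + conj a * c) ∧ t * e₁ + (1 - t) * e₂ = -a := by
  -- The target is `1 + (a + conj a c) z + c z² = (1 - e₁ z)(1 - e₂ z)`. With `γ² = c` and `a = γ b`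
  -- the linear coefficient is `2γ Re b`, so `e₁, e₂ = γ (-Re b ± i s)`, unimodular since `|Re b| ≤
  -- 1`.
  obtain ⟨γ, hγ⟩ := IsAlgClosed.exists_pow_nat_eq c two_pos
  have hγ1 : ‖γ‖ = 1 := by
    have h1 := congrArg norm hγ
    rw [norm_pow, hc] at h1
    exact (pow_eq_one_iff_of_nonneg (norm_nonneg _) two_ne_zero).1 h1
  have hγγ : γ * conj γ = 1 := by
    rw [Complex.mul_conj', hγ1]
    simp
  set b := a * conj γ with hb
  have hab : a = γ * b := by
    rw [hb]
    linear_combination -a * hγγ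
  have hb1 : b.re ^ 2 + b.im ^ 2 ≤ 1 := by
    have h1 : ‖b‖ ≤ 1 := by rwa [hb, norm_mul, RCLike.norm_conj, hγ1, mul_one]
    have h2 : ‖b‖ ^ 2 ≤ 1 := pow_le_one₀ (norm_nonneg _) h1
    rw [Complex.sq_norm, Complex.normSq_apply] at h2
    linarith
  set s := Real.sqrt (1 - b.re ^ 2) with hs
  have hs0 : 0 ≤ s := Real.sqrt_nonneg _
  have hs2 : s ^ 2 = 1 - b.re ^ 2 := Real.sq_sqrt (by nlinarith [sq_nonneg b.im])
  have him : |b.im| ≤ s := abs_le_of_sq_le_sq (by linarith) hs0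
  have hdiv : |b.im / s| ≤ 1 := by
    rw [abs_div, abs_of_nonneg hs0]
    exact div_le_one_of_le₀ him hs0
  have hmul : b.im / s * s = b.im := by
    rcases hs0.eq_or_lt with h | h
    · rw [← h, abs_nonpos_iff] at him
      simp [him]
    · exact div_mul_cancel₀ _ h.ne'
  have hsC : (s : ℂ) ^ 2 = 1 - (b.re : ℂ) ^ 2 := by exact_mod_cast hs2
  have hunit : ∀ x : ℝ, x ^ 2 = 1 - b.re ^ 2 → ‖γ * (-b.re + x * Complex.I)‖ = 1 := by
    intro x hx
    rw [norm_mul, hγ1, one_mul]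
    refine (pow_eq_one_iff_of_nonneg (norm_nonneg _) two_ne_zero).1 ?_
    rw [Complex.sq_norm, Complex.normSq_apply]
    simp
    linarith
  -- The mean condition asks for `(2t - 1) s = -Im b`. If `s = 0` then `Im b = 0`, and division by
  -- zero gives `t = 1/2`.
  refine ⟨γ * (-b.re + s * Complex.I), γ * (-b.re + (-s : ℝ) * Complex.I), (1 - b.im / s) / 2,
    hunit s hs2, hunit (-s) (by rw [neg_sq, hs2]), ?_, ?_, ?_, ?_, ?_⟩
  · linarith [(abs_le.1 hdiv).2]
  · linarith [(abs_le.1 hdiv).1]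
  · push_cast
    linear_combination hγ + γ ^ 2 * hsC - γ ^ 2 * s ^ 2 * Complex.I_sq
  · have h1 : conj a * c = γ * conj b := by
      rw [hab, ← hγ, map_mul]
      linear_combination γ * conj b * hγγ
    have h2 := Complex.add_conj b
    rw [h1]
    push_cast at h2 ⊢
    linear_combination γ * h2 + hab
  · have h1 : ((b.im / s : ℝ) : ℂ) * s = b.im := by exact_mod_cast hmul
    have h2 := Complex.re_add_im b
    rw [hab]
    push_cast at h1 ⊢
    linear_combination -γ * Complex.I * h1 - γ * h2

/-- A linear equation for `cz`. Its two sides have coefficients of modulus ratio `‖z‖`, since `ε C -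
‖z‖ A = ε conj (conj C - ‖z‖ ε conj A)`; the coefficient is nonzero because `‖C‖ > ‖z‖ ‖A‖`. -/
theorem exists_unimodular_deviation {a z : ℂ} (ha : ‖a‖ ≤ 1) (hz : ‖z‖ < 1) {ε : ℂ}
    (hε : ‖ε‖ = 1) : ∃ c : ℂ, ‖c‖ = 1 ∧
      conj (1 + a * z) * (c * z) + (‖z‖ : ℂ) ^ 2 * (a + conj z) =
        ‖z‖ * ε * ((1 + a * z) + conj (a + conj z) * (c * z)) := by
  rcases eq_or_ne z 0 with rfl | hz0
  · exact ⟨1, by simp, by simp⟩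
  set A := a + conj z with hA
  set C := 1 + a * z with hC
  have hεε : conj ε * ε = 1 := by
    rw [Complex.conj_mul', hε]
    simp
  have hden : conj C - ‖z‖ * ε * conj A ≠ 0 := by
    intro h
    have h1 : ‖C‖ = ‖z‖ * ‖A‖ := by
      have := congrArg norm (sub_eq_zero.1 h)
      simpa [hε] using this
    have h2 := normSq_sub_mul_normSq a z
    rw [← hA, ← hC, h1] at h2
    have h3 : 0 < (1 - ‖z‖ ^ 2) * (1 + ‖z‖ ^ 2 + 2 * (a * z).re) :=
      mul_pos (by nlinarith [norm_nonneg z]) (variability_denom_pos ha hz)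
    rw [← h2] at h3
    nlinarith
  have hnum : ‖ε * C - ‖z‖ * A‖ = ‖conj C - ‖z‖ * ε * conj A‖ := by
    have h1 : ε * C - ‖z‖ * A = ε * conj (conj C - ‖z‖ * ε * conj A) := by
      simp only [map_sub, map_mul, Complex.conj_conj, Complex.conj_ofReal]
      linear_combination ‖z‖ * A * hεε
    rw [h1, norm_mul, hε, one_mul, RCLike.norm_conj]
  have hz0' : (‖z‖ : ℂ) ≠ 0 := by exact_mod_cast norm_ne_zero_iff.2 hz0
  refine ⟨‖z‖ * (ε * C - ‖z‖ * A) / (conj C - ‖z‖ * ε * conj A) / z, ?_, ?_⟩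
  · rw [norm_div, norm_div, norm_mul, hnum, Complex.norm_real, norm_norm,
      mul_div_cancel_right₀ _ (norm_ne_zero_iff.2 hden), div_self (norm_ne_zero_iff.2 hz0)]
  · rw [div_mul_cancel₀ _ hz0]
    field_simp
    ring

/-- Each boundary point of the disk of variability arises from a two-point measure. -/
theorem exists_boundary_pair {α : ℝ} {a z : ℂ} (ha : ‖a‖ ≤ 1) (hz : z ∈ unitDisk)
    {ε : ℂ} (hε : ‖ε‖ = 1) :
    ∃ (e₁ e₂ : ℂ) (t : ℝ), ‖e₁‖ = 1 ∧ ‖e₂‖ = 1 ∧ 0 ≤ t ∧ t ≤ 1 ∧ t * e₁ + (1 - t) * e₂ = -a ∧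
      (1 - (‖z‖ : ℂ) ^ 2) * ((α + 1) / (1 - z) -
        (α - 1) * (t * (e₁ / (1 - e₁ * z)) + (1 - t) * (e₂ / (1 - e₂ * z)))) =
      variabilityCenter α a z + variabilityRadius α a z * ε := by
  have hz1 : ‖z‖ < 1 := mem_ball_zero_iff.1 hz
  obtain ⟨c, hc, hdev⟩ := exists_unimodular_deviation ha hz1 hε
  obtain ⟨e₁, e₂, t, he₁, he₂, ht0, ht1, hprod, hadd, hmean⟩ := exists_unimodular_pair ha hc
  refine ⟨e₁, e₂, t, he₁, he₂, ht0, ht1, hmean, ?_⟩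
  have h1 := one_sub_mul_ne_zero he₁ hz
  have h2 := one_sub_mul_ne_zero he₂ hz
  -- `φ = (a + cz)/B` is the extremal case of Schwarz-Pick, and `(1 + zφ) B` factors as `(1 - e₁
  -- z)(1 - e₂ z)`.
  set B := 1 + conj a * (c * z) with hB
  have hB0 : B ≠ 0 := by
    refine one_add_ne_zero_of_norm_lt_one ?_
    rw [norm_mul, norm_mul, hc, one_mul, RCLike.norm_conj]
    nlinarith [norm_nonneg z]
  set φ := (a + c * z) / B with hφ
  have hq : (1 - e₁ * z) * (1 - e₂ * z) = B + z * (a + c * z) := by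
    linear_combination z ^ 2 * hprod - z * hadd
  have hφ1 : (1 + z * φ) * B = (1 - e₁ * z) * (1 - e₂ * z) := by
    rw [hq, hφ]
    field_simp
  have hφ0 : 1 + z * φ ≠ 0 := fun h => by
    rw [h, zero_mul] at hφ1
    exact mul_ne_zero h1 h2 hφ1.symm
  have hφB : φ * B = a + c * z := div_mul_cancel₀ _ hB0
  have hsum : t * (e₁ / (1 - e₁ * z)) + (1 - t) * (e₂ / (1 - e₂ * z)) = -(φ / (1 + z * φ)) := by
    have h3 : φ / (1 + z * φ) = (a + c * z) / ((1 - e₁ * z) * (1 - e₂ * z)) := by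
      rw [← hφ1, ← hφB, mul_div_mul_right _ _ hB0]
    rw [h3, ← neg_div, eq_div_iff (mul_ne_zero h1 h2)]
    have h4 : ∀ p q : ℂ, p ≠ 0 → q ≠ 0 → (t * (e₁ / p) + (1 - t) * (e₂ / q)) * (p * q) =
        t * e₁ * q + (1 - t) * e₂ * p := fun p q hp hq => by
      field_simp
    rw [h4 _ _ h1 h2]
    linear_combination hmean - z * hprod
  have hcen := sub_variabilityCenter (α := α) ha hz1 hφ0
  have hD : ((1 + ‖z‖ ^ 2 + 2 * (a * z).re : ℝ) : ℂ) ≠ 0 := by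
    exact_mod_cast (variability_denom_pos ha hz1).ne'
  have hdev' : deviation a z φ = (1 - ‖a‖ ^ 2 : ℝ) * ‖z‖ * ε * (1 + z * φ) := by
    have e2 : (‖a‖ : ℂ) ^ 2 = a * conj a := (Complex.mul_conj' a).symm
    apply mul_right_cancel₀ hB0
    have h5 : (φ - a) * B = (1 - a * conj a) * (c * z) := by
      linear_combination hφB
    have h6 : (1 - conj a * φ) * B = 1 - a * conj a := by
      linear_combination -conj a * hφB
    have h7 : (1 + z * φ) * B = (1 + a * z) + conj (a + conj z) * (c * z) := by
      simp only [map_add, Complex.conj_conj]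
      linear_combination z * hφB
    rw [deviation]
    push_cast
    rw [e2]
    linear_combination conj (1 + a * z) * h5 + (‖z‖ : ℂ) ^ 2 * (a + conj z) * h6 +
      (1 - a * conj a) * hdev - (1 - a * conj a) * ‖z‖ * ε * h7
  rw [hsum, mul_neg, sub_neg_eq_add, ← sub_eq_iff_eq_add', hcen, hdev', variabilityRadius]
  rw [mul_div_mul_right _ _ hφ0]
  push_cast at hD ⊢
  field_simp

/-! ### The set of variability -/

theorem mainTheorem3 (α : ℝ) (hα₁ : 1 < α) (hα₂ : α ≤ 2) (a : ℂ) (ha : ‖a‖ ≤ 1)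
    (z : ℂ) (hz : z ∈ unitDisk) :
    {w : ℂ | ∃ f : ℂ → ℂ, IsConcaveUnivalent α f ∧
        deriv (deriv f) 0 = (α : ℂ) + 1 + ((α : ℂ) - 1) * a ∧
        w = (1 - (‖z‖ : ℂ) ^ 2) * preSchwarzian f z} =
      Metric.closedBall (variabilityCenter α a z) (variabilityRadius α a z) := by
  apply Set.Subset.antisymm
  · rintro w ⟨f, hf, hfa, rfl⟩
    exact hf.mem_closedBall hα₁ ha hz hfa
  intro w hw
  rw [mem_closedBall_iff_norm] at hw
  set R := variabilityRadius α a z with hR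
  have hR0 : 0 ≤ R := (norm_nonneg _).trans hw
  -- If `R = 0`, division by zero gives `v = 0`, and `w` is the center.
  set v := (w - variabilityCenter α a z) / R with hv
  have hvR : R * v = w - variabilityCenter α a z := by
    rcases hR0.eq_or_lt with h | h
    · rw [← h, norm_le_zero_iff] at hw
      simp [hw, ← h]
    · exact mul_div_cancel₀ _ (by exact_mod_cast h.ne')
  have hv1 : ‖v‖ ≤ 1 := by
    rw [hv, norm_div, Complex.norm_real, Real.norm_of_nonneg hR0]
    exact div_le_one_of_le₀ hw hR0
  set ε := Complex.exp (Complex.arg v * Complex.I) with hε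
  have hε1 : ‖ε‖ = 1 := Complex.norm_exp_ofReal_mul_I _
  have hvε : ‖v‖ * ε = v := Complex.norm_mul_exp_arg_mul_I v
  obtain ⟨e₁, e₂, t, he₁, he₂, ht0, ht1, hm, hb⟩ := exists_boundary_pair (α := α) ha hz hε1
  obtain ⟨e₃, e₄, u, he₃, he₄, hu0, hu1, hm', hb'⟩ :=
    exists_boundary_pair (α := α) ha hz (ε := -ε) (by rwa [norm_neg])
  -- `w` is the mixture with weights `l` and `1 - l` of the antipodal boundary points in directions
  -- `ε` and `-ε`, because `2l - 1 = ‖v‖`. The two measures are mixed likewise into one with four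
  -- points.
  set l := (1 + ‖v‖) / 2 with hl
  have hl0 : 0 ≤ l := by positivity
  have hl1 : 0 ≤ 1 - l := by linarith
  obtain ⟨f, hf, hfs⟩ := exists_isConcaveUnivalent hα₁ hα₂ (e := ![e₁, e₂, e₃, e₄])
    (t := ![l * t, l * (1 - t), (1 - l) * u, (1 - l) * (1 - u)])
    (by simp [Fin.forall_fin_succ, he₁, he₂, he₃, he₄])
    (by
      have h1 := mul_nonneg hl0 ht0
      have h2 := mul_nonneg hl0 (sub_nonneg.2 ht1)
      have h3 := mul_nonneg hl1 hu0
      have h4 := mul_nonneg hl1 (sub_nonneg.2 hu1)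
      simp [Fin.forall_fin_succ, h1, h2, h3, h4])
    (by
      simp [Fin.sum_univ_four]
      ring)
  simp only [Fin.sum_univ_four, Matrix.cons_val] at hfs
  push_cast at hfs
  refine ⟨f, hf, ?_, ?_⟩
  · have h0 := hfs 0 (by simp [unitDisk])
    rw [preSchwarzian, hf.deriv_zero] at h0
    simp only [div_one, mul_zero, sub_zero] at h0
    rw [h0]
    linear_combination -(α - 1 : ℂ) * (l * hm + (1 - l) * hm')
  · rw [hfs z hz]
    have hlC : (2 : ℂ) * l - 1 = ‖v‖ := by
      rw [hl]
      push_cast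
      ring
    linear_combination -hvR - l * hb - (1 - l) * hb' - R * (ε * hlC + hvε)

end
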